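/- **Setting.** Minkowski space is $\mathbb R^4$ with $\eta=\mathrm{diag}(1,-1,-1,-1)$. Let $\xi_1,\dots,\xi_N$ be a basis of a complex Lie algebra with $[\xi_a,\xi_b]=i\sum_c f_{abc}\xi_c$, where $f_{abc}$ is real and totally antisymmetric; for Lie-algebra valued $X=\sum_a X_a\xi_a$, $Y=\sum_a Y_a\xi_a$ put $\langle X|Y\rangle=\sum_a X_aY_a$ and $i[X,Y]=-\sum_{abc} f_{abc}X_aY_b\,\xi_c$. Let $\pi$ be a matrix representation and $\gamma^\mu$ Dirac matrices. Let $u$ be a timelike unit vector ($u^2=1$), and let $c(e)\,d\sigma(e)$ be a real smearing of total weight $1$ over the directions $e$ with $e^2=-1$, $e\cdot u=0$. Put $(I_vh)(x)=\int_0^\infty h(x+sv)\,ds$, $I_u^\nu=u^\nu I_u$, $I_c^\nu=\int d\sigma(e)\,c(e)\,e^\nu I_e$; primed operators act on the variable $x'$, and $\delta=\delta(x-x')$. $\mathfrak S$ denotes symmetrization in $(x,x')$: $\mathfrak S D=\frac12\big(D(x,x')+D(x',x)\big)$. **Fields.** The free fields are: the Feynman gauge potential $A^K_\mu$, with $\square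 A^K_\mu=0$, and massless quark fields $\psi,\bar\psi$; from them $$A_\mu=A^K_\mu+u_\mu I_u(\partial^\kappa A^K_\kappa),\quad F_{\mu\nu}=\partial_\mu A_\nu-\partial_\nu A_\mu,\quad \phi=I_c^\nu A^K_\nu,\quad A_\mu(c)=I_c^\nu F_{\mu\nu},\quad j^\mu_a=\bar\psi\gamma^\mu\pi(\xi_a)\psi .$$ Wick polynomials are polynomials in the linear free fields, identified with their normal-ordered symbols, i.e. with their values on the smooth solutions of the free field equations for which the string integrals converge, locally uniformly with all derivatives ($I_u(\partial^\kappa A^K_\kappa)$ vanishing at infinity in the directions $e$). Put $$A_{\mu\nu}(c)=i[A_\mu(c),A_\nu(c)],\qquad A_{\mu\nu}=i[A_\mu,A_\nu],\qquad \sigma_\nu=i[\phi,A_\nu(c)+A_\nu],$$ $$J_\mu(c)=j_\mu-i[F_{\mu\nu},A^\nu(c)],\qquad J_\mu=j_\mu-i[F_{\mu\nu},A^\nu].$$ The first-order data are $$L_1=\tfrac12\langle F^{\mu\nu}|A_{\mu\nu}(c)\rangle+\langle A_\mu(c)|j^\mu\rangle,\quad K_1=\tfrac12\langle F^{\mu\nu}|A_{\mu\nu}\rangle+\langle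 A_\mu|j^\mu\rangle,\quad U_1^\mu=\tfrac12\langle F^{\mu\nu}|\sigma_\nu\rangle+\langle\phi|j^\mu\rangle .$$ **Obstruction map.** For Wick polynomials $Y^\mu$ and $X$, at tree level, $$O_Y(X')=\sum_{\varphi,\chi}\frac{\partial Y^\mu}{\partial\varphi}(x)\,O_\mu(\varphi(x),\chi(x'))\,\frac{\partial X}{\partial\chi}(x'),$$ the sum running over the linear free fields. The two-point obstructions $O_\mu(\varphi,\chi')$ are distributions; in the colour indices the gluonic ones are multiples of $\delta_{ab}$. With vanishing renormalization constant of $\langle TFF'\rangle$, and $B^{[\kappa}C^{\lambda]}=B^\kappa C^\lambda-B^\lambda C^\kappa$, they satisfy $$O_\mu(F^{\mu\nu},F'^{\kappa\lambda})=-\eta^{\nu[\kappa}\partial^{\lambda]}i\delta,\qquad O_\mu(F^{\mu\nu},A'^\kappa(c))=-(\eta^{\nu\kappa}-I'^\nu_c\partial^\kappa)i\delta,$$ $$O_\mu(F^{\mu\nu},A'^\kappa)=-(\eta^{\nu\kappa}+I_u^\nu\partial^\kappa)i\delta,\qquad O_\mu(F^{\mu\nu},\phi')=-(I'^\nu_c+I_u^\nu)i\delta,$$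 $$O_\mu(A_\nu(c),\cdot)-O_\nu(A_\mu(c),\cdot)=0,\qquad O_\mu(A_\nu,\cdot)-O_\nu(A_\mu,\cdot)=0,\qquad O_\mu(\phi,\cdot)=0,$$ $$\gamma^\mu O_\mu(\psi,\bar\psi')=-\delta,\qquad O_\mu(\bar\psi,\psi')\gamma^\mu=\delta$$ (the last for the ordering $\psi'\bar\psi$ of the contraction); $O_\mu(F^{\mu\nu},\cdot)$ vanishes on the quark fields, and $\gamma^\mu O_\mu(\psi,\cdot)$, $O_\mu(\bar\psi,\cdot)\gamma^\mu$ vanish on all other fields. All components not determined by these equations are arbitrary. **Proposition.** (i) As an identity of distributions in $(x,x')$, $$\begin{aligned}O_{U_1}(L_1'+K_1')={}&-\tfrac12\partial^\lambda\big(\langle\sigma^\kappa|A_{\kappa\lambda}(c)+A_{\kappa\lambda}\rangle\, i\delta\big)-\tfrac12\partial'_\kappa\big(\langle\sigma_\nu|J'^\kappa(c)\rangle\, I'^\nu_c i\delta\big)+\tfrac12\partial'_\kappa\big(\langle\sigma_\nu|J'^\kappa\rangle\, I_u^\nu i\delta\big)\\&+(L_2-K_2)\,i\delta+R\,i\delta,\end{aligned}$$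 with $$L_2=-\tfrac12\langle A^{\mu\nu}(c)|A_{\mu\nu}(c)\rangle,\qquad K_2=-\tfrac12\langle A^{\mu\nu}|A_{\mu\nu}\rangle,$$ $$R=-\tfrac12\big\langle i[\phi,\partial^\kappa A^\lambda(c)+\partial^\kappa A^\lambda]\big|A_{\kappa\lambda}(c)+A_{\kappa\lambda}\big\rangle+\tfrac12\big\langle\sigma_\kappa\big|i[F^{\kappa\lambda},A_\lambda(c)+A_\lambda]\big\rangle .$$ (ii) The remaining terms are total derivatives: $R=\partial_\mu\big(\tfrac16\langle F^{\mu\nu}|i[\phi,i[\phi,\partial_\nu\phi]]\rangle\big)$, and $$R\,i\delta=-i\,\mathfrak S\,\partial_\mu\Big(-\tfrac13\langle F^{\mu\nu}|i[\phi,i[\phi,\partial_\nu\phi]]\rangle\,\delta\Big).$$ (iii) Consequently the second-order obstruction is resolved, $$\mathfrak S\,O_{U_1}(L_1'+K_1')=(L_2-K_2)\,i\delta-i\,\mathfrak S\,\partial_\mu U_2^\mu(x;x'),$$ with the induced interactions $L_2$, $K_2$ above and $$U_2^\mu=\tfrac12\langle J^\mu(c)|\sigma'_\kappa\rangle I_c^\kappa\delta-\tfrac12\langle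 J^\mu|\sigma'_\kappa\rangle I'^\kappa_u\delta-\tfrac12\langle A^{\mu\nu}(c)+A^{\mu\nu}|\sigma_\nu\rangle\delta-\tfrac13\langle F^{\mu\nu}|i[\phi,i[\phi,\partial_\nu\phi]]\rangle\delta .$$ -/

import Mathlib

open MeasureTheory Set Filter Topology
open scoped ContDiff

namespace StringQCD

noncomputable section

/-! ### Minkowski space -/

/-- Minkowski space `ℝ⁴`; a vector `v` has contravariant components `v μ`. -/
abbrev Mink : Type := Fin 4 → ℝ

/-- The diagonal of the metric `η = diag(1, -1, -1, -1)`. Raising or lowering the index `μ` is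
multiplication by `g μ`. -/
def g : Fin 4 → ℝ := ![1, -1, -1, -1]

/-- The metric tensor. -/
def eta (μ ν : Fin 4) : ℂ := if μ = ν then (g μ : ℂ) else 0

/-- The Minkowski product. -/
def dot (v w : Mink) : ℝ := ∑ μ, g μ * v μ * w μ

/-- The partial derivative `∂_μ h`. -/
def pd (μ : Fin 4) (h : Mink → ℂ) (x : Mink) : ℂ := fderiv ℝ h x (Pi.single μ 1)

/-- The wave operator `□ = ∂^μ ∂_μ`. -/
def box (h : Mink → ℂ) (x : Mink) : ℂ := ∑ μ, (g μ : ℂ) * pd μ (pd μ h) x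

/-! ### Strings and string integrations -/

/-- A timelike unit vector `u` and a string smearing `c(e) dσ(e)` of total weight `1` over
directions in the sphere of unit spacelike vectors orthogonal to `u`. -/
structure Strings where
  /-- the timelike unit vector -/
  u : Mink
  /-- the reference measure on directions -/
  σ : Measure Mink
  /-- the real (not necessarily positive) smearing function -/
  c : Mink → ℝ
  u_unit : dot u u = 1
  σ_finite : IsFiniteMeasure σ
  σ_carried : ∀ᵐ e ∂σ, dot e e = -1 ∧ dot e u = 0
  c_integrable : Integrable c σ
  c_weight : ∫ e, c e ∂σ = 1

/-- The sphere of unit spacelike vectors orthogonal to `u`. -/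
def Strings.dirs (S : Strings) : Set Mink := {e | dot e e = -1 ∧ dot e S.u = 0}

/-- `(I_v h)(x) = ∫_0^∞ h(x + s v) ds`. -/
def stringInt (v : Mink) (h : Mink → ℂ) (x : Mink) : ℂ := ∫ s in Ioi (0 : ℝ), h (x + s • v)

/-- `(I_c^ν h)(x) = ∫ dσ(e) c(e) e^ν (I_e h)(x)`. -/
def Strings.Ic (S : Strings) (ν : Fin 4) (h : Mink → ℂ) (x : Mink) : ℂ :=
  ∫ e, ((S.c e * e ν : ℝ) : ℂ) * stringInt e h x ∂S.σ

/-- `h` and all its derivatives have integrable majorants along the strings with directions in `E`,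
locally uniformly in the endpoint of the string: `h` vanishes at infinity fast enough for the
string integrations. -/
def StringIntegrable (h : Mink → ℂ) (E : Set Mink) : Prop :=
  ∀ K : Set Mink, IsCompact K → ∀ n : ℕ, ∃ b : ℝ → ℝ, IntegrableOn b (Ioi 0) ∧
    ∀ x ∈ K, ∀ e ∈ E, ∀ s : ℝ, 0 < s → ‖iteratedFDeriv ℝ n h (x + s • e)‖ ≤ b s

/-! ### Bilocal distributions

A distribution in `(x, x')` is represented by its pairing with test functions on the product of
two copies of Minkowski space; only its values on test functions matter. -/

/-- Test functions in two variables `(x, x')`. -/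
def IsTest (f : Mink × Mink → ℂ) : Prop := ContDiff ℝ ∞ f ∧ HasCompactSupport f

/-- Pairings with functions of `(x, x')`. -/
abbrev Bilocal : Type := (Mink × Mink → ℂ) → ℂ

namespace Bilocal

/-- Equality as distributions. -/
def Eqv (D D' : Bilocal) : Prop := ∀ f, IsTest f → D f = D' f

/-- Linearity on test functions. -/
def IsLinear (D : Bilocal) : Prop :=
  ∀ f f', IsTest f → IsTest f' → ∀ z : ℂ, D (fun p => f p + z * f' p) = D f + z * D f'

/-- The product `h(x, x') · D`. -/
def mul (h : Mink → Mink → ℂ) (D : Bilocal) : Bilocal := fun f => D fun p => h p.1 p.2 * f p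

/-- The derivative `∂_μ` with respect to `x`. -/
def dx (μ : Fin 4) (D : Bilocal) : Bilocal := fun f => -D fun p => fderiv ℝ f p (Pi.single μ 1, 0)

/-- The derivative `∂'_μ` with respect to `x'`. -/
def dx' (μ : Fin 4) (D : Bilocal) : Bilocal := fun f => -D fun p => fderiv ℝ f p (0, Pi.single μ 1)

/-- The exchange of `x` and `x'`. -/
def swap (D : Bilocal) : Bilocal := fun f => D fun p => f (p.2, p.1)

/-- The symmetrization in `x` and `x'`. -/
def sym (D : Bilocal) : Bilocal := (1 / 2 : ℂ) • (D + swap D)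

/-- The derivative `∂^μ` with respect to `x`. -/
def dxUp (μ : Fin 4) (D : Bilocal) : Bilocal := (g μ : ℂ) • dx μ D

/-- `δ(x - x')`. -/
def delta : Bilocal := fun f => ∫ x, f (x, x)

/-- `i δ(x - x')`. -/
def iDelta : Bilocal := Complex.I • delta

/-- `I_v` acting on the variable `x` of `δ(x - x')`, that is `∫_0^∞ δ(x + s v - x') ds`. -/
def lineDelta (v : Mink) : Bilocal := fun f => ∫ s in Ioi (0 : ℝ), ∫ x, f (x, x + s • v)

/-- `I_u^ν δ(x - x')`, the integration acting on `x`. -/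
def IuDelta (S : Strings) (ν : Fin 4) : Bilocal := (S.u ν : ℂ) • lineDelta S.u

/-- `I_c^ν δ(x - x')`, the integration acting on `x`. -/
def IcDelta (S : Strings) (ν : Fin 4) : Bilocal := fun f =>
  ∫ e, ((S.c e * e ν : ℝ) : ℂ) * lineDelta e f ∂S.σ

/-- `I'_u^ν δ(x - x')`, the integration acting on `x'`. -/
def IuDelta' (S : Strings) (ν : Fin 4) : Bilocal := swap (IuDelta S ν)

/-- `I'_c^ν δ(x - x')`, the integration acting on `x'`. -/
def IcDelta' (S : Strings) (ν : Fin 4) : Bilocal := swap (IcDelta S ν)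

end Bilocal

open Bilocal

/-! ### Lie-algebra valued expressions

The elements `X = X_a ξ_a` are given by their components. -/

section Lie

variable {N : ℕ} {R : Type*} [CommRing R] [Algebra ℂ R]

/-- The components of `i[X, Y] = -f_{abc} X_a Y_b ξ_c`. -/
def br (f : Fin N → Fin N → Fin N → ℝ) (X Y : Fin N → R) : Fin N → R := fun c =>
  ∑ a, ∑ b, (-(f a b c : ℂ)) • (X a * Y b)

/-- The inner product `⟨X | Y⟩ = X_a Y_a`. -/
def ip (X Y : Fin N → R) : R := ∑ a, X a * Y a

/-- `(1/2) ⟨F^{μν} | i[B_μ, B_ν]⟩ + ⟨B_μ | j^μ⟩`, from contravariant components. -/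
def cubic (f : Fin N → Fin N → Fin N → ℝ) (F : Fin 4 → Fin 4 → Fin N → R)
    (B : Fin 4 → Fin N → R) (j : Fin 4 → Fin N → R) : R :=
  (1 / 2 : ℂ) • (∑ μ, ∑ ν, ((g μ * g ν : ℝ) : ℂ) • ip (F μ ν) (br f (B μ) (B ν)))
    + ∑ μ, (g μ : ℂ) • ip (B μ) (j μ)

end Lie

/-! ### Wick polynomials -/

/-- The linear free fields of QCD: `F^{μν}_a`, `A^μ_a(c)`, `A^μ_a`, `φ_a(c)` (with `a < N`), and
the quark fields `ψ` and `ψ̄` with a representation index `m < n` and a spinor index. -/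
inductive Fld (N n : ℕ) : Type
  | F (a : Fin N) (μ ν : Fin 4)
  | Ac (a : Fin N) (μ : Fin 4)
  | A (a : Fin N) (μ : Fin 4)
  | phi (a : Fin N)
  | psi (m : Fin n) (α : Fin 4)
  | psib (m : Fin n) (α : Fin 4)
  deriving DecidableEq, Fintype

/-- Wick polynomials in the linear free fields. -/
abbrev Wick (N n : ℕ) : Type := MvPolynomial (Fld N n) ℂ

/-- The colour and spinor matrices of the model: structure constants `f_{abc}`, the matrices
`τ_a = π(ξ_a)` and the Dirac matrices `γ^μ`. -/
structure Consts (N n : ℕ) where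
  /-- structure constants -/
  f : Fin N → Fin N → Fin N → ℝ
  /-- generators in the quark representation -/
  τ : Fin N → Matrix (Fin n) (Fin n) ℂ
  /-- Dirac matrices -/
  γ : Fin 4 → Matrix (Fin 4) (Fin 4) ℂ

section Interactions

variable {N n : ℕ} (C : Consts N n)

/-- The current `j^μ_a = ψ̄ γ^μ π(ξ_a) ψ`. -/
def jWick (μ : Fin 4) (a : Fin N) : Wick N n :=
  ∑ m, ∑ m', ∑ α, ∑ β, (C.γ μ α β * C.τ a m m') •
    (MvPolynomial.X (Fld.psib m α) * MvPolynomial.X (Fld.psi m' β))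

/-- `L_1 = (1/2) ⟨F^{μν} | i[A_μ(c), A_ν(c)]⟩ + ⟨A_μ(c) | j^μ⟩`. -/
def L1 : Wick N n :=
  cubic C.f (fun μ ν a => MvPolynomial.X (Fld.F a μ ν)) (fun μ a => MvPolynomial.X (Fld.Ac a μ))
    (jWick C)

/-- `K_1 = (1/2) ⟨F^{μν} | i[A_μ, A_ν]⟩ + ⟨A_μ | j^μ⟩`. -/
def K1 : Wick N n :=
  cubic C.f (fun μ ν a => MvPolynomial.X (Fld.F a μ ν)) (fun μ a => MvPolynomial.X (Fld.A a μ))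
    (jWick C)

/-- `U_1^μ = V_1^μ = (1/2) ⟨F^{μν} | i[φ, A_ν(c) + A_ν]⟩ + ⟨φ | j^μ⟩`. -/
def U1 (μ : Fin 4) : Wick N n :=
  (1 / 2 : ℂ) • (∑ ν, (g ν : ℂ) • ip (fun a => MvPolynomial.X (Fld.F a μ ν))
      (br C.f (fun a => MvPolynomial.X (Fld.phi a))
        (fun a => MvPolynomial.X (Fld.Ac a ν) + MvPolynomial.X (Fld.A a ν))))
    + ip (fun a => MvPolynomial.X (Fld.phi a)) (jWick C μ)

end Interactions

/-! ### Two-point obstructions -/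

/-- The two-point obstructions `O_μ(F^{μν}_a, χ')` (summed over `μ`). -/
def rowF {N n : ℕ} (S : Strings) (a : Fin N) (ν : Fin 4) : Fld N n → Bilocal
  | .F b κ l => if a = b then -(eta ν κ • dxUp l iDelta - eta ν l • dxUp κ iDelta) else 0
  | .Ac b κ => if a = b then -(eta ν κ • iDelta - dxUp κ (Complex.I • IcDelta' S ν)) else 0
  | .A b κ => if a = b then -(eta ν κ • iDelta + dxUp κ (Complex.I • IuDelta S ν)) else 0
  | .phi b => if a = b then -(Complex.I • (IcDelta' S ν + IuDelta S ν)) else 0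
  | .psi _ _ => 0
  | .psib _ _ => 0

/-- The two-point obstructions `(γ^μ)_{βα} O_μ(ψ_{mα}, χ')`. -/
def rowPsi {N n : ℕ} (m : Fin n) (β : Fin 4) : Fld N n → Bilocal
  | .psib k δ => if m = k ∧ β = δ then -delta else 0
  | _ => 0

/-- The two-point obstructions `O_μ(ψ̄_{mα}, χ') (γ^μ)_{αβ}`. The entry for `χ' = ψ'` is the value
of `⟨[T, ∂_μ] ψ' ψ̄ γ^μ⟩`: for bilinears in `ψ̄` and `ψ`, this ordering of the contraction accounts
for the Fermi signs. -/
def rowPsib {N n : ℕ} (m : Fin n) (β : Fin 4) : Fld N n → Bilocal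
  | .psi k δ => if m = k ∧ β = δ then delta else 0
  | _ => 0

/-- `O μ φ χ` is the two-point obstruction
`O_μ(φ(x), χ(x')) = ⟨T ∂_μ φ(x) χ(x')⟩ - ∂_μ ⟨T φ(x) χ(x')⟩`.
Only those combinations are prescribed in which an equation of motion for `∂_μ φ` is used under the
time-ordering: `∂_μ F^{μν} = 0`, `∂_μ A_ν(c) - ∂_ν A_μ(c) = F_{μν} = ∂_μ A_ν - ∂_ν A_μ`,
`∂_μ φ = A_μ(c) - A_μ` and the massless Dirac equation (no renormalization of `⟨T F F'⟩`).
The other components are arbitrary. -/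
structure IsTwoPointObstruction {N n : ℕ} (C : Consts N n) (S : Strings)
    (O : Fin 4 → Fld N n → Fld N n → Bilocal) : Prop where
  linear : ∀ μ φ χ, (O μ φ χ).IsLinear
  F : ∀ a ν χ, (∑ μ, O μ (.F a μ ν) χ).Eqv (rowF S a ν χ)
  curl_Ac : ∀ a μ ν χ, ((g ν : ℂ) • O μ (.Ac a ν) χ - (g μ : ℂ) • O ν (.Ac a μ) χ).Eqv 0
  curl_A : ∀ a μ ν χ, ((g ν : ℂ) • O μ (.A a ν) χ - (g μ : ℂ) • O ν (.A a μ) χ).Eqv 0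
  phi : ∀ μ a χ, (O μ (.phi a) χ).Eqv 0
  psi : ∀ m β χ, (∑ μ, ∑ α, C.γ μ β α • O μ (.psi m α) χ).Eqv (rowPsi m β χ)
  psib : ∀ m β χ, (∑ μ, ∑ α, C.γ μ α β • O μ (.psib m α) χ).Eqv (rowPsib m β χ)

/-! ### The fields

A Wick polynomial is evaluated on the (commuting, complex-valued) solutions of the free field
equations: the values are its normal-ordered symbol, and an identity between tree-level expressions
is the identity of the symbols for all solutions. -/

/-- A configuration of the Feynman gauge potential `A^K_μ` (covariant components) and of the quark
fields `ψ` and `ψ̄`. -/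
structure Config (N n : ℕ) where
  /-- Feynman gauge potential -/
  AK : Fin N → Fin 4 → Mink → ℂ
  /-- quark field -/
  psi : Fin n → Fin 4 → Mink → ℂ
  /-- conjugate quark field -/
  psib : Fin n → Fin 4 → Mink → ℂ

namespace Config

variable {N n : ℕ} (C : Consts N n) (S : Strings) (Φ : Config N n)

/-- `N = ∂^μ A^K_μ`. -/
def nul (a : Fin N) (x : Mink) : ℂ := ∑ μ, (g μ : ℂ) * pd μ (Φ.AK a μ) x

/-- `A_μ = A^K_μ + u_μ I_u (∂ A^K)`. -/
def A (a : Fin N) (μ : Fin 4) (x : Mink) : ℂ :=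
  Φ.AK a μ x + ((g μ * S.u μ : ℝ) : ℂ) * stringInt S.u (Φ.nul a) x

/-- `F_{μν} = ∂_μ A_ν - ∂_ν A_μ`. -/
def F (a : Fin N) (μ ν : Fin 4) (x : Mink) : ℂ := pd μ (Φ.A S a ν) x - pd ν (Φ.A S a μ) x

/-- The escort field `φ(c) = I_c^ν A^K_ν`. -/
def phi (a : Fin N) (x : Mink) : ℂ := ∑ ν, S.Ic ν (Φ.AK a ν) x

/-- The string-localized potential `A_μ(c) = I_c^ν F_{μν}`. -/
def Ac (a : Fin N) (μ : Fin 4) (x : Mink) : ℂ := ∑ ν, S.Ic ν (Φ.F S a μ ν) x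

/-- The values of the linear free fields (contravariant components). -/
def val (x : Mink) : Fld N n → ℂ
  | .F a μ ν => ((g μ * g ν : ℝ) : ℂ) * Φ.F S a μ ν x
  | .Ac a μ => (g μ : ℂ) * Φ.Ac S a μ x
  | .A a μ => (g μ : ℂ) * Φ.A S a μ x
  | .phi a => Φ.phi S a x
  | .psi m α => Φ.psi m α x
  | .psib m α => Φ.psib m α x

/-- The value of a Wick polynomial at the point `x`. -/
def eval (W : Wick N n) (x : Mink) : ℂ := MvPolynomial.aeval (Φ.val S x) W

/-- The field equations, smoothness, and the decay needed for the string integrations. -/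
structure OnShell : Prop where
  smooth_AK : ∀ a μ, ContDiff ℝ ∞ (Φ.AK a μ)
  smooth_psi : ∀ m α, ContDiff ℝ ∞ (Φ.psi m α)
  smooth_psib : ∀ m α, ContDiff ℝ ∞ (Φ.psib m α)
  wave : ∀ a μ x, box (Φ.AK a μ) x = 0
  dirac_psi : ∀ m α x, ∑ μ, ∑ β, C.γ μ α β * pd μ (Φ.psi m β) x = 0
  dirac_psib : ∀ m β x, ∑ μ, ∑ α, pd μ (Φ.psib m α) x * C.γ μ α β = 0
  decay_AK : ∀ a μ, StringIntegrable (Φ.AK a μ) S.dirs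
  decay_nul : ∀ a, StringIntegrable (Φ.nul a) {S.u}
  decay_IuN : ∀ a μ, StringIntegrable (pd μ (stringInt S.u (Φ.nul a))) S.dirs
  vanish_IuN : ∀ a x, ∀ e ∈ S.dirs,
    Tendsto (fun s : ℝ => stringInt S.u (Φ.nul a) (x + s • e)) atTop (𝓝 0)

/-! Composite fields, as Lie-algebra valued functions. Suffix `Up`: contravariant indices. -/

/-- `F^{μν}`. -/
def FUp (μ ν : Fin 4) (x : Mink) : Fin N → ℂ := fun a => ((g μ * g ν : ℝ) : ℂ) * Φ.F S a μ ν x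

/-- The current `j^μ`. -/
def jUp (μ : Fin 4) (x : Mink) : Fin N → ℂ := fun a => Φ.eval S (jWick C μ a) x

/-- `J^μ(c) = j^μ - i[F^{μν}, A_ν(c)]`. -/
def JcUp (μ : Fin 4) (x : Mink) : Fin N → ℂ :=
  Φ.jUp C S μ x - ∑ ν, br C.f (Φ.FUp S μ ν x) (fun a => Φ.Ac S a ν x)

/-- `J^μ = j^μ - i[F^{μν}, A_ν]`. -/
def JUp (μ : Fin 4) (x : Mink) : Fin N → ℂ :=
  Φ.jUp C S μ x - ∑ ν, br C.f (Φ.FUp S μ ν x) (fun a => Φ.A S a ν x)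

/-- `A_{μν}(c) = i[A_μ(c), A_ν(c)]`. -/
def AAc (μ ν : Fin 4) (x : Mink) : Fin N → ℂ :=
  br C.f (fun a => Φ.Ac S a μ x) (fun a => Φ.Ac S a ν x)

/-- `A_{μν} = i[A_μ, A_ν]`. -/
def AA (μ ν : Fin 4) (x : Mink) : Fin N → ℂ :=
  br C.f (fun a => Φ.A S a μ x) (fun a => Φ.A S a ν x)

/-- `A_ν(c) + A_ν`. -/
def sumA (ν : Fin 4) (x : Mink) : Fin N → ℂ := fun a => Φ.Ac S a ν x + Φ.A S a ν x

/-- `φ`, as a Lie-algebra valued function. -/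
def phiV (x : Mink) : Fin N → ℂ := fun a => Φ.phi S a x

/-- `σ_ν = i[φ, A_ν(c) + A_ν]`. -/
def sig (ν : Fin 4) (x : Mink) : Fin N → ℂ := br C.f (Φ.phiV S x) (Φ.sumA S ν x)

/-! Second order. -/

/-- `L_2 = -(1/2) ⟨A^{μν}(c) | A_{μν}(c)⟩`. -/
def L2 (x : Mink) : ℂ :=
  -(1 / 2) * ∑ μ, ∑ ν, ((g μ * g ν : ℝ) : ℂ) * ip (Φ.AAc C S μ ν x) (Φ.AAc C S μ ν x)

/-- `K_2 = -(1/2) ⟨A^{μν} | A_{μν}⟩`. -/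
def K2 (x : Mink) : ℂ :=
  -(1 / 2) * ∑ μ, ∑ ν, ((g μ * g ν : ℝ) : ℂ) * ip (Φ.AA C S μ ν x) (Φ.AA C S μ ν x)

/-- `⟨F^{μν} | i[φ, i[φ, ∂_ν φ]]⟩`. -/
def cubicPhi (μ : Fin 4) (x : Mink) : ℂ :=
  ∑ ν, ip (Φ.FUp S μ ν x)
    (br C.f (Φ.phiV S x) (br C.f (Φ.phiV S x) (fun a => pd ν (Φ.phi S a) x)))

/-- The field `U_2^μ(x; x')`:
`(1/2) ⟨J^μ(c) | σ'_κ⟩ I_c^κ δ - (1/2) ⟨J^μ | σ'_κ⟩ I'_u^κ δ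
  - (1/2) ⟨A^{μν}(c) + A^{μν} | σ_ν⟩ δ - (1/3) ⟨F^{μν} | i[φ, i[φ, ∂_ν φ]]⟩ δ`. -/
def U2 (μ : Fin 4) : Bilocal :=
  (1 / 2 : ℂ) • (∑ κ, mul (fun x x' => ip (Φ.JcUp C S μ x) (Φ.sig C S κ x')) (IcDelta S κ))
  - (1 / 2 : ℂ) • (∑ κ, mul (fun x x' => ip (Φ.JUp C S μ x) (Φ.sig C S κ x')) (IuDelta' S κ))
  - (1 / 2 : ℂ) • mul (fun x _ => ∑ ν, ((g μ * g ν : ℝ) : ℂ) *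
      ip (Φ.AAc C S μ ν x + Φ.AA C S μ ν x) (Φ.sig C S ν x)) delta
  - (1 / 3 : ℂ) • mul (fun x _ => Φ.cubicPhi C S μ x) delta

/-- The manifest derivative terms of `O_{U_1}(L_1' + K_1')`:
`-(1/2) ∂^l (⟨σ^κ | A_{κl}(c) + A_{κl}⟩ iδ)
  - (1/2) ∂'_κ (⟨σ_ν | J'^κ(c)⟩ I'_c^ν iδ) + (1/2) ∂'_κ (⟨σ_ν | J'^κ⟩ I_u^ν iδ)`. -/
def manifestTerms : Bilocal :=
  -((1 / 2 : ℂ) • ∑ l, dxUp l (mul (fun x _ => ∑ κ, (g κ : ℂ) *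
      ip (Φ.sig C S κ x) (Φ.AAc C S κ l x + Φ.AA C S κ l x)) iDelta))
  - (1 / 2 : ℂ) • (∑ κ, dx' κ (∑ ν, mul (fun x x' => ip (Φ.sig C S ν x) (Φ.JcUp C S κ x'))
      (Complex.I • IcDelta' S ν)))
  + (1 / 2 : ℂ) • (∑ κ, dx' κ (∑ ν, mul (fun x x' => ip (Φ.sig C S ν x) (Φ.JUp C S κ x'))
      (Complex.I • IuDelta S ν)))

/-- The coefficient of `iδ` in the remaining terms of `O_{U_1}(L_1' + K_1')`:
`-(1/2) ⟨i[φ, ∂^κ A^l(c) + ∂^κ A^l] | A_{κl}(c) + A_{κl}⟩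
  + (1/2) ⟨i[φ, A_κ(c) + A_κ] | i[F^{κl}, A_l(c) + A_l]⟩`. -/
def remaining (x : Mink) : ℂ :=
  -(1 / 2) * (∑ κ, ∑ l, ((g κ * g l : ℝ) : ℂ) *
      ip (br C.f (Φ.phiV S x) (fun a => pd κ (Φ.Ac S a l) x + pd κ (Φ.A S a l) x))
        (Φ.AAc C S κ l x + Φ.AA C S κ l x))
  + (1 / 2) * ∑ κ, ∑ l, ip (br C.f (Φ.phiV S x) (Φ.sumA S κ x))
      (br C.f (Φ.FUp S κ l x) (Φ.sumA S l x))

/-- The tree-level obstruction map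
`O_Y(X') = ∑_{φ, χ} (∂Y^μ/∂φ)(x) O_μ(φ(x), χ(x')) (∂X/∂χ)(x')`. -/
def obstr (O : Fin 4 → Fld N n → Fld N n → Bilocal) (Y : Fin 4 → Wick N n) (X : Wick N n) :
    Bilocal :=
  ∑ μ, ∑ φ, ∑ χ, mul (fun x x' =>
    Φ.eval S (MvPolynomial.pderiv φ (Y μ)) x * Φ.eval S (MvPolynomial.pderiv χ X) x') (O μ φ χ)

end Config

end

end StringQCD

open StringQCD

/-! Although most two-point obstructions are arbitrary, only the prescribed combinations survive in
`O_{U_1}`. The derivative of `U_1^μ` with respect to `A_ν(c)` or `A_ν` is antisymmetric in `μν`, so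
the curl relations cancel it. The field `φ` contributes nothing. The derivative with respect to
`F^{κν}` contains a Kronecker delta in `μκ`, and the quark derivatives contain a matrix `γ^μ`; this
assembles exactly the given rows (`sum_obstr_U1`).

The quark rows produce a commutator of colour matrices, hence `⟨σ_μ|j^μ⟩ iδ` (`quark_terms`). The
row of `F` (`sum_rowF`) produces three kinds of terms. Derivatives of `δ` multiplied by `A_{κλ}(c) +
A_{κλ}` split by the Leibniz rule into an exterior derivative and a local term with `∂σ` (`sum_FF`).
Plain `δ` terms carry `-(1/2)(J(c) + J)`, whose part in `j` cancels the quark terms. String deltas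
under `∂_κ` become exterior derivatives `∂'_κ`, because they are translation invariant and the
currents `J(c)`, `J` are conserved (`sum_dx_eq_neg_sum_dx'_mul`, `div_current`).

In the local terms, `∂φ = A(c) - A` turns the antisymmetrized `∂σ` into a multiple of `A_{κλ}(c) -
A_{κλ}`, which is paired with `A_{κλ}(c) + A_{κλ}`: the difference of squares is `L_2 - K_2`, and
what is left is `R` (`local_terms`). With `B = A(c) + A`, whose curl is `2F`, and the Maxwell
equation, `R` is compared with the divergence one index pair at a time; invariance of the inner
product and two Jacobi identities finish (`remaining_pair_identity`).

Since `(∂h) δ = (∂ + ∂')(h δ)`, a local divergence is twice a symmetrized derivative, which turns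
`1/6` into `1/3`. Exchanging `x` and `x'` brings the string terms to the form they have in `U_2`.

The analytic input is twofold. Locally uniform integrable majorants permit differentiation under the
string integrals and, with the assumed vanishing of `I_u(∂A^K)`, remove boundary terms at infinity,
which gives the field equations. And every string leaves the support of a test function after a
bounded parameter, uniformly in its direction, so that string deltas are well behaved. -/

namespace StringQCD

/-! ### Weighted superpositions of translates -/

section Translates

variable {α : Type*} [MeasurableSpace α] {m : Measure α} {k : α → ℝ} {T : α → Mink}

/-- The derivatives of the weighted translates `k p • h (x + T p)` have integrable majorants,
locally uniformly in `x`. -/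
def DominatedTranslates {E : Type} [NormedAddCommGroup E] [NormedSpace ℝ E]
    (m : Measure α) (k : α → ℝ) (T : α → Mink) (h : Mink → E) : Prop :=
  ∀ K : Set Mink, IsCompact K → ∀ n : ℕ, ∃ B : α → ℝ, Integrable B m ∧
    ∀ᵐ p ∂m, ∀ x ∈ K, ‖k p‖ * ‖iteratedFDeriv ℝ n h (x + T p)‖ ≤ B p

variable {E : Type} [NormedAddCommGroup E] [NormedSpace ℝ E] {h : Mink → E}

theorem DominatedTranslates.fderiv (hd : DominatedTranslates m k T h) :
    DominatedTranslates m k T (fderiv ℝ h) := by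
  intro K hK n
  obtain ⟨B, hB, hle⟩ := hd K hK (n + 1)
  exact ⟨B, hB, by simpa only [norm_iteratedFDeriv_fderiv] using hle⟩

theorem aestronglyMeasurable_translates (hk : AEStronglyMeasurable k m) (hT : Measurable T)
    (hh : Continuous h) (x : Mink) : AEStronglyMeasurable (fun p => k p • h (x + T p)) m :=
  hk.smul (hh.stronglyMeasurable.comp_measurable (measurable_const.add hT)).aestronglyMeasurable

theorem DominatedTranslates.integrable (hd : DominatedTranslates m k T h)
    (hk : AEStronglyMeasurable k m) (hT : Measurable T) (hh : Continuous h) (x : Mink) :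
    Integrable (fun p => k p • h (x + T p)) m := by
  obtain ⟨B, hB, hle⟩ := hd {x} isCompact_singleton 0
  refine hB.mono' (aestronglyMeasurable_translates hk hT hh x) ?_
  filter_upwards [hle] with p hp
  have := hp x rfl
  rwa [norm_iteratedFDeriv_zero, ← norm_smul] at this

/-- Dominated differentiation: the majorant of the first derivatives on the closed unit ball around
`x` serves all nearby base points at once. -/
theorem DominatedTranslates.hasFDerivAt (hd : DominatedTranslates m k T h)
    (hk : AEStronglyMeasurable k m) (hT : Measurable T) (hh : ContDiff ℝ ∞ h) (x : Mink) :
    HasFDerivAt (fun x => ∫ p, k p • h (x + T p) ∂m) (∫ p, k p • _root_.fderiv ℝ h (x + T p) ∂m) x := by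
  obtain ⟨B, hB, hle⟩ := hd (Metric.closedBall x 1) (isCompact_closedBall x 1) 1
  refine hasFDerivAt_integral_of_dominated_of_fderiv_le (bound := B)
    (F' := fun x p => k p • _root_.fderiv ℝ h (x + T p))
    (Metric.closedBall_mem_nhds x one_pos)
    (Eventually.of_forall fun y => aestronglyMeasurable_translates hk hT hh.continuous y)
    (hd.integrable hk hT hh.continuous x)
    (aestronglyMeasurable_translates hk hT (hh.continuous_fderiv (by simp)) x) ?_ hB ?_
  · filter_upwards [hle] with p hp y hy
    rw [norm_smul]
    refine le_trans (le_of_eq ?_) (hp y hy)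
    rw [← norm_iteratedFDeriv_fderiv, norm_iteratedFDeriv_zero]
  · refine Eventually.of_forall fun p y _ => HasFDerivAt.const_smul ?_ (k p)
    simpa [Function.comp_def] using ((hh.differentiable (by simp)) (y + T p)).hasFDerivAt.comp y
      ((hasFDerivAt_id y).add_const (T p))

/-- The derivative is again a superposition of translates with the same weight, but of a function
with values in linear maps. The induction therefore runs over all target spaces `E`. -/
theorem DominatedTranslates.contDiff (hd : DominatedTranslates m k T h)
    (hk : AEStronglyMeasurable k m) (hT : Measurable T) (hh : ContDiff ℝ ∞ h) :
    ContDiff ℝ ∞ (fun x => ∫ p, k p • h (x + T p) ∂m) := by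
  rw [contDiff_infty]
  intro n
  induction n generalizing E with
  | zero =>
    refine contDiff_zero.2 (continuous_iff_continuousAt.2 fun x => ?_)
    exact (hd.hasFDerivAt hk hT hh x).continuousAt
  | succ n ih =>
    refine contDiff_succ_iff_hasFDerivAt.2 ⟨_, ih hd.fderiv (hh.fderiv_right (by simp)), ?_⟩
    exact hd.hasFDerivAt hk hT hh

theorem DominatedTranslates.pd_integral {h : Mink → ℂ} (hd : DominatedTranslates m k T h)
    (hk : AEStronglyMeasurable k m) (hT : Measurable T) (hh : ContDiff ℝ ∞ h) (μ : Fin 4)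
    (x : Mink) :
    pd μ (fun x => ∫ p, k p • h (x + T p) ∂m) x = ∫ p, k p • pd μ h (x + T p) ∂m := by
  rw [pd, (hd.hasFDerivAt hk hT hh x).fderiv, ContinuousLinearMap.integral_apply
    (hd.fderiv.integrable hk hT (hh.continuous_fderiv (by simp)) x)]
  rfl

end Translates

/-! ### Partial derivatives of smooth functions -/

theorem contDiff_pd {h : Mink → ℂ} (hh : ContDiff ℝ ∞ h) (μ : Fin 4) : ContDiff ℝ ∞ (pd μ h) :=
  (hh.fderiv_right (by simp)).clm_apply contDiff_const

theorem pd_add {h k : Mink → ℂ} (hh : ContDiff ℝ ∞ h) (hk : ContDiff ℝ ∞ k) (μ : Fin 4)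
    (x : Mink) : pd μ (fun y => h y + k y) x = pd μ h x + pd μ k x := by
  rw [pd, fderiv_fun_add (hh.differentiable (by simp) x) (hk.differentiable (by simp) x)]
  rfl

theorem pd_sub {h k : Mink → ℂ} (hh : ContDiff ℝ ∞ h) (hk : ContDiff ℝ ∞ k) (μ : Fin 4)
    (x : Mink) : pd μ (fun y => h y - k y) x = pd μ h x - pd μ k x := by
  rw [pd, fderiv_fun_sub (hh.differentiable (by simp) x) (hk.differentiable (by simp) x)]
  rfl

theorem pd_const_mul {h : Mink → ℂ} (hh : ContDiff ℝ ∞ h) (z : ℂ) (μ : Fin 4) (x : Mink) :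
    pd μ (fun y => z * h y) x = z * pd μ h x := by
  rw [pd, fderiv_const_mul (hh.differentiable (by simp) x)]
  rfl

theorem pd_mul {h k : Mink → ℂ} (hh : ContDiff ℝ ∞ h) (hk : ContDiff ℝ ∞ k) (μ : Fin 4)
    (x : Mink) : pd μ (fun y => h y * k y) x = pd μ h x * k x + h x * pd μ k x := by
  rw [pd, fderiv_fun_mul (hh.differentiable (by simp) x) (hk.differentiable (by simp) x)]
  simp [pd]; ring

theorem pd_sum {ι : Type*} (s : Finset ι) {h : ι → Mink → ℂ} (hh : ∀ i, ContDiff ℝ ∞ (h i))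
    (μ : Fin 4) (x : Mink) : pd μ (fun y => ∑ i ∈ s, h i y) x = ∑ i ∈ s, pd μ (h i) x := by
  rw [pd, fderiv_fun_sum (fun i _ => (hh i).differentiable (by simp) x)]
  simp [pd]

theorem pd_comm {h : Mink → ℂ} (hh : ContDiff ℝ ∞ h) (μ ν : Fin 4) (x : Mink) :
    pd μ (pd ν h) x = pd ν (pd μ h) x := by
  have hd : DifferentiableAt ℝ (fderiv ℝ h) x :=
    ((hh.fderiv_right (m := ∞) (by simp)).differentiable (by simp)) x
  have key : ∀ κ l : Fin 4, pd κ (pd l h) x =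
      fderiv ℝ (fderiv ℝ h) x (Pi.single κ 1) (Pi.single l 1) := by
    intro κ l
    unfold pd
    rw [fderiv_clm_apply hd (differentiableAt_const _)]
    simp
  rw [key, key]
  exact (hh.contDiffAt (x := x)).isSymmSndFDerivAt
    (by simpa using WithTop.coe_le_coe.2 (le_top : (2 : ℕ∞) ≤ ⊤)) _ _

theorem fderiv_eq_sum_pd (h : Mink → ℂ) (x v : Mink) :
    fderiv ℝ h x v = ∑ μ, (v μ : ℂ) * pd μ h x := by
  conv_lhs => rw [← LinearMap.sum_single_apply (fun _ => ℝ) v, map_sum]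
  refine Finset.sum_congr rfl fun μ _ => ?_
  rw [pd, ← Complex.real_smul, ← map_smul, ← Pi.single_smul]
  simp

/-! ### String integrations -/

theorem StringIntegrable.mono {h : Mink → ℂ} {E E' : Set Mink} (hh : StringIntegrable h E)
    (hE : E' ⊆ E) : StringIntegrable h E' := by
  intro K hK n
  obtain ⟨b, hb, hle⟩ := hh K hK n
  exact ⟨b, hb, fun x hx e he => hle x hx e (hE he)⟩

/-- A partial derivative is the full derivative followed by evaluation at a basis vector; this costs
one order of differentiation and the norm of the evaluation map. -/
theorem StringIntegrable.pd {h : Mink → ℂ} {E : Set Mink} (hh : StringIntegrable h E)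
    (hc : ContDiff ℝ ∞ h) (μ : Fin 4) : StringIntegrable (pd μ h) E := by
  intro K hK n
  obtain ⟨b, hb, hle⟩ := hh K hK (n + 1)
  set L := ContinuousLinearMap.apply ℝ ℂ (Pi.single μ 1 : Mink)
  refine ⟨fun s => ‖L‖ * b s, hb.const_mul _, fun x hx e he s hs => ?_⟩
  have hc' : ContDiff ℝ ∞ (fderiv ℝ h) := hc.fderiv_right (by simp)
  refine (L.norm_iteratedFDeriv_comp_left (hc'.contDiffAt (x := x + s • e)) (n := n)
    (by exact_mod_cast le_top)).trans ?_
  rw [norm_iteratedFDeriv_fderiv]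
  exact mul_le_mul_of_nonneg_left (hle x hx e he s hs) (norm_nonneg _)

theorem StringIntegrable.add {h k : Mink → ℂ} {E : Set Mink} (hh : StringIntegrable h E)
    (hk : StringIntegrable k E) (ch : ContDiff ℝ ∞ h) (ck : ContDiff ℝ ∞ k) :
    StringIntegrable (fun x => h x + k x) E := by
  intro K hK n
  obtain ⟨b, hb, hle⟩ := hh K hK n
  obtain ⟨b', hb', hle'⟩ := hk K hK n
  refine ⟨fun s => b s + b' s, hb.add hb', fun x hx e he s hs => ?_⟩
  have hn : (n : WithTop ℕ∞) ≤ ∞ := by exact_mod_cast le_top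
  change ‖iteratedFDeriv ℝ n (h + k) _‖ ≤ _
  rw [iteratedFDeriv_add_apply (ch.of_le hn).contDiffAt (ck.of_le hn).contDiffAt]
  exact (norm_add_le _ _).trans (add_le_add (hle x hx e he s hs) (hle' x hx e he s hs))

theorem StringIntegrable.const_mul {h : Mink → ℂ} {E : Set Mink} (hh : StringIntegrable h E)
    (ch : ContDiff ℝ ∞ h) (z : ℂ) : StringIntegrable (fun x => z * h x) E := by
  intro K hK n
  obtain ⟨b, hb, hle⟩ := hh K hK n
  refine ⟨fun s => ‖z‖ * b s, hb.const_mul _, fun x hx e he s hs => ?_⟩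
  have hn : (n : WithTop ℕ∞) ≤ ∞ := by exact_mod_cast le_top
  change ‖iteratedFDeriv ℝ n (z • h) _‖ ≤ _
  rw [iteratedFDeriv_const_smul_apply (ch.of_le hn).contDiffAt, norm_smul]
  exact mul_le_mul_of_nonneg_left (hle x hx e he s hs) (norm_nonneg _)

theorem StringIntegrable.dominatedTranslates {h : Mink → ℂ} {v : Mink}
    (hh : StringIntegrable h {v}) :
    DominatedTranslates (volume.restrict (Ioi (0 : ℝ))) (fun _ => 1) (fun s => s • v) h := by
  intro K hK n
  obtain ⟨b, hb, hle⟩ := hh K hK n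
  refine ⟨b, hb, ?_⟩
  filter_upwards [ae_restrict_mem measurableSet_Ioi] with s hs x hx
  simpa using hle x hx v rfl s hs

theorem stringInt_eq_integral_smul (v : Mink) (h : Mink → ℂ) :
    stringInt v h = fun x => ∫ s in Ioi (0 : ℝ), (1 : ℝ) • h (x + s • v) := by
  funext x; simp [stringInt]

theorem measurable_smul_vec (v : Mink) : Measurable fun s : ℝ => s • v := by fun_prop

theorem StringIntegrable.integrable {h : Mink → ℂ} {v : Mink} (hh : StringIntegrable h {v})
    (ch : Continuous h) (x : Mink) : IntegrableOn (fun s : ℝ => h (x + s • v)) (Ioi 0) := by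
  simpa [IntegrableOn] using hh.dominatedTranslates.integrable aestronglyMeasurable_const
    (measurable_smul_vec v) ch x

theorem contDiff_stringInt {h : Mink → ℂ} {v : Mink} (hh : StringIntegrable h {v})
    (ch : ContDiff ℝ ∞ h) : ContDiff ℝ ∞ (stringInt v h) := by
  rw [stringInt_eq_integral_smul]
  exact hh.dominatedTranslates.contDiff aestronglyMeasurable_const (measurable_smul_vec v) ch

theorem pd_stringInt {h : Mink → ℂ} {v : Mink} (hh : StringIntegrable h {v})
    (ch : ContDiff ℝ ∞ h) (μ : Fin 4) (x : Mink) :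
    pd μ (stringInt v h) x = stringInt v (pd μ h) x := by
  rw [stringInt_eq_integral_smul, hh.dominatedTranslates.pd_integral aestronglyMeasurable_const
    (measurable_smul_vec v) ch, stringInt_eq_integral_smul]

theorem hasDerivAt_string {h : Mink → ℂ} (ch : ContDiff ℝ ∞ h) (x v : Mink) (s : ℝ) :
    HasDerivAt (fun s : ℝ => h (x + s • v)) (∑ μ, (v μ : ℂ) * pd μ h (x + s • v)) s := by
  rw [← fderiv_eq_sum_pd]
  have h1 : HasDerivAt (fun s : ℝ => x + s • v) v s := by
    simpa using ((hasDerivAt_id s).smul_const v).const_add x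
  exact (ch.differentiable (by simp) _).hasFDerivAt.comp_hasDerivAt s h1

/-- Along the ray both `h` and its derivative are integrable: the second gives a limit, the first
forces it to be zero. -/
theorem StringIntegrable.tendsto_zero {h : Mink → ℂ} {v : Mink} (hh : StringIntegrable h {v})
    (ch : ContDiff ℝ ∞ h) (x : Mink) :
    Tendsto (fun s : ℝ => h (x + s • v)) atTop (𝓝 0) :=
  tendsto_zero_of_hasDerivAt_of_integrableOn_Ioi (fun s _ => hasDerivAt_string ch x v s)
    (integrable_finsetSum _ fun μ _ =>
      ((hh.pd ch μ).integrable (contDiff_pd ch μ).continuous x).const_mul _)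
    (hh.integrable ch.continuous x)

/-- `∑ v^μ I_v (∂_μ h) = -h` for `h` vanishing at the end of the string. -/
theorem sum_stringInt_pd {h : Mink → ℂ} {v : Mink} (ch : ContDiff ℝ ∞ h)
    (hh : ∀ μ, StringIntegrable (pd μ h) {v}) (x : Mink)
    (h0 : Tendsto (fun s : ℝ => h (x + s • v)) atTop (𝓝 0)) :
    ∑ μ, (v μ : ℂ) * stringInt v (pd μ h) x = -h x := by
  have hi : ∀ μ, IntegrableOn (fun s : ℝ => (v μ : ℂ) * pd μ h (x + s • v)) (Ioi 0) := fun μ =>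
    ((hh μ).integrable (contDiff_pd ch μ).continuous x).const_mul _
  have := integral_Ioi_of_hasDerivAt_of_tendsto
    (hasDerivAt_string ch x v 0).continuousAt.continuousWithinAt
    (fun s _ => hasDerivAt_string ch x v s) (integrable_finsetSum _ fun μ _ => hi μ) h0
  rw [integral_finsetSum _ fun μ _ => hi μ] at this
  simpa [stringInt, integral_const_mul] using this

instance (S : Strings) : IsFiniteMeasure S.σ := S.σ_finite

namespace Strings

variable (S : Strings)

/-- Orthogonality to the timelike `u` and Cauchy–Schwarz for the spatial parts give `e₀² u₀² ≤ (1 +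
e₀²)(u₀² - 1)`, that is `e₀² + 1 ≤ u₀²`. Hence the directions form a bounded set that stays away
from the origin. -/
theorem dirs_spatial {e : Mink} (he : e ∈ S.dirs) :
    1 ≤ e 1 ^ 2 + e 2 ^ 2 + e 3 ^ 2 ∧ ∀ ν, e ν ^ 2 ≤ S.u 0 ^ 2 := by
  obtain ⟨h1, h2⟩ := he
  have hu := S.u_unit
  simp only [dot, g, Fin.sum_univ_four, Matrix.cons_val] at h1 h2 hu
  set u := S.u
  have hcs : (e 0 * u 0) ^ 2 ≤ (e 1 ^ 2 + e 2 ^ 2 + e 3 ^ 2) * (u 1 ^ 2 + u 2 ^ 2 + u 3 ^ 2) := by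
    have : e 0 * u 0 = e 1 * u 1 + e 2 * u 2 + e 3 * u 3 := by linarith
    rw [this]
    nlinarith [sq_nonneg (e 1 * u 2 - e 2 * u 1), sq_nonneg (e 1 * u 3 - e 3 * u 1),
      sq_nonneg (e 2 * u 3 - e 3 * u 2)]
  have hs : e 1 ^ 2 + e 2 ^ 2 + e 3 ^ 2 = 1 + e 0 ^ 2 := by linarith
  have hv : u 1 ^ 2 + u 2 ^ 2 + u 3 ^ 2 = u 0 ^ 2 - 1 := by linarith
  rw [hs, hv] at hcs
  have h0 : e 0 ^ 2 + 1 ≤ u 0 ^ 2 := by nlinarith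
  refine ⟨by nlinarith [sq_nonneg (e 0)], fun ν => ?_⟩
  fin_cases ν <;> simp <;>
    nlinarith [sq_nonneg (e 0), sq_nonneg (e 1), sq_nonneg (e 2), sq_nonneg (e 3)]

theorem abs_dirs_le {e : Mink} (he : e ∈ S.dirs) (ν : Fin 4) : |e ν| ≤ |S.u 0| :=
  sq_le_sq.1 ((S.dirs_spatial he).2 ν)

theorem ae_dirs : ∀ᵐ e ∂S.σ, e ∈ S.dirs := S.σ_carried

/-- The weight `c(e) e^ν` of a string direction. -/
noncomputable def weight (ν : Fin 4) (e : Mink) : ℝ := S.c e * e ν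

theorem integrable_weight (ν : Fin 4) : Integrable (S.weight ν) S.σ := by
  refine (S.c_integrable.norm.mul_const |S.u 0|).mono'
    (S.c_integrable.aestronglyMeasurable.mul (measurable_pi_apply ν).aestronglyMeasurable) ?_
  filter_upwards [S.ae_dirs] with e he
  rw [weight, norm_mul]
  exact mul_le_mul_of_nonneg_left (S.abs_dirs_le he ν) (norm_nonneg _)

/-- The measure on strings: direction and parameter along the string. -/
noncomputable def strMeasure : Measure (Mink × ℝ) := S.σ.prod (volume.restrict (Ioi 0))

theorem measurable_strPoint : Measurable fun p : Mink × ℝ => p.2 • p.1 :=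
  measurable_snd.smul measurable_fst

theorem aestronglyMeasurable_weight_fst (ν : Fin 4) :
    AEStronglyMeasurable (fun p : Mink × ℝ => S.weight ν p.1) S.strMeasure :=
  (S.integrable_weight ν).aestronglyMeasurable.comp_fst

end Strings

variable {S : Strings} {h k : Mink → ℂ}

/-- The majorants are uniform over all directions, so a product of a function of the direction and a
function of the string parameter dominates. -/
theorem StringIntegrable.dominatedTranslates_dirs (hh : StringIntegrable h S.dirs) (ν : Fin 4) :
    DominatedTranslates S.strMeasure (fun p => S.weight ν p.1) (fun p => p.2 • p.1) h := by
  intro K hK n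
  obtain ⟨b, hb, hle⟩ := hh K hK n
  refine ⟨fun p => ‖S.weight ν p.1‖ * b p.2, (S.integrable_weight ν).norm.mul_prod hb, ?_⟩
  have h1 : ∀ᵐ p ∂S.strMeasure, p.1 ∈ S.dirs :=
    Measure.quasiMeasurePreserving_fst.ae S.ae_dirs
  have h2 : ∀ᵐ p ∂S.strMeasure, p.2 ∈ Ioi (0 : ℝ) :=
    Measure.quasiMeasurePreserving_snd.ae (ae_restrict_mem measurableSet_Ioi)
  filter_upwards [h1, h2] with p hp1 hp2 x hx
  exact mul_le_mul_of_nonneg_left (hle x hx p.1 hp1 p.2 hp2) (norm_nonneg _)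

theorem StringIntegrable.integrable_dirs (hh : StringIntegrable h S.dirs) (ch : Continuous h)
    (ν : Fin 4) (x : Mink) :
    Integrable (fun p : Mink × ℝ => S.weight ν p.1 • h (x + p.2 • p.1)) S.strMeasure :=
  (hh.dominatedTranslates_dirs ν).integrable (S.aestronglyMeasurable_weight_fst ν)
    Strings.measurable_strPoint ch x

theorem StringIntegrable.integrable_weight_stringInt (hh : StringIntegrable h S.dirs)
    (ch : Continuous h) (ν : Fin 4) (x : Mink) :
    Integrable (fun e => ((S.c e * e ν : ℝ) : ℂ) * stringInt e h x) S.σ := by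
  refine (hh.integrable_dirs ch ν x).integral_prod_left.congr (Eventually.of_forall fun e => ?_)
  simp only [stringInt, Complex.real_smul, integral_const_mul]
  rfl

/-- By Fubini the smeared string integral is a single superposition of translates, to which the
differentiation results apply. -/
theorem StringIntegrable.Ic_eq (hh : StringIntegrable h S.dirs) (ch : Continuous h) (ν : Fin 4) :
    S.Ic ν h = fun x => ∫ p, S.weight ν p.1 • h (x + p.2 • p.1) ∂S.strMeasure := by
  funext x
  rw [Strings.strMeasure, integral_prod _ (hh.integrable_dirs ch ν x)]
  simp only [Strings.Ic, stringInt, Complex.real_smul, integral_const_mul]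
  rfl

theorem contDiff_Ic (hh : StringIntegrable h S.dirs) (ch : ContDiff ℝ ∞ h) (ν : Fin 4) :
    ContDiff ℝ ∞ (S.Ic ν h) := by
  rw [hh.Ic_eq ch.continuous]
  exact (hh.dominatedTranslates_dirs ν).contDiff (S.aestronglyMeasurable_weight_fst ν)
    Strings.measurable_strPoint ch

theorem pd_Ic (hh : StringIntegrable h S.dirs) (ch : ContDiff ℝ ∞ h) (μ ν : Fin 4) (x : Mink) :
    pd μ (S.Ic ν h) x = S.Ic ν (pd μ h) x := by
  rw [hh.Ic_eq ch.continuous, (hh.pd ch μ).Ic_eq (contDiff_pd ch μ).continuous,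
    (hh.dominatedTranslates_dirs ν).pd_integral (S.aestronglyMeasurable_weight_fst ν)
    Strings.measurable_strPoint ch]

theorem Ic_add (hh : StringIntegrable h S.dirs) (hk : StringIntegrable k S.dirs)
    (ch : ContDiff ℝ ∞ h) (ck : ContDiff ℝ ∞ k) (ν : Fin 4) (x : Mink) :
    S.Ic ν (fun y => h y + k y) x = S.Ic ν h x + S.Ic ν k x := by
  rw [(hh.add hk ch ck).Ic_eq (ch.add ck).continuous, hh.Ic_eq ch.continuous,
    hk.Ic_eq ck.continuous]
  simp only [smul_add]
  exact integral_add (hh.integrable_dirs ch.continuous ν x) (hk.integrable_dirs ck.continuous ν x)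

theorem Ic_const_mul (z : ℂ) (ν : Fin 4) (x : Mink) :
    S.Ic ν (fun y => z * h y) x = z * S.Ic ν h x := by
  unfold Strings.Ic
  rw [← integral_const_mul]
  refine integral_congr_ae (Eventually.of_forall fun e => ?_)
  simp only [stringInt, integral_const_mul]
  ring

theorem Ic_sub (hh : StringIntegrable h S.dirs) (hk : StringIntegrable k S.dirs)
    (ch : ContDiff ℝ ∞ h) (ck : ContDiff ℝ ∞ k) (ν : Fin 4) (x : Mink) :
    S.Ic ν (fun y => h y - k y) x = S.Ic ν h x - S.Ic ν k x := by
  have := Ic_add hh (hk.const_mul ck (-1)) ch (contDiff_const.mul ck) ν x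
  rw [Ic_const_mul] at this
  simpa [sub_eq_add_neg] using this

/-- `I_c^ν ∂_ν h = -h` for `h` vanishing at infinity along the strings. -/
theorem sum_Ic_pd (ch : ContDiff ℝ ∞ h) (hh : ∀ ν, StringIntegrable (pd ν h) S.dirs) (x : Mink)
    (h0 : ∀ e ∈ S.dirs, Tendsto (fun s : ℝ => h (x + s • e)) atTop (𝓝 0)) :
    ∑ ν, S.Ic ν (pd ν h) x = -h x := by
  simp only [Strings.Ic]
  rw [← integral_finsetSum _ fun ν _ =>
    (hh ν).integrable_weight_stringInt (contDiff_pd ch ν).continuous ν x]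
  have : ∀ᵐ e ∂S.σ, ∑ ν, ((S.c e * e ν : ℝ) : ℂ) * stringInt e (pd ν h) x =
      ((S.c e : ℝ) : ℂ) * (-h x) := by
    filter_upwards [S.ae_dirs] with e he
    rw [← sum_stringInt_pd ch (fun μ => (hh μ).mono (by simpa using he)) x (h0 e he),
      Finset.mul_sum]
    refine Finset.sum_congr rfl fun ν _ => ?_
    push_cast; ring
  -- The total weight `1` of the smearing fixes the coefficient of `-h x`.
  rw [integral_congr_ae this, integral_mul_const, integral_complex_ofReal, S.c_weight]
  simp

/-- `u_ν I_c^ν = 0`. -/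
theorem sum_u_Ic (hh : StringIntegrable h S.dirs) (ch : Continuous h) (x : Mink) :
    ∑ ν, ((g ν * S.u ν : ℝ) : ℂ) * S.Ic ν h x = 0 := by
  simp only [Strings.Ic, ← integral_const_mul]
  rw [← integral_finsetSum _ fun ν _ => (hh.integrable_weight_stringInt ch ν x).const_mul _]
  refine integral_eq_zero_of_ae ?_
  filter_upwards [S.ae_dirs] with e he
  have : ∑ ν, ((g ν * S.u ν : ℝ) : ℂ) * (((S.c e * e ν : ℝ) : ℂ) * stringInt e h x) =
      ((dot e S.u : ℝ) : ℂ) * (((S.c e : ℝ) : ℂ) * stringInt e h x) := by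
    rw [dot]
    push_cast
    rw [Finset.sum_mul]
    refine Finset.sum_congr rfl fun ν _ => ?_
    ring
  rw [this, he.2]
  simp

/-! ### Field equations of the string-localized fields -/

namespace Config.OnShell

variable {N n : ℕ} {C : Consts N n} {Φ : Config N n} (hΦ : Φ.OnShell C S)
include hΦ

theorem contDiff_nul (a : Fin N) : ContDiff ℝ ∞ (Φ.nul a) :=
  ContDiff.sum fun μ _ => contDiff_const.mul (contDiff_pd (hΦ.smooth_AK a μ) μ)

theorem contDiff_IuN (a : Fin N) : ContDiff ℝ ∞ (stringInt S.u (Φ.nul a)) :=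
  contDiff_stringInt (hΦ.decay_nul a) (hΦ.contDiff_nul a)

theorem contDiff_A (a : Fin N) (μ : Fin 4) : ContDiff ℝ ∞ (Φ.A S a μ) :=
  (hΦ.smooth_AK a μ).add (contDiff_const.mul (hΦ.contDiff_IuN a))

theorem contDiff_F (a : Fin N) (μ ν : Fin 4) : ContDiff ℝ ∞ (Φ.F S a μ ν) :=
  (contDiff_pd (hΦ.contDiff_A a ν) μ).sub (contDiff_pd (hΦ.contDiff_A a μ) ν)

theorem pd_A (a : Fin N) (μ ν : Fin 4) : pd μ (Φ.A S a ν) = fun x =>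
    pd μ (Φ.AK a ν) x + ((g ν * S.u ν : ℝ) : ℂ) * pd μ (stringInt S.u (Φ.nul a)) x := by
  funext x
  rw [← pd_const_mul (hΦ.contDiff_IuN a), ← pd_add (hΦ.smooth_AK a ν)
    (contDiff_const.mul (hΦ.contDiff_IuN a))]
  rfl

theorem decay_pd_A (a : Fin N) (μ ν : Fin 4) : StringIntegrable (pd μ (Φ.A S a ν)) S.dirs := by
  have c1 := contDiff_pd (hΦ.contDiff_IuN a) μ
  rw [hΦ.pd_A]
  exact ((hΦ.decay_AK a ν).pd (hΦ.smooth_AK a ν) μ).add ((hΦ.decay_IuN a μ).const_mul c1 _)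
    (contDiff_pd (hΦ.smooth_AK a ν) μ) (contDiff_const.mul c1)

theorem decay_F (a : Fin N) (μ ν : Fin 4) : StringIntegrable (Φ.F S a μ ν) S.dirs := by
  have c1 := contDiff_pd (hΦ.contDiff_A a ν) μ
  have c2 := contDiff_pd (hΦ.contDiff_A a μ) ν
  have := (hΦ.decay_pd_A a μ ν).add ((hΦ.decay_pd_A a ν μ).const_mul c2 (-1)) c1
    (contDiff_const.mul c2)
  simp only [neg_mul, one_mul, ← sub_eq_add_neg] at this
  exact this

theorem contDiff_phi (a : Fin N) : ContDiff ℝ ∞ (Φ.phi S a) :=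
  ContDiff.sum fun ν _ => contDiff_Ic (hΦ.decay_AK a ν) (hΦ.smooth_AK a ν) ν

theorem contDiff_Ac (a : Fin N) (μ : Fin 4) : ContDiff ℝ ∞ (Φ.Ac S a μ) :=
  ContDiff.sum fun ν _ => contDiff_Ic (hΦ.decay_F a μ ν) (hΦ.contDiff_F a μ ν) ν

/-- `∂_μ A_ν(c) - ∂_ν A_μ(c) = F_{μν}`. -/
theorem curl_Ac (a : Fin N) (μ ν : Fin 4) (x : Mink) :
    pd μ (Φ.Ac S a ν) x - pd ν (Φ.Ac S a μ) x = Φ.F S a μ ν x := by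
  have key : ∀ μ ν, pd μ (Φ.Ac S a ν) x = ∑ κ, S.Ic κ (pd μ (Φ.F S a ν κ)) x := by
    intro μ ν
    have : pd μ (Φ.Ac S a ν) x = ∑ κ, pd μ (S.Ic κ (Φ.F S a ν κ)) x :=
      pd_sum _ (fun κ => contDiff_Ic (hΦ.decay_F a ν κ) (hΦ.contDiff_F a ν κ) κ) μ x
    rw [this]
    exact Finset.sum_congr rfl fun κ _ => pd_Ic (hΦ.decay_F a ν κ) (hΦ.contDiff_F a ν κ) μ κ x
  -- The Bianchi identity turns the curl of `I_c^κ F_{νκ}` into `-I_c^κ ∂_κ F_{μν}`, and `I_c^κ ∂_κ`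
  -- is minus the identity on functions decaying along the strings.
  have bianchi : ∀ κ, (fun y => pd μ (Φ.F S a ν κ) y - pd ν (Φ.F S a μ κ) y) =
      fun y => (-1 : ℂ) * pd κ (Φ.F S a μ ν) y := by
    intro κ
    funext y
    have e : ∀ i j l, pd i (Φ.F S a j l) y =
        pd i (pd j (Φ.A S a l)) y - pd i (pd l (Φ.A S a j)) y := fun i j l =>
      pd_sub (contDiff_pd (hΦ.contDiff_A a l) j) (contDiff_pd (hΦ.contDiff_A a j) l) i y
    rw [e, e, e, pd_comm (hΦ.contDiff_A a κ) μ ν, pd_comm (hΦ.contDiff_A a ν) κ μ,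
      pd_comm (hΦ.contDiff_A a μ) κ ν]
    ring
  have d : ∀ μ ν κ, StringIntegrable (pd μ (Φ.F S a ν κ)) S.dirs := fun μ ν κ =>
    (hΦ.decay_F a ν κ).pd (hΦ.contDiff_F a ν κ) μ
  have c : ∀ μ ν κ, ContDiff ℝ ∞ (pd μ (Φ.F S a ν κ)) := fun μ ν κ =>
    contDiff_pd (hΦ.contDiff_F a ν κ) μ
  rw [key, key, ← Finset.sum_sub_distrib]
  have : ∀ κ, S.Ic κ (pd μ (Φ.F S a ν κ)) x - S.Ic κ (pd ν (Φ.F S a μ κ)) x =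
      -S.Ic κ (pd κ (Φ.F S a μ ν)) x := by
    intro κ
    rw [← Ic_sub (d μ ν κ) (d ν μ κ) (c μ ν κ) (c ν μ κ), bianchi, Ic_const_mul]
    ring
  simp only [this, Finset.sum_neg_distrib]
  rw [sum_Ic_pd (hΦ.contDiff_F a μ ν) (fun κ => d κ μ ν) x fun e he =>
    ((hΦ.decay_F a μ ν).mono (by simpa using he)).tendsto_zero (hΦ.contDiff_F a μ ν) x]
  ring

/-- `∂_μ φ = A_μ(c) - A_μ`. -/
theorem pd_phi (a : Fin N) (μ : Fin 4) (x : Mink) :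
    pd μ (Φ.phi S a) x = Φ.Ac S a μ x - Φ.A S a μ x := by
  have c : ∀ μ ν, ContDiff ℝ ∞ (pd μ (Φ.A S a ν)) := fun μ ν => contDiff_pd (hΦ.contDiff_A a ν) μ
  have h1 : pd μ (Φ.phi S a) x = ∑ ν, S.Ic ν (pd μ (Φ.AK a ν)) x := by
    have : pd μ (Φ.phi S a) x = ∑ ν, pd μ (S.Ic ν (Φ.AK a ν)) x :=
      pd_sum _ (fun ν => contDiff_Ic (hΦ.decay_AK a ν) (hΦ.smooth_AK a ν) ν) μ x
    rw [this]
    exact Finset.sum_congr rfl fun ν _ => pd_Ic (hΦ.decay_AK a ν) (hΦ.smooth_AK a ν) μ ν x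
  have h2 : Φ.Ac S a μ x = ∑ ν, S.Ic ν (pd μ (Φ.A S a ν)) x
      - ∑ ν, S.Ic ν (pd ν (Φ.A S a μ)) x := by
    rw [← Finset.sum_sub_distrib]
    exact Finset.sum_congr rfl fun ν _ =>
      Ic_sub (hΦ.decay_pd_A a μ ν) (hΦ.decay_pd_A a ν μ) (c μ ν) (c ν μ) ν x
  -- The term `u_ν I_u N` of `A_ν` drops out because all string directions are orthogonal to `u`.
  have h3 : ∑ ν, S.Ic ν (pd μ (Φ.A S a ν)) x = ∑ ν, S.Ic ν (pd μ (Φ.AK a ν)) x := by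
    have c1 := contDiff_pd (hΦ.contDiff_IuN a) μ
    rw [← add_zero (∑ ν, S.Ic ν (pd μ (Φ.AK a ν)) x),
      ← sum_u_Ic (hΦ.decay_IuN a μ) c1.continuous x, ← Finset.sum_add_distrib]
    refine Finset.sum_congr rfl fun ν _ => ?_
    rw [hΦ.pd_A, Ic_add ((hΦ.decay_AK a ν).pd (hΦ.smooth_AK a ν) μ)
      ((hΦ.decay_IuN a μ).const_mul c1 _) (contDiff_pd (hΦ.smooth_AK a ν) μ)
      (contDiff_const.mul c1), Ic_const_mul]
  -- Only the derivatives of `I_u N` are assumed integrable along the strings, so its limit at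
  -- infinity needs the separate hypothesis `vanish_IuN`.
  have h4 : ∑ ν, S.Ic ν (pd ν (Φ.A S a μ)) x = -Φ.A S a μ x := by
    refine sum_Ic_pd (hΦ.contDiff_A a μ) (fun ν => hΦ.decay_pd_A a ν μ) x fun e he => ?_
    have t1 := ((hΦ.decay_AK a μ).mono (E' := {e}) (by simpa using he)).tendsto_zero
      (hΦ.smooth_AK a μ) x
    have t2 := (hΦ.vanish_IuN a x e he).const_mul ((g μ * S.u μ : ℝ) : ℂ)
    simpa [Config.A] using t1.add t2
  rw [h1, h2, h3, h4]
  ring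

/-- `∂_μ A_ν - ∂_ν A_μ = F_{μν}` for `A(c) + A`. -/
theorem curl_sumA (a : Fin N) (μ ν : Fin 4) (x : Mink) :
    (pd μ (Φ.Ac S a ν) x + pd μ (Φ.A S a ν) x) - (pd ν (Φ.Ac S a μ) x + pd ν (Φ.A S a μ) x) =
      2 * Φ.F S a μ ν x := by
  have := hΦ.curl_Ac a μ ν x
  have h2 : pd μ (Φ.A S a ν) x - pd ν (Φ.A S a μ) x = Φ.F S a μ ν x := rfl
  linear_combination this + h2

/-- `□ ∂^κ A^K_κ = 0`. -/
theorem box_nul (a : Fin N) (x : Mink) : box (Φ.nul a) x = 0 := by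
  have h1 : ∀ μ, pd μ (Φ.nul a) = fun y => ∑ κ, (g κ : ℂ) * pd κ (pd μ (Φ.AK a κ)) y := by
    intro μ
    funext y
    have : pd μ (Φ.nul a) y = ∑ κ, pd μ (fun y => (g κ : ℂ) * pd κ (Φ.AK a κ) y) y :=
      pd_sum _ (fun κ => contDiff_const.mul (contDiff_pd (hΦ.smooth_AK a κ) κ)) μ y
    rw [this]
    refine Finset.sum_congr rfl fun κ _ => ?_
    rw [pd_const_mul (contDiff_pd (hΦ.smooth_AK a κ) κ), pd_comm (hΦ.smooth_AK a κ)]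
  have cc : ∀ μ κ, ContDiff ℝ ∞ (pd μ (Φ.AK a κ)) := fun μ κ => contDiff_pd (hΦ.smooth_AK a κ) μ
  have h2 : ∀ μ, pd μ (pd μ (Φ.nul a)) x =
      ∑ κ, (g κ : ℂ) * pd κ (pd μ (pd μ (Φ.AK a κ))) x := by
    intro μ
    rw [h1, pd_sum _ (fun κ => contDiff_const.mul (contDiff_pd (cc μ κ) κ))]
    refine Finset.sum_congr rfl fun κ _ => ?_
    rw [pd_const_mul (contDiff_pd (cc μ κ) κ), pd_comm (cc μ κ)]
  have h3 : ∀ κ, ∑ μ, (g μ : ℂ) * pd κ (pd μ (pd μ (Φ.AK a κ))) x = 0 := by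
    intro κ
    have : pd κ (box (Φ.AK a κ)) x = ∑ μ, pd κ (fun y => (g μ : ℂ) * pd μ (pd μ (Φ.AK a κ)) y) x :=
      pd_sum _ (fun μ => contDiff_const.mul (contDiff_pd (cc μ κ) μ)) κ x
    have h0 : box (Φ.AK a κ) = fun _ => 0 := funext (hΦ.wave a κ)
    rw [h0] at this
    simp only [pd_const_mul (contDiff_pd (cc _ κ) _)] at this
    rw [← this]
    simp [pd]
  simp only [box, h2, Finset.mul_sum]
  rw [Finset.sum_comm]
  refine Finset.sum_eq_zero fun κ _ => ?_
  have := congrArg (fun z => (g κ : ℂ) * z) (h3 κ)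
  simp only [Finset.mul_sum, mul_zero] at this
  rw [← this]
  exact Finset.sum_congr rfl fun μ _ => by ring

/-- `□ A_ν = 0`. -/
theorem box_A (a : Fin N) (ν : Fin 4) (x : Mink) : box (Φ.A S a ν) x = 0 := by
  have cN := hΦ.contDiff_nul a
  have cI := hΦ.contDiff_IuN a
  have dN := hΦ.decay_nul a
  have h1 : ∀ μ, pd μ (pd μ (Φ.A S a ν)) x = pd μ (pd μ (Φ.AK a ν)) x +
      ((g ν * S.u ν : ℝ) : ℂ) * stringInt S.u (pd μ (pd μ (Φ.nul a))) x := by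
    intro μ
    have e : pd μ (stringInt S.u (Φ.nul a)) = stringInt S.u (pd μ (Φ.nul a)) :=
      funext fun y => pd_stringInt dN cN μ y
    rw [hΦ.pd_A, pd_add (contDiff_pd (hΦ.smooth_AK a ν) μ) (contDiff_const.mul (contDiff_pd cI μ)),
      pd_const_mul (contDiff_pd cI μ), e, pd_stringInt (dN.pd cN μ) (contDiff_pd cN μ)]
  have h2 : ∑ μ, (g μ : ℂ) * stringInt S.u (pd μ (pd μ (Φ.nul a))) x = 0 := by
    simp only [stringInt, ← integral_const_mul]
    rw [← integral_finsetSum]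
    · refine integral_eq_zero_of_ae (Eventually.of_forall fun s => hΦ.box_nul a _)
    · intro μ _
      exact (((dN.pd cN μ).pd (contDiff_pd cN μ) μ).integrable
        (contDiff_pd (contDiff_pd cN μ) μ).continuous x).const_mul _
  have h3 := hΦ.wave a ν x
  simp only [box, h1, mul_add, Finset.sum_add_distrib] at h3 ⊢
  rw [h3, zero_add, ← mul_zero ((g ν * S.u ν : ℝ) : ℂ), ← h2, Finset.mul_sum]
  exact Finset.sum_congr rfl fun μ _ => by ring

/-- `∂^μ A_μ = 0`. -/
theorem div_A (a : Fin N) (x : Mink) : ∑ μ, (g μ : ℂ) * pd μ (Φ.A S a μ) x = 0 := by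
  have cN := hΦ.contDiff_nul a
  have dN := hΦ.decay_nul a
  -- Since `u^μ ∂_μ I_u N = -N`, the string term of `A_μ` cancels the divergence of the Feynman
  -- gauge potential.
  have h1 := sum_stringInt_pd cN (fun μ => dN.pd cN μ) x (dN.tendsto_zero cN x)
  simp only [← pd_stringInt dN cN] at h1
  have gg : ∀ μ : Fin 4, (g μ : ℂ) * (g μ : ℂ) = 1 := by
    intro μ; fin_cases μ <;> simp [g]
  have h2 : ∑ μ, (g μ : ℂ) * pd μ (Φ.A S a μ) x =
      Φ.nul a x + ∑ μ, (S.u μ : ℂ) * pd μ (stringInt S.u (Φ.nul a)) x := by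
    rw [Config.nul, ← Finset.sum_add_distrib]
    refine Finset.sum_congr rfl fun μ _ => ?_
    rw [hΦ.pd_A]
    push_cast
    linear_combination (S.u μ : ℂ) * pd μ (stringInt S.u (Φ.nul a)) x * gg μ
  rw [h2, h1]
  ring

/-- `∂^μ F_{μν} = 0`. -/
theorem maxwell (a : Fin N) (ν : Fin 4) (x : Mink) :
    ∑ μ, (g μ : ℂ) * pd μ (Φ.F S a μ ν) x = 0 := by
  have cA := hΦ.contDiff_A a
  have e : ∀ μ, pd μ (Φ.F S a μ ν) x =
      pd μ (pd μ (Φ.A S a ν)) x - pd ν (pd μ (Φ.A S a μ)) x := fun μ => by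
    rw [← pd_comm (cA μ) μ ν]
    exact pd_sub (contDiff_pd (cA ν) μ) (contDiff_pd (cA μ) ν) μ x
  -- The gauge condition `∂^μ A_μ = 0` reduces the Maxwell equation to the wave equation.
  have h1 : ∑ μ, (g μ : ℂ) * pd ν (pd μ (Φ.A S a μ)) x = 0 := by
    have := pd_sum Finset.univ (h := fun μ y => (g μ : ℂ) * pd μ (Φ.A S a μ) y)
      (fun μ => contDiff_const.mul (contDiff_pd (cA μ) μ)) ν x
    simp only [pd_const_mul (contDiff_pd (cA _) _), hΦ.div_A] at this
    rw [← this]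
    simp [pd]
  have h2 := hΦ.box_A a ν x
  simp only [e, mul_sub, Finset.sum_sub_distrib, h1, sub_zero]
  exact h2

end Config.OnShell

theorem Config.F_antisymm {N n : ℕ} (Φ : Config N n) (a : Fin N) (μ ν : Fin 4) (x : Mink) :
    Φ.F S a ν μ x = -Φ.F S a μ ν x := by
  simp [Config.F]

/-! ### Test functions -/

namespace IsTest

variable {f f' : Mink × Mink → ℂ}

theorem zero : IsTest fun _ => 0 := ⟨contDiff_const, HasCompactSupport.zero⟩

theorem add (hf : IsTest f) (hf' : IsTest f') : IsTest fun p => f p + f' p :=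
  ⟨hf.1.add hf'.1, hf.2.add hf'.2⟩

theorem mul_left (hf : IsTest f) {h : Mink × Mink → ℂ} (hh : ContDiff ℝ ∞ h) :
    IsTest fun p => h p * f p :=
  ⟨hh.mul hf.1, hf.2.mul_left⟩

theorem const_mul (hf : IsTest f) (z : ℂ) : IsTest fun p => z * f p :=
  hf.mul_left contDiff_const

theorem fst_mul (hf : IsTest f) {h : Mink → ℂ} (hh : ContDiff ℝ ∞ h) :
    IsTest fun p => h p.1 * f p :=
  hf.mul_left (hh.comp contDiff_fst)

theorem snd_mul (hf : IsTest f) {h : Mink → ℂ} (hh : ContDiff ℝ ∞ h) :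
    IsTest fun p => h p.2 * f p :=
  hf.mul_left (hh.comp contDiff_snd)

theorem sum {ι : Type*} (s : Finset ι) {F : ι → Mink × Mink → ℂ} (hF : ∀ i ∈ s, IsTest (F i)) :
    IsTest fun p => ∑ i ∈ s, F i p := by
  classical
  induction s using Finset.induction_on with
  | empty => simpa using zero
  | insert i s his ih =>
    simp only [Finset.sum_insert his]
    exact (hF i (Finset.mem_insert_self i s)).add
      (ih fun j hj => hF j (Finset.mem_insert_of_mem hj))

theorem fderiv_apply (hf : IsTest f) (v : Mink × Mink) : IsTest fun p => fderiv ℝ f p v :=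
  ⟨(hf.1.fderiv_right (by simp)).clm_apply contDiff_const, hf.2.fderiv_apply ℝ v⟩

theorem swap (hf : IsTest f) : IsTest fun p => f (p.2, p.1) :=
  ⟨hf.1.comp (contDiff_snd.prodMk contDiff_fst),
    hf.2.comp_homeomorph (Homeomorph.prodComm Mink Mink)⟩

theorem differentiableAt (hf : IsTest f) (p : Mink × Mink) : DifferentiableAt ℝ f p :=
  hf.1.differentiable (by simp) p

theorem exists_radius (hf : IsTest f) : ∃ R : ℝ, 0 < R ∧ ∀ p, f p ≠ 0 → ‖p.1‖ ≤ R ∧ ‖p.2‖ ≤ R := by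
  obtain ⟨R, hR⟩ := hf.2.isCompact.isBounded.exists_norm_le
  refine ⟨max R 1, by positivity, fun p hp => ?_⟩
  have := hR p (subset_tsupport f hp)
  exact ⟨(norm_fst_le p).trans (this.trans (le_max_left _ _)),
    (norm_snd_le p).trans (this.trans (le_max_left _ _))⟩

theorem exists_bound (hf : IsTest f) : ∃ M : ℝ, ∀ p, ‖f p‖ ≤ M :=
  hf.2.exists_bound_of_continuous hf.1.continuous

/-- Restriction to a translate of the diagonal. -/
theorem diag (hf : IsTest f) (a : Mink) :
    ContDiff ℝ ∞ (fun x => f (x, x + a)) ∧ HasCompactSupport fun x => f (x, x + a) := by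
  refine ⟨hf.1.comp (contDiff_id.prodMk (contDiff_id.add contDiff_const)), ?_⟩
  obtain ⟨R, -, hR⟩ := hf.exists_radius
  refine HasCompactSupport.intro (isCompact_closedBall (0 : Mink) R) fun x hx => ?_
  by_contra h
  exact hx (by simpa using (hR _ h).1)

theorem integrable_diag (hf : IsTest f) (a : Mink) : Integrable fun x => f (x, x + a) :=
  (hf.diag a).1.continuous.integrable_of_hasCompactSupport (hf.diag a).2

end IsTest

/-- Integration by parts against the constant function `1`. -/
theorem integral_fderiv_eq_zero_of_hasCompactSupport {h : Mink → ℂ} (ch : ContDiff ℝ ∞ h)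
    (hs : HasCompactSupport h) (v : Mink) : ∫ x, fderiv ℝ h x v = 0 := by
  have c' : Continuous fun x => fderiv ℝ h x v := by
    exact (ch.continuous_fderiv (by simp)).clm_apply continuous_const
  have hi := ch.continuous.integrable_of_hasCompactSupport (μ := volume) hs
  have hi' := c'.integrable_of_hasCompactSupport (μ := volume) (hs.fderiv_apply ℝ v)
  have := integral_smul_fderiv_eq_neg_fderiv_smul_of_integrable (μ := volume) (𝕜 := ℝ) (v := v)
    (f := fun _ : Mink => (1 : ℝ)) (g := h) (by simp) (by simpa using hi') (by simpa using hi)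
    (fun x _ => differentiableAt_const _) (fun x _ => ch.differentiable (by simp) x)
  simpa using this

theorem fderiv_diag {f : Mink × Mink → ℂ} (hf : IsTest f) (a x v : Mink) :
    fderiv ℝ (fun x => f (x, x + a)) x v =
      fderiv ℝ f (x, x + a) (v, 0) + fderiv ℝ f (x, x + a) (0, v) := by
  have h1 : HasFDerivAt (fun x : Mink => (x, x + a))
      ((ContinuousLinearMap.id ℝ Mink).prod (ContinuousLinearMap.id ℝ Mink)) x :=
    (hasFDerivAt_id x).prodMk ((hasFDerivAt_id x).add_const a)
  have h2 := (hf.differentiableAt (x, x + a)).hasFDerivAt.comp x h1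
  have h3 : fderiv ℝ (fun x => f (x, x + a)) x = _ := h2.fderiv
  rw [h3, ← map_add]
  simp

/-- Translation invariance of the integral over a translate of the diagonal. -/
theorem integral_diag_fderiv {f : Mink × Mink → ℂ} (hf : IsTest f) (a v : Mink) :
    ∫ x, fderiv ℝ f (x, x + a) (v, 0) = -∫ x, fderiv ℝ f (x, x + a) (0, v) := by
  have h := integral_fderiv_eq_zero_of_hasCompactSupport (hf.diag a).1 (hf.diag a).2 v
  simp only [fderiv_diag hf] at h
  rw [integral_add ((hf.fderiv_apply (v, 0)).integrable_diag a)
    ((hf.fderiv_apply (0, v)).integrable_diag a)] at h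
  exact eq_neg_of_add_eq_zero_left h

/-! ### Line integrals of the delta distribution -/

/-- The integrands vanish for `x` outside one ball that does not depend on `a`, so this is a
parametric integral over a fixed compact set. -/
theorem continuous_integral_diag {f : Mink × Mink → ℂ} (hf : IsTest f) :
    Continuous fun a : Mink => ∫ x, f (x, x + a) := by
  obtain ⟨R, -, hR⟩ := hf.exists_radius
  have : (fun a : Mink => ∫ x, f (x, x + a)) =
      fun a => ∫ x in Metric.closedBall (0 : Mink) R, f (x, x + a) := by
    funext a
    refine (setIntegral_eq_integral_of_forall_compl_eq_zero fun x hx => ?_).symm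
    by_contra h
    exact hx (by simpa using (hR _ h).1)
  rw [this]
  refine continuous_parametric_integral_of_continuous ?_ (isCompact_closedBall _ _)
  exact hf.1.continuous.comp
    (continuous_snd.prodMk (continuous_snd.add continuous_fst))

/-- If `f` lives where both arguments have norm at most `R`, then `f (x, x + s • e) ≠ 0` forces `s
‖e‖ ≤ 2R`, hence `s ≤ 4R`. The majorant is constant up to `4R` and does not depend on `e`. The
threshold `1/2` is a convenient lower bound valid for `u` and for all string directions. -/
theorem exists_line_bound {f : Mink × Mink → ℂ} (hf : IsTest f) :
    ∃ b : ℝ → ℝ, IntegrableOn b (Ioi 0) ∧ ∀ e : Mink, 1 / 2 ≤ ‖e‖ → ∀ s : ℝ, 0 < s →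
      ‖∫ x, f (x, x + s • e)‖ ≤ b s := by
  obtain ⟨R, hR0, hR⟩ := hf.exists_radius
  obtain ⟨M, hM⟩ := hf.exists_bound
  set V := (volume : Measure Mink).real (Metric.closedBall 0 R)
  have hM0 : 0 ≤ M := (norm_nonneg _).trans (hM 0)
  refine ⟨indicator (Icc 0 (4 * R)) fun _ => M * V, ?_, fun e he s hs => ?_⟩
  · refine Integrable.integrableOn ((integrable_indicator_iff measurableSet_Icc).2 ?_)
    exact integrableOn_const isCompact_Icc.measure_lt_top.ne
  · by_cases hsR : s ≤ 4 * R
    · rw [indicator_of_mem (show s ∈ Icc 0 (4 * R) from ⟨hs.le, hsR⟩)]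
      rw [← setIntegral_eq_integral_of_forall_compl_eq_zero (s := Metric.closedBall (0 : Mink) R)]
      · exact norm_setIntegral_le_of_norm_le_const (isCompact_closedBall _ _).measure_lt_top
          fun x _ => hM _
      · intro x hx
        by_contra h
        exact hx (by simpa using (hR _ h).1)
    · rw [indicator_of_notMem (fun h => hsR h.2)]
      refine (norm_eq_zero.2 (integral_eq_zero_of_ae (Eventually.of_forall fun x => ?_))).le
      by_contra h
      obtain ⟨h1, h2⟩ := hR _ h
      simp only at h1 h2
      have h3 : ‖s • e‖ ≤ 2 * R := by
        calc ‖s • e‖ = ‖(x + s • e) - x‖ := by simp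
          _ ≤ ‖x + s • e‖ + ‖x‖ := norm_sub_le _ _
          _ ≤ 2 * R := by linarith
      rw [norm_smul, Real.norm_of_nonneg hs.le] at h3
      push Not at hsR
      nlinarith

theorem integrableOn_line {f : Mink × Mink → ℂ} (hf : IsTest f) {e : Mink} (he : 1 / 2 ≤ ‖e‖) :
    IntegrableOn (fun s : ℝ => ∫ x, f (x, x + s • e)) (Ioi 0) := by
  obtain ⟨b, hb, hle⟩ := exists_line_bound hf
  refine hb.mono' ((continuous_integral_diag hf).comp (by fun_prop)).aestronglyMeasurable ?_
  filter_upwards [ae_restrict_mem measurableSet_Ioi] with s hs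
  exact hle e he s hs

/-- The norm is the maximum norm: three spatial components below `1/2` in absolute value could not
have squares adding up to `1`. -/
theorem Strings.half_le_norm (S : Strings) {e : Mink} (he : e ∈ S.dirs) : 1 / 2 ≤ ‖e‖ := by
  have h1 := (S.dirs_spatial he).1
  by_contra h
  push Not at h
  have hc : ∀ i, e i ^ 2 ≤ 1 / 4 := fun i => by
    have h2 : |e i| < 1 / 2 := (norm_le_pi_norm e i).trans_lt h
    rw [← sq_abs]
    nlinarith [abs_nonneg (e i)]
  linarith [hc 1, hc 2, hc 3]

theorem Strings.half_le_norm_u (S : Strings) : 1 / 2 ≤ ‖S.u‖ := by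
  have hu := S.u_unit
  simp only [dot, g, Fin.sum_univ_four, Matrix.cons_val] at hu
  have h1 : |S.u 0| ≤ ‖S.u‖ := norm_le_pi_norm S.u 0
  have h2 : 1 ≤ |S.u 0| ^ 2 := by
    rw [sq_abs]
    nlinarith [sq_nonneg (S.u 1), sq_nonneg (S.u 2), sq_nonneg (S.u 3)]
  nlinarith [abs_nonneg (S.u 0)]

/-- An integrable weight times a measurable function that is bounded uniformly over the string
directions. -/
theorem integrable_weight_lineDelta (S : Strings) (ν : Fin 4) {f : Mink × Mink → ℂ}
    (hf : IsTest f) :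
    Integrable (fun e => ((S.c e * e ν : ℝ) : ℂ) * Bilocal.lineDelta e f) S.σ := by
  obtain ⟨b, hb, hle⟩ := exists_line_bound hf
  have hm : StronglyMeasurable fun p : Mink × ℝ => ∫ x, f (x, x + p.2 • p.1) :=
    ((continuous_integral_diag hf).comp
      (continuous_snd.smul continuous_fst)).stronglyMeasurable
  have hw : Integrable (fun e => ((S.c e * e ν : ℝ) : ℂ)) S.σ := (S.integrable_weight ν).ofReal
  refine hw.mul_bdd (c := ∫ s in Ioi (0 : ℝ), b s)
    (hm.integral_prod_right (ν := volume.restrict (Ioi (0 : ℝ)))).aestronglyMeasurable ?_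
  filter_upwards [S.ae_dirs] with e he
  refine norm_integral_le_of_norm_le hb ?_
  filter_upwards [ae_restrict_mem measurableSet_Ioi] with s hs
  exact hle e (S.half_le_norm he) s hs

namespace Bilocal

/-! ### Linear functionals on test functions -/

namespace IsLinear

variable {D D' : Bilocal}

theorem map_zero (hD : D.IsLinear) : D (fun _ => 0) = 0 := by
  have := hD _ _ IsTest.zero IsTest.zero 1
  simpa using this

theorem map_add (hD : D.IsLinear) {f f' : Mink × Mink → ℂ} (hf : IsTest f) (hf' : IsTest f') :
    D (fun p => f p + f' p) = D f + D f' := by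
  simpa using hD f f' hf hf' 1

theorem map_const_mul (hD : D.IsLinear) {f : Mink × Mink → ℂ} (hf : IsTest f) (z : ℂ) :
    D (fun p => z * f p) = z * D f := by
  simpa [hD.map_zero] using hD _ f IsTest.zero hf z

theorem map_sum (hD : D.IsLinear) {ι : Type*} (s : Finset ι) {F : ι → Mink × Mink → ℂ}
    (hF : ∀ i, IsTest (F i)) : D (fun p => ∑ i ∈ s, F i p) = ∑ i ∈ s, D (F i) := by
  classical
  induction s using Finset.induction_on with
  | empty => simpa using hD.map_zero
  | insert i s his ih =>
    simp only [Finset.sum_insert his]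
    rw [hD.map_add (hF i) (IsTest.sum s fun j _ => hF j), ih]

theorem smul (hD : D.IsLinear) (z : ℂ) : (z • D).IsLinear := by
  intro f f' hf hf' w
  simp only [Pi.smul_apply, smul_eq_mul, hD f f' hf hf' w]
  ring

theorem swap (hD : D.IsLinear) : D.swap.IsLinear := fun _ _ hf hf' z => hD _ _ hf.swap hf'.swap z

end IsLinear

theorem isLinear_delta : delta.IsLinear := by
  intro f f' hf hf' z
  have h1 := hf.integrable_diag 0
  have h2 := hf'.integrable_diag 0
  simp only [add_zero] at h1 h2
  simp only [delta]
  rw [integral_add h1 (h2.const_mul z), integral_const_mul]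

theorem isLinear_iDelta : iDelta.IsLinear := isLinear_delta.smul _

theorem isLinear_lineDelta {e : Mink} (he : 1 / 2 ≤ ‖e‖) : (lineDelta e).IsLinear := by
  intro f f' hf hf' z
  simp only [lineDelta]
  rw [← integral_const_mul, ← integral_add (integrableOn_line hf he)
    ((integrableOn_line hf' he).const_mul z)]
  refine integral_congr_ae (Eventually.of_forall fun s => ?_)
  simp only
  rw [integral_add (hf.integrable_diag _) ((hf'.integrable_diag _).const_mul z), integral_const_mul]

theorem isLinear_IuDelta (S : Strings) (ν : Fin 4) : (IuDelta S ν).IsLinear :=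
  (isLinear_lineDelta S.half_le_norm_u).smul _

theorem isLinear_IcDelta (S : Strings) (ν : Fin 4) : (IcDelta S ν).IsLinear := by
  intro f f' hf hf' z
  simp only [IcDelta]
  rw [← integral_const_mul, ← integral_add (integrable_weight_lineDelta S ν hf)
    ((integrable_weight_lineDelta S ν hf').const_mul z)]
  refine integral_congr_ae ?_
  filter_upwards [S.ae_dirs] with e he
  rw [isLinear_lineDelta (S.half_le_norm he) f f' hf hf' z]
  ring

/-- Invariance under simultaneous translations of `x` and `x'`. -/
def TranslationInvariant (D : Bilocal) : Prop :=
  ∀ f, IsTest f → ∀ v : Mink,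
    D (fun p => fderiv ℝ f p (v, 0)) = -D (fun p => fderiv ℝ f p (0, v))

theorem fderiv_swap {f : Mink × Mink → ℂ} (hf : IsTest f) (p : Mink × Mink) (v w : Mink) :
    fderiv ℝ (fun p => f (p.2, p.1)) p (v, w) = fderiv ℝ f (p.2, p.1) (w, v) := by
  have h1 : HasFDerivAt (fun p : Mink × Mink => (p.2, p.1))
      ((ContinuousLinearMap.snd ℝ Mink Mink).prod (ContinuousLinearMap.fst ℝ Mink Mink)) p :=
    hasFDerivAt_snd.prodMk hasFDerivAt_fst
  have h2 := (hf.differentiableAt (p.2, p.1)).hasFDerivAt.comp p h1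
  have h3 : fderiv ℝ (fun p => f (p.2, p.1)) p = _ := h2.fderiv
  rw [h3]
  simp

namespace TranslationInvariant

variable {D : Bilocal}

theorem smul (hD : D.TranslationInvariant) (z : ℂ) : (z • D).TranslationInvariant := by
  intro f hf v
  simp only [Pi.smul_apply, hD f hf v, smul_neg]

theorem swap (hD : D.TranslationInvariant) : D.swap.TranslationInvariant := by
  intro f hf v
  have := hD _ hf.swap v
  simp only [fderiv_swap hf] at this
  simp only [Bilocal.swap, this, neg_neg]

end TranslationInvariant

theorem translationInvariant_lineDelta (e : Mink) : (lineDelta e).TranslationInvariant := by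
  intro f hf v
  simp only [lineDelta, integral_diag_fderiv hf, integral_neg]

theorem translationInvariant_IuDelta (S : Strings) (ν : Fin 4) :
    (IuDelta S ν).TranslationInvariant :=
  (translationInvariant_lineDelta S.u).smul _

theorem translationInvariant_IcDelta (S : Strings) (ν : Fin 4) :
    (IcDelta S ν).TranslationInvariant := by
  intro f hf v
  simp only [IcDelta, translationInvariant_lineDelta _ f hf v, mul_neg, integral_neg]

/-! ### Leibniz rules -/

theorem fderiv_fst_mul {f : Mink × Mink → ℂ} (hf : IsTest f) {h : Mink → ℂ}
    (hh : ContDiff ℝ ∞ h) (κ : Fin 4) (p : Mink × Mink) :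
    fderiv ℝ (fun p => h p.1 * f p) p (Pi.single κ 1, 0) =
      pd κ h p.1 * f p + h p.1 * fderiv ℝ f p (Pi.single κ 1, 0) := by
  have h1 : HasFDerivAt (fun p : Mink × Mink => h p.1) _ p :=
    (hh.differentiable (by simp) p.1).hasFDerivAt.comp p hasFDerivAt_fst
  rw [fderiv_fun_mul h1.differentiableAt (hf.differentiableAt p), h1.fderiv]
  simp [pd]; ring

theorem fderiv_snd_mul {f : Mink × Mink → ℂ} (hf : IsTest f) {h : Mink → ℂ}
    (hh : ContDiff ℝ ∞ h) (κ : Fin 4) (p : Mink × Mink) :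
    fderiv ℝ (fun p => h p.2 * f p) p (0, Pi.single κ 1) =
      pd κ h p.2 * f p + h p.2 * fderiv ℝ f p (0, Pi.single κ 1) := by
  have h1 : HasFDerivAt (fun p : Mink × Mink => h p.2) _ p :=
    (hh.differentiable (by simp) p.2).hasFDerivAt.comp p hasFDerivAt_snd
  rw [fderiv_fun_mul h1.differentiableAt (hf.differentiableAt p), h1.fderiv]
  simp [pd]; ring

theorem fderiv_fst_mul_snd_dir {f : Mink × Mink → ℂ} (hf : IsTest f) {h : Mink → ℂ}
    (hh : ContDiff ℝ ∞ h) (v : Mink) (p : Mink × Mink) :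
    fderiv ℝ (fun p => h p.1 * f p) p (0, v) = h p.1 * fderiv ℝ f p (0, v) := by
  have h1 : HasFDerivAt (fun p : Mink × Mink => h p.1) _ p :=
    (hh.differentiable (by simp) p.1).hasFDerivAt.comp p hasFDerivAt_fst
  rw [fderiv_fun_mul h1.differentiableAt (hf.differentiableAt p), h1.fderiv]
  simp

theorem fderiv_snd_mul_fst_dir {f : Mink × Mink → ℂ} (hf : IsTest f) {h : Mink → ℂ}
    (hh : ContDiff ℝ ∞ h) (v : Mink) (p : Mink × Mink) :
    fderiv ℝ (fun p => h p.2 * f p) p (v, 0) = h p.2 * fderiv ℝ f p (v, 0) := by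
  have h1 : HasFDerivAt (fun p : Mink × Mink => h p.2) _ p :=
    (hh.differentiable (by simp) p.2).hasFDerivAt.comp p hasFDerivAt_snd
  rw [fderiv_fun_mul h1.differentiableAt (hf.differentiableAt p), h1.fderiv]
  simp

/-- For a translation invariant `D` and a conserved current `J^κ(x')`, a derivative `∂_κ D` with
respect to `x` is traded for an exterior derivative `-∂'_κ`. -/
theorem sum_dx_eq_neg_sum_dx'_mul {N : ℕ} {D : Bilocal} (hD : D.IsLinear)
    (tD : D.TranslationInvariant) {s : Mink → Fin N → ℂ} {J : Fin 4 → Mink → Fin N → ℂ}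
    (cs : ∀ a, ContDiff ℝ ∞ fun x => s x a) (cJ : ∀ κ a, ContDiff ℝ ∞ fun x => J κ x a)
    (dJ : ∀ a x, ∑ κ, pd κ (fun y => J κ y a) x = 0) {f : Mink × Mink → ℂ} (hf : IsTest f) :
    ∑ a, ∑ κ, dx κ D (fun p => s p.1 a * (J κ p.2 a * f p)) =
      -∑ κ, dx' κ (mul (fun x x' => ip (s x) (J κ x')) D) f := by
  have hf' : ∀ κ, IsTest fun p => fderiv ℝ f p (0, Pi.single κ 1) := fun κ => hf.fderiv_apply _
  have h1 : ∀ a κ, dx κ D (fun p => s p.1 a * (J κ p.2 a * f p)) =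
      D (fun p => s p.1 a * (pd κ (fun y => J κ y a) p.2 * f p)) +
        D (fun p => s p.1 a * (J κ p.2 a * fderiv ℝ f p (0, Pi.single κ 1))) := by
    intro a κ
    have t1 : IsTest fun p => J κ p.2 a * f p := hf.snd_mul (cJ κ a)
    -- Translation invariance moves the derivative from `x` to `x'`, where it acts on `J` and `f`
    -- but not on `s`.
    rw [dx, tD _ (t1.fst_mul (cs a)), neg_neg, ← hD.map_add
      ((hf.snd_mul (contDiff_pd (cJ κ a) κ)).fst_mul (cs a))
      (((hf' κ).snd_mul (cJ κ a)).fst_mul (cs a))]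
    congr 1
    funext p
    rw [fderiv_fst_mul_snd_dir t1 (cs a), fderiv_snd_mul hf (cJ κ a)]
    ring
  -- Conservation removes the terms in which the derivative hits the current.
  have h2 : ∀ a, ∑ κ, D (fun p => s p.1 a * (pd κ (fun y => J κ y a) p.2 * f p)) = 0 := by
    intro a
    rw [← hD.map_sum _ fun κ => (hf.snd_mul (contDiff_pd (cJ κ a) κ)).fst_mul (cs a)]
    simp only [← Finset.mul_sum, ← Finset.sum_mul, dJ, zero_mul, mul_zero]
    exact hD.map_zero
  have h3 : ∀ κ, dx' κ (mul (fun x x' => ip (s x) (J κ x')) D) f =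
      -∑ a, D (fun p => s p.1 a * (J κ p.2 a * fderiv ℝ f p (0, Pi.single κ 1))) := by
    intro κ
    rw [← hD.map_sum _ fun a => ((hf' κ).snd_mul (cJ κ a)).fst_mul (cs a)]
    simp only [dx', mul, ip, Finset.sum_mul, mul_assoc]
  simp only [h1, Finset.sum_add_distrib, h2, h3, Finset.sum_neg_distrib, neg_neg,
    zero_add]
  exact Finset.sum_comm

end Bilocal

/-! ### Algebra of structure constants -/

section LieAlgebra

variable {N : ℕ} (f : Fin N → Fin N → Fin N → ℝ)

section Bilinear

variable {R : Type*} [CommRing R] [Algebra ℂ R]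

/-- The bracket `i[X, Y]` as a bilinear map. -/
noncomputable def brHom : (Fin N → R) →ₗ[ℂ] (Fin N → R) →ₗ[ℂ] (Fin N → R) :=
  LinearMap.mk₂ ℂ (br f)
    (fun X X' Y => by funext c; simp [br, add_mul, smul_add, Finset.sum_add_distrib])
    (fun z X Y => by
      funext c
      simp only [br, Pi.smul_apply, smul_mul_assoc, Finset.smul_sum, smul_comm z])
    (fun X Y Y' => by funext c; simp [br, mul_add, smul_add, Finset.sum_add_distrib])
    (fun z X Y => by
      funext c
      simp only [br, Pi.smul_apply, mul_smul_comm, Finset.smul_sum, smul_comm z])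

/-- The inner product as a bilinear map. -/
noncomputable def ipHom : (Fin N → R) →ₗ[ℂ] (Fin N → R) →ₗ[ℂ] R :=
  LinearMap.mk₂ ℂ ip
    (fun X X' Y => by simp [ip, add_mul, Finset.sum_add_distrib])
    (fun z X Y => by simp [ip, Finset.smul_sum])
    (fun X Y Y' => by simp [ip, mul_add, Finset.sum_add_distrib])
    (fun z X Y => by simp [ip, Finset.smul_sum])

theorem brHom_apply (X Y : Fin N → R) : brHom f X Y = br f X Y := rfl

theorem ipHom_apply (X Y : Fin N → R) : ipHom X Y = ip X Y := rfl

variable {f} in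
theorem br_antisymm (hf : ∀ a b c, f a b c = -f b a c) (X Y : Fin N → R) :
    br f Y X = -br f X Y := by
  funext c
  simp only [br, Pi.neg_apply, ← Finset.sum_neg_distrib]
  rw [Finset.sum_comm]
  refine Finset.sum_congr rfl fun a _ => Finset.sum_congr rfl fun b _ => ?_
  rw [hf b a c, mul_comm, ← neg_smul]
  push_cast
  rfl

theorem ip_comm {R : Type*} [CommRing R] (X Y : Fin N → R) : ip Y X = ip X Y :=
  Finset.sum_congr rfl fun _ _ => mul_comm _ _

-- Invariance of the inner product: total antisymmetry makes the structure constants cyclic.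
variable {f} in
theorem ip_br (hf : ∀ a b c, f a b c = -f b a c ∧ f a b c = -f a c b) (X Y Z : Fin N → R) :
    ip X (br f Y Z) = ip (br f X Y) Z := by
  simp only [ip, br, Finset.mul_sum, Finset.sum_mul, mul_smul_comm, smul_mul_assoc]
  calc ∑ c, ∑ a, ∑ b, (-(f a b c : ℂ)) • (X c * (Y a * Z b))
      = ∑ c, ∑ b, ∑ a, (-(f a b c : ℂ)) • (X c * (Y a * Z b)) :=
        Finset.sum_congr rfl fun c _ => Finset.sum_comm
    _ = ∑ b, ∑ c, ∑ a, (-(f a b c : ℂ)) • (X c * (Y a * Z b)) := Finset.sum_comm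
    _ = _ := by
      refine Finset.sum_congr rfl fun b _ => Finset.sum_congr rfl fun c _ =>
        Finset.sum_congr rfl fun a _ => ?_
      rw [(hf a b c).2, (hf a c b).1, neg_neg, mul_assoc]

theorem map_br {R' : Type*} [CommRing R'] [Algebra ℂ R'] (F : R →ₐ[ℂ] R') (X Y : Fin N → R)
    (c : Fin N) : F (br f X Y c) = br f (fun a => F (X a)) (fun a => F (Y a)) c := by
  simp only [br, map_sum, map_smul, map_mul]

theorem map_ip {R' : Type*} [CommRing R'] [Algebra ℂ R'] (F : R →ₐ[ℂ] R') (X Y : Fin N → R) :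
    F (ip X Y) = ip (fun a => F (X a)) (fun a => F (Y a)) := by
  simp [ip]

theorem derivation_br (D : Derivation ℂ R R) (X Y : Fin N → R) (c : Fin N) :
    D (br f X Y c) = br f (fun a => D (X a)) Y c + br f X (fun a => D (Y a)) c := by
  simp only [br, map_sum, D.map_smul, D.leibniz, smul_eq_mul, smul_add, Finset.sum_add_distrib]
  rw [add_comm]
  simp only [mul_comm (Y _)]

theorem derivation_ip (D : Derivation ℂ R R) (X Y : Fin N → R) :
    D (ip X Y) = ip (fun a => D (X a)) Y + ip X (fun a => D (Y a)) := by
  simp only [ip, map_sum, D.leibniz, smul_eq_mul, Finset.sum_add_distrib]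
  rw [add_comm]
  simp only [mul_comm (Y _)]

end Bilinear

variable {f}
variable {𝔤 : Type*} [LieRing 𝔤] [LieAlgebra ℂ 𝔤] (ξ : Module.Basis (Fin N) ℂ 𝔤)

/-- Connects the component bracket with the abstract one: the factor `i` in front of the commutator
meets the `i` in the structure relation, whence the sign in `-f_{abc}`. -/
theorem equivFun_symm_br (hξ : ∀ a b, ⁅ξ a, ξ b⁆ = ∑ c, (Complex.I * (f a b c : ℂ)) • ξ c)
    (X Y : Fin N → ℂ) : ξ.equivFun.symm (br f X Y) =
      Complex.I • ⁅ξ.equivFun.symm X, ξ.equivFun.symm Y⁆ := by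
  simp only [Module.Basis.equivFun_symm_apply, lie_sum, sum_lie, smul_lie,
    lie_smul, hξ, br, Finset.smul_sum, Finset.sum_smul, smul_smul]
  rw [Finset.sum_comm]
  conv_rhs => rw [Finset.sum_comm]
  refine Finset.sum_congr rfl fun a _ => ?_
  rw [Finset.sum_comm]
  refine Finset.sum_congr rfl fun b _ => Finset.sum_congr rfl fun c _ => ?_
  congr 1
  simp only [smul_eq_mul]
  linear_combination (-(X a * Y b * f a b c)) * Complex.I_mul_I

/-- Inherited from the Lie algebra through the basis; no quadratic identity for the `f_{abc}` is
assumed. -/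
theorem br_jacobi (hξ : ∀ a b, ⁅ξ a, ξ b⁆ = ∑ c, (Complex.I * (f a b c : ℂ)) • ξ c)
    (X Y Z : Fin N → ℂ) :
    br f X (br f Y Z) + br f Y (br f Z X) + br f Z (br f X Y) = 0 := by
  apply ξ.equivFun.symm.injective
  simp only [map_add, equivFun_symm_br ξ hξ, lie_smul, ← smul_add, lie_jacobi, smul_zero, map_zero]

end LieAlgebra

/-! ### Lie-algebra valued functions -/

/-- Componentwise partial derivative. -/
noncomputable def pdV {N : ℕ} (μ : Fin 4) (X : Mink → Fin N → ℂ) (x : Mink) : Fin N → ℂ :=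
  fun a => pd μ (fun y => X y a) x

/-- Componentwise smoothness. -/
def SmoothV {N : ℕ} (X : Mink → Fin N → ℂ) : Prop := ∀ a, ContDiff ℝ ∞ fun y => X y a

section Smooth

variable {N : ℕ} {f : Fin N → Fin N → Fin N → ℝ} {X Y : Mink → Fin N → ℂ}

theorem SmoothV.add (hX : SmoothV X) (hY : SmoothV Y) : SmoothV fun y => X y + Y y :=
  fun a => (hX a).add (hY a)

theorem SmoothV.sub (hX : SmoothV X) (hY : SmoothV Y) : SmoothV fun y => X y - Y y :=
  fun a => (hX a).sub (hY a)

theorem SmoothV.sum {ι : Type*} {s : Finset ι} {X : ι → Mink → Fin N → ℂ}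
    (hX : ∀ i, SmoothV (X i)) : SmoothV fun y => ∑ i ∈ s, X i y := fun a => by
  simp only [Finset.sum_apply]
  exact ContDiff.sum fun i _ => hX i a

theorem SmoothV.br (hX : SmoothV X) (hY : SmoothV Y) : SmoothV fun y => br f (X y) (Y y) :=
  fun _ => ContDiff.sum fun a _ => ContDiff.sum fun b _ =>
    contDiff_const.mul ((hX a).mul (hY b))

theorem SmoothV.ip (hX : SmoothV X) (hY : SmoothV Y) :
    ContDiff ℝ ∞ fun y => StringQCD.ip (X y) (Y y) :=
  ContDiff.sum fun a _ => (hX a).mul (hY a)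

theorem SmoothV.pdV (hX : SmoothV X) (μ : Fin 4) : SmoothV (StringQCD.pdV μ X) :=
  fun a => contDiff_pd (hX a) μ

theorem pdV_br (hX : SmoothV X) (hY : SmoothV Y) (μ : Fin 4) (x : Mink) :
    pdV μ (fun y => br f (X y) (Y y)) x = br f (pdV μ X x) (Y x) + br f (X x) (pdV μ Y x) := by
  funext c
  have hs : ∀ a b, ContDiff ℝ ∞ fun y => X y a * Y y b := fun a b => (hX a).mul (hY b)
  have h1 : ∀ a b, ContDiff ℝ ∞ fun y => (-(f a b c : ℂ)) * (X y a * Y y b) := fun a b =>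
    contDiff_const.mul (hs a b)
  simp only [pdV, br, smul_eq_mul, Pi.add_apply]
  rw [pd_sum _ fun a => ContDiff.sum fun b _ => h1 a b]
  simp only [pd_sum _ (h1 _), pd_const_mul (hs _ _), pd_mul (hX _) (hY _), mul_add,
    Finset.sum_add_distrib]

theorem pd_ip (hX : SmoothV X) (hY : SmoothV Y) (μ : Fin 4) (x : Mink) :
    pd μ (fun y => ip (X y) (Y y)) x = ip (pdV μ X x) (Y x) + ip (X x) (pdV μ Y x) := by
  simp only [ip, pd_sum _ (fun a => (hX a).mul (hY a)), pd_mul (hX _) (hY _),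
    Finset.sum_add_distrib, pdV]

end Smooth

/-- The working tool for contracted indices: it reduces a vanishing double sum to an algebraic
identity for one pair of indices and its transpose. -/
theorem sum_sum_eq_zero_of_antisymm {ι M : Type*} [Fintype ι] [AddCommGroup M] [Module ℂ M]
    {E : ι → ι → M} (h : ∀ i j, E i j + E j i = 0) : ∑ i, ∑ j, E i j = 0 := by
  have h1 : ∑ i, ∑ j, E i j + ∑ i, ∑ j, E j i = 0 := by
    simp only [← Finset.sum_add_distrib, h, Finset.sum_const_zero]
  rw [Finset.sum_comm (f := fun i j => E j i)] at h1
  have h2 : (2 : ℂ) • ∑ i, ∑ j, E i j = 0 := by rw [two_smul, h1]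
  exact (smul_eq_zero.1 h2).resolve_left two_ne_zero

theorem g_mul_self (μ : Fin 4) : (g μ : ℂ) * (g μ : ℂ) = 1 := by
  fin_cases μ <;> simp [g]

/-! ### Smoothness of composite fields and conservation of the currents -/

namespace Config

variable {N n : ℕ} (C : Consts N n) (S : Strings) (Φ : Config N n)

/-- `F_{μν}` as a Lie-algebra valued function. -/
noncomputable def FV (μ ν : Fin 4) (x : Mink) : Fin N → ℂ := fun a => Φ.F S a μ ν x

/-- `A_μ(c)` as a Lie-algebra valued function. -/
noncomputable def AcV (μ : Fin 4) (x : Mink) : Fin N → ℂ := fun a => Φ.Ac S a μ x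

/-- `A_μ` as a Lie-algebra valued function. -/
noncomputable def AV (μ : Fin 4) (x : Mink) : Fin N → ℂ := fun a => Φ.A S a μ x

theorem FUp_eq (μ ν : Fin 4) (x : Mink) :
    Φ.FUp S μ ν x = ((g μ : ℂ) * (g ν : ℂ)) • Φ.FV S μ ν x := by
  funext a
  simp [FUp, FV]

theorem FV_antisymm (μ ν : Fin 4) (x : Mink) : Φ.FV S ν μ x = -Φ.FV S μ ν x := by
  funext a
  exact Φ.F_antisymm a μ ν x

theorem sumA_eq (ν : Fin 4) (x : Mink) : Φ.sumA S ν x = Φ.AcV S ν x + Φ.AV S ν x := rfl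

namespace OnShell

variable {C S Φ} (hΦ : Φ.OnShell C S)
include hΦ

theorem smoothV_FUp (μ ν : Fin 4) : SmoothV (Φ.FUp S μ ν) := fun a =>
  contDiff_const.mul (hΦ.contDiff_F a μ ν)

theorem smoothV_AcV (μ : Fin 4) : SmoothV (Φ.AcV S μ) := fun a => hΦ.contDiff_Ac a μ

theorem smoothV_AV (μ : Fin 4) : SmoothV (Φ.AV S μ) := fun a => hΦ.contDiff_A a μ

theorem smoothV_sumA (μ : Fin 4) : SmoothV (Φ.sumA S μ) :=
  (hΦ.smoothV_AcV μ).add (hΦ.smoothV_AV μ)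

theorem smoothV_phiV : SmoothV (Φ.phiV S) := fun a => hΦ.contDiff_phi a

theorem smoothV_sig (ν : Fin 4) : SmoothV (Φ.sig C S ν) :=
  hΦ.smoothV_phiV.br (hΦ.smoothV_sumA ν)

theorem smoothV_AAc (μ ν : Fin 4) : SmoothV (Φ.AAc C S μ ν) :=
  (hΦ.smoothV_AcV μ).br (hΦ.smoothV_AcV ν)

theorem smoothV_AA (μ ν : Fin 4) : SmoothV (Φ.AA C S μ ν) :=
  (hΦ.smoothV_AV μ).br (hΦ.smoothV_AV ν)

theorem contDiff_val (i : Fld N n) : ContDiff ℝ ∞ fun x => Φ.val S x i := by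
  cases i with
  | F a μ ν => exact contDiff_const.mul (hΦ.contDiff_F a μ ν)
  | Ac a μ => exact contDiff_const.mul (hΦ.contDiff_Ac a μ)
  | A a μ => exact contDiff_const.mul (hΦ.contDiff_A a μ)
  | phi a => exact hΦ.contDiff_phi a
  | psi m α => exact hΦ.smooth_psi m α
  | psib m α => exact hΦ.smooth_psib m α

theorem contDiff_eval (W : Wick N n) : ContDiff ℝ ∞ (Φ.eval S W) := by
  unfold Config.eval
  induction W using MvPolynomial.induction_on with
  | C z => simpa using contDiff_const
  | add p q hp hq => simpa using hp.add hq
  | mul_X p i hp => simpa using hp.mul (hΦ.contDiff_val i)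

theorem smoothV_jUp (μ : Fin 4) : SmoothV (Φ.jUp C S μ) := fun _ => hΦ.contDiff_eval _

theorem smoothV_JcUp (μ : Fin 4) : SmoothV (Φ.JcUp C S μ) :=
  (hΦ.smoothV_jUp μ).sub (SmoothV.sum fun ν => (hΦ.smoothV_FUp μ ν).br (hΦ.smoothV_AcV ν))

theorem smoothV_JUp (μ : Fin 4) : SmoothV (Φ.JUp C S μ) :=
  (hΦ.smoothV_jUp μ).sub (SmoothV.sum fun ν => (hΦ.smoothV_FUp μ ν).br (hΦ.smoothV_AV ν))

theorem contDiff_cubicPhi (μ : Fin 4) : ContDiff ℝ ∞ (Φ.cubicPhi C S μ) :=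
  ContDiff.sum fun ν _ => (hΦ.smoothV_FUp μ ν).ip
    (hΦ.smoothV_phiV.br (hΦ.smoothV_phiV.br (hΦ.smoothV_phiV.pdV ν)))

theorem pdV_phiV (μ : Fin 4) (x : Mink) : pdV μ (Φ.phiV S) x = Φ.AcV S μ x - Φ.AV S μ x :=
  funext fun a => hΦ.pd_phi a μ x

theorem pdV_sumA (μ ν : Fin 4) (x : Mink) :
    pdV μ (Φ.sumA S ν) x = fun a => pd μ (Φ.Ac S a ν) x + pd μ (Φ.A S a ν) x :=
  funext fun a => pd_add (hΦ.contDiff_Ac a ν) (hΦ.contDiff_A a ν) μ x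

/-- Both `A(c)` and `A` are potentials of `F`, so their sum has curl `2F`. -/
theorem pdV_sumA_swap (μ ν : Fin 4) (x : Mink) :
    pdV ν (Φ.sumA S μ) x = pdV μ (Φ.sumA S ν) x - (2 : ℂ) • Φ.FV S μ ν x := by
  rw [hΦ.pdV_sumA, hΦ.pdV_sumA]
  funext a
  simp only [Pi.sub_apply, Pi.smul_apply, smul_eq_mul, FV, ← hΦ.curl_sumA a μ ν x]
  ring

theorem maxwellUp (ν : Fin 4) (x : Mink) : ∑ μ, pdV μ (Φ.FUp S μ ν) x = 0 := by
  funext a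
  have h := hΦ.maxwell a ν x
  have e : ∀ μ, pdV μ (Φ.FUp S μ ν) x a = (g ν : ℂ) * ((g μ : ℂ) * pd μ (Φ.F S a μ ν) x) := by
    intro μ
    have : pdV μ (Φ.FUp S μ ν) x a = ((g μ * g ν : ℝ) : ℂ) * pd μ (Φ.F S a μ ν) x :=
      pd_const_mul (hΦ.contDiff_F a μ ν) _ μ x
    rw [this]; push_cast; ring
  simp only [Finset.sum_apply, e, ← Finset.mul_sum, h, mul_zero, Pi.zero_apply]

/-- `∂_μ j^μ = 0`. -/
theorem div_jUp (a : Fin N) (x : Mink) : ∑ μ, pd μ (fun y => Φ.jUp C S μ y a) x = 0 := by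
  have cs : ∀ m m' α β, ContDiff ℝ ∞ fun y => Φ.psib m α y * Φ.psi m' β y := fun m m' α β =>
    (hΦ.smooth_psib m α).mul (hΦ.smooth_psi m' β)
  have e : ∀ μ, (fun y => Φ.jUp C S μ y a) = fun y => ∑ m, ∑ m', ∑ α, ∑ β,
      (C.γ μ α β * C.τ a m m') * (Φ.psib m α y * Φ.psi m' β y) := by
    intro μ
    funext y
    simp [jUp, Config.eval, jWick, val]
  have c1 : ∀ μ m m' α β, ContDiff ℝ ∞ fun y =>
      (C.γ μ α β * C.τ a m m') * (Φ.psib m α y * Φ.psi m' β y) := fun μ m m' α β =>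
    contDiff_const.mul (cs m m' α β)
  -- The Leibniz terms are grouped so that, after summation over `μ`, each group contains one of the
  -- two Dirac equations.
  have e2 : ∀ μ, pd μ (fun y => Φ.jUp C S μ y a) x = ∑ m, ∑ m',
      (C.τ a m m' * ∑ β, Φ.psi m' β x * ∑ α, pd μ (Φ.psib m α) x * C.γ μ α β +
        C.τ a m m' * ∑ α, Φ.psib m α x * ∑ β, C.γ μ α β * pd μ (Φ.psi m' β) x) := by
    intro μ
    rw [e, pd_sum _ fun m => ContDiff.sum fun m' _ => ContDiff.sum fun α _ =>
      ContDiff.sum fun β _ => c1 μ m m' α β]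
    refine Finset.sum_congr rfl fun m _ => ?_
    rw [pd_sum _ fun m' => ContDiff.sum fun α _ => ContDiff.sum fun β _ => c1 μ m m' α β]
    refine Finset.sum_congr rfl fun m' _ => ?_
    rw [pd_sum _ fun α => ContDiff.sum fun β _ => c1 μ m m' α β]
    simp only [pd_sum _ (c1 μ m m' _), pd_const_mul (cs _ _ _ _),
      pd_mul (hΦ.smooth_psib _ _) (hΦ.smooth_psi _ _), mul_add, Finset.sum_add_distrib,
      Finset.mul_sum]
    congr 1
    · rw [Finset.sum_comm]
      refine Finset.sum_congr rfl fun α _ => Finset.sum_congr rfl fun β _ => ?_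
      ring
    · refine Finset.sum_congr rfl fun α _ => Finset.sum_congr rfl fun β _ => ?_
      ring
  simp only [e2]
  rw [Finset.sum_comm]
  refine Finset.sum_eq_zero fun m _ => ?_
  rw [Finset.sum_comm]
  refine Finset.sum_eq_zero fun m' _ => ?_
  rw [Finset.sum_add_distrib, ← Finset.mul_sum, ← Finset.mul_sum, Finset.sum_comm,
    Finset.sum_comm (f := fun μ α => Φ.psib m α x * ∑ β, C.γ μ α β * pd μ (Φ.psi m' β) x)]
  simp only [← Finset.mul_sum, hΦ.dirac_psi, hΦ.dirac_psib, mul_zero, Finset.sum_const_zero,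
    add_zero]

/-- Conservation of `j^μ - i[F^{μν}, B_ν]` for a potential `B` of the field strength. -/
theorem div_current (hf : ∀ a b c, C.f a b c = -C.f b a c) {B : Fin 4 → Mink → Fin N → ℂ}
    (cB : ∀ ν, SmoothV (B ν))
    (hB : ∀ μ ν x, pdV μ (B ν) x - pdV ν (B μ) x = Φ.FV S μ ν x) (a : Fin N) (x : Mink) :
    ∑ μ, pd μ (fun y => (Φ.jUp C S μ y - ∑ ν, br C.f (Φ.FUp S μ ν y) (B ν y)) a) x = 0 := by
  have c1 : ∀ μ ν, SmoothV fun y => br C.f (Φ.FUp S μ ν y) (B ν y) := fun μ ν =>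
    (hΦ.smoothV_FUp μ ν).br (cB ν)
  have e : ∀ μ, pd μ (fun y => (Φ.jUp C S μ y - ∑ ν, br C.f (Φ.FUp S μ ν y) (B ν y)) a) x =
      pd μ (fun y => Φ.jUp C S μ y a) x -
        ∑ ν, (br C.f (pdV μ (Φ.FUp S μ ν) x) (B ν x) +
          br C.f (Φ.FUp S μ ν x) (pdV μ (B ν) x)) a := by
    intro μ
    simp only [Pi.sub_apply, Finset.sum_apply]
    rw [pd_sub (hΦ.smoothV_jUp μ a) (ContDiff.sum fun ν _ => c1 μ ν a), pd_sum _ fun ν => c1 μ ν a]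
    simp only [← pdV_br (hΦ.smoothV_FUp μ _) (cB _)]
    rfl
  simp only [e, Finset.sum_sub_distrib, hΦ.div_jUp, zero_sub, ← Finset.sum_apply,
    Finset.sum_add_distrib]
  -- Maxwell equation.
  have h1 : ∑ μ, ∑ ν, br C.f (pdV μ (Φ.FUp S μ ν) x) (B ν x) = 0 := by
    rw [Finset.sum_comm]
    refine Finset.sum_eq_zero fun ν _ => ?_
    have := LinearMap.congr_fun (map_sum (brHom C.f) (fun μ => pdV μ (Φ.FUp S μ ν) x) Finset.univ)
      (B ν x)
    rw [hΦ.maxwellUp, map_zero, LinearMap.sum_apply] at this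
    exact this.symm
  -- The antisymmetric `F^{μν}` sees only the curl of `B`, which is `F` itself, and `i[F_{μν},
  -- F_{μν}] = 0` for each fixed pair of indices.
  have h2 : ∑ μ, ∑ ν, br C.f (Φ.FUp S μ ν x) (pdV μ (B ν) x) = 0 := by
    refine sum_sum_eq_zero_of_antisymm fun μ ν => ?_
    have h3 : pdV ν (B μ) x = pdV μ (B ν) x - Φ.FV S μ ν x := by rw [← hB μ ν x]; abel
    have h4 : br C.f (Φ.FV S μ ν x) (Φ.FV S μ ν x) = 0 := self_eq_neg.1 (br_antisymm hf _ _)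
    simp only [← brHom_apply] at h4 ⊢
    rw [h3, FUp_eq, FUp_eq, FV_antisymm _ _ μ ν, map_sub]
    simp only [map_smul, map_neg, LinearMap.smul_apply, LinearMap.neg_apply, h4, smul_neg]
    rw [mul_comm (g ν : ℂ), smul_zero]
    abel
  rw [h1, h2]
  simp

theorem div_JcUp (hf : ∀ a b c, C.f a b c = -C.f b a c) (a : Fin N) (x : Mink) :
    ∑ μ, pd μ (fun y => Φ.JcUp C S μ y a) x = 0 :=
  hΦ.div_current hf hΦ.smoothV_AcV (fun μ ν x => funext fun a => hΦ.curl_Ac a μ ν x) a x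

theorem div_JUp (hf : ∀ a b c, C.f a b c = -C.f b a c) (a : Fin N) (x : Mink) :
    ∑ μ, pd μ (fun y => Φ.JUp C S μ y a) x = 0 :=
  hΦ.div_current hf hΦ.smoothV_AV (fun _ _ _ => rfl) a x

end OnShell

end Config

/-! ### The remaining terms as a divergence -/

section Algebra

variable {N : ℕ} {f : Fin N → Fin N → Fin N → ℝ}

/-- Invariance of `⟨·|·⟩` and the Jacobi identity, for the field strength `F` in the plane of the
potentials `b, c` and the gradients `d, e`. -/
theorem remaining_pair_identity (hf : ∀ a b c, f a b c = -f b a c ∧ f a b c = -f a c b)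
    (hJ : ∀ X Y Z : Fin N → ℂ, br f X (br f Y Z) + br f Y (br f Z X) + br f Z (br f X Y) = 0)
    (p F b c d e : Fin N → ℂ) :
    -(1 / 2 : ℂ) * ip (br f p F) (br f b c + br f d e) +
      (1 / 2) * (ip (br f p b) (br f F c) - ip (br f p c) (br f F b)) -
      (1 / 6) * (ip F (br f d (br f p e)) - ip F (br f e (br f p d))) -
      (1 / 3) * ip F (br f p (br f d e)) = 0 := by
  have anti : ∀ X Y : Fin N → ℂ, br f Y X = -br f X Y := br_antisymm fun a b c => (hf a b c).1
  -- Every term will be rewritten as the pairing of `F` with a double bracket, so the Jacobi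
  -- identity is needed only in this paired form.
  have hJ' : ∀ X Y Z W : Fin N → ℂ, ip W (br f X (br f Y Z)) + ip W (br f Y (br f Z X)) +
      ip W (br f Z (br f X Y)) = 0 := fun X Y Z W => by
    have := congrArg (ipHom W) (hJ X Y Z)
    simpa only [map_add, map_zero, ipHom_apply] using this
  have neg_r : ∀ W X Y Z : Fin N → ℂ, ip W (br f X (br f Y Z)) = -ip W (br f X (br f Z Y)) := by
    intro W X Y Z
    rw [anti Z Y]
    simp only [← ipHom_apply, ← brHom_apply, map_neg]
  have move : ∀ X Y Z W : Fin N → ℂ, ip (br f X Y) (br f Z W) = -ip Y (br f X (br f Z W)) := by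
    intro X Y Z W
    rw [ip_br hf Y X, anti X Y, ← ipHom_apply, ← ipHom_apply, map_neg, LinearMap.neg_apply,
      neg_neg]
  have h1 := hJ' p d e F
  have h2 : ip (br f p b) (br f F c) = ip F (br f c (br f p b)) := by
    rw [ip_comm, anti c F, ← ipHom_apply, map_neg, LinearMap.neg_apply, ipHom_apply, move, neg_neg]
  have h3 : ip (br f p c) (br f F b) = ip F (br f b (br f p c)) := by
    rw [ip_comm, anti b F, ← ipHom_apply, map_neg, LinearMap.neg_apply, ipHom_apply, move, neg_neg]
  have h4 := hJ' p b c F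
  have h5 : ip (br f p F) (br f b c + br f d e) =
      -ip F (br f p (br f b c)) - ip F (br f p (br f d e)) := by
    rw [← ipHom_apply, map_add, ipHom_apply, ipHom_apply, move, move]
    ring
  rw [h5, h2, h3]
  rw [neg_r F d e p] at h1
  rw [neg_r F b c p] at h4
  -- The Jacobi identity for `p, b, c` removes the potentials. For `p, d, e` the coefficient of the
  -- bracket with `p` outermost is `1/2 - 1/3 = 1/6`, equal to that of the other two terms.
  linear_combination (1 / 2 : ℂ) * h4 + (1 / 6 : ℂ) * h1

end Algebra

namespace Config

variable {N n : ℕ} {C : Consts N n} {S : Strings} {Φ : Config N n}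

/-- `A_{μν}(c) + A_{μν} = (1/2) (i[B_μ, B_ν] + i[∂_μ φ, ∂_ν φ])` with `B = A(c) + A`. -/
theorem OnShell.AAc_add_AA (hΦ : Φ.OnShell C S) (μ ν : Fin 4) (x : Mink) :
    Φ.AAc C S μ ν x + Φ.AA C S μ ν x = (1 / 2 : ℂ) •
      (br C.f (Φ.sumA S μ x) (Φ.sumA S ν x) +
        br C.f (pdV μ (Φ.phiV S) x) (pdV ν (Φ.phiV S) x)) := by
  have h1 : Φ.AAc C S μ ν x = brHom C.f (Φ.AcV S μ x) (Φ.AcV S ν x) := rfl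
  have h2 : Φ.AA C S μ ν x = brHom C.f (Φ.AV S μ x) (Φ.AV S ν x) := rfl
  -- Polarization: `B` is the sum and `∂φ` the difference of `A(c)` and `A`, so the mixed brackets
  -- cancel.
  rw [h1, h2, hΦ.pdV_phiV, hΦ.pdV_phiV, sumA_eq, sumA_eq, ← brHom_apply, ← brHom_apply]
  simp only [map_add, map_sub, LinearMap.add_apply, LinearMap.sub_apply]
  module

theorem AAc_antisymm (hf : ∀ a b c, C.f a b c = -C.f b a c) (μ ν : Fin 4) (x : Mink) :
    Φ.AAc C S ν μ x + Φ.AA C S ν μ x = -(Φ.AAc C S μ ν x + Φ.AA C S μ ν x) := by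
  rw [neg_add]
  congr 1 <;> exact br_antisymm hf _ _

theorem OnShell.pd_cubicPhi (hΦ : Φ.OnShell C S) (μ : Fin 4) (x : Mink) :
    pd μ (Φ.cubicPhi C S μ) x = ∑ ν,
      (ip (pdV μ (Φ.FUp S μ ν) x)
          (br C.f (Φ.phiV S x) (br C.f (Φ.phiV S x) (pdV ν (Φ.phiV S) x))) +
        ip (Φ.FUp S μ ν x)
          (br C.f (pdV μ (Φ.phiV S) x) (br C.f (Φ.phiV S x) (pdV ν (Φ.phiV S) x)) +
            br C.f (Φ.phiV S x) (br C.f (pdV μ (Φ.phiV S) x) (pdV ν (Φ.phiV S) x) +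
              br C.f (Φ.phiV S x) (pdV μ (pdV ν (Φ.phiV S)) x)))) := by
  have c0 := hΦ.smoothV_phiV
  have e : Φ.cubicPhi C S μ = fun y => ∑ ν, ip (Φ.FUp S μ ν y)
      (br C.f (Φ.phiV S y) (br C.f (Φ.phiV S y) (pdV ν (Φ.phiV S) y))) := rfl
  rw [e, pd_sum _ fun ν => (hΦ.smoothV_FUp μ ν).ip (c0.br (c0.br (c0.pdV ν)))]
  refine Finset.sum_congr rfl fun ν _ => ?_
  rw [pd_ip (hΦ.smoothV_FUp μ ν) (c0.br (c0.br (c0.pdV ν))), pdV_br c0 (c0.br (c0.pdV ν)),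
    pdV_br c0 (c0.pdV ν)]

/-- The remaining terms are a total derivative. -/
theorem OnShell.remaining_eq (hΦ : Φ.OnShell C S)
    (hf : ∀ a b c, C.f a b c = -C.f b a c ∧ C.f a b c = -C.f a c b)
    (hJ : ∀ X Y Z : Fin N → ℂ,
      br C.f X (br C.f Y Z) + br C.f Y (br C.f Z X) + br C.f Z (br C.f X Y) = 0) (x : Mink) :
    Φ.remaining C S x = ∑ μ, pd μ (fun y => (1 / 6) * Φ.cubicPhi C S μ y) x := by
  -- By the Maxwell equation the divergence does not act on `F`.
  have h0 : ∑ μ, ∑ ν, ip (pdV μ (Φ.FUp S μ ν) x)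
      (br C.f (Φ.phiV S x) (br C.f (Φ.phiV S x) (pdV ν (Φ.phiV S) x))) = 0 := by
    rw [Finset.sum_comm]
    refine Finset.sum_eq_zero fun ν _ => ?_
    have := LinearMap.congr_fun (map_sum ipHom (fun μ => pdV μ (Φ.FUp S μ ν) x) Finset.univ)
      (br C.f (Φ.phiV S x) (br C.f (Φ.phiV S x) (pdV ν (Φ.phiV S) x)))
    rw [hΦ.maxwellUp, map_zero, LinearMap.sum_apply] at this
    exact this.symm
  have h1 : ∀ μ, pd μ (fun y => (1 / 6) * Φ.cubicPhi C S μ y) x =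
      (1 / 6) * pd μ (Φ.cubicPhi C S μ) x := fun μ => pd_const_mul (hΦ.contDiff_cubicPhi μ) _ μ x
  simp only [h1, hΦ.pd_cubicPhi, Finset.sum_add_distrib, mul_add, ← Finset.mul_sum, h0, mul_zero,
    zero_add, remaining, ← hΦ.pdV_sumA]
  rw [← sub_eq_zero]
  simp only [Finset.mul_sum, ← Finset.sum_add_distrib, ← Finset.sum_sub_distrib]
  refine sum_sum_eq_zero_of_antisymm fun κ l => ?_
  -- Second derivatives of `φ` are symmetric and cancel against the antisymmetric `F^{κl}`.
  have hd : pdV l (pdV κ (Φ.phiV S)) x = pdV κ (pdV l (Φ.phiV S)) x :=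
    funext fun a => pd_comm (hΦ.smoothV_phiV a) l κ x
  have anti := br_antisymm (R := ℂ) fun a b c => (hf a b c).1
  have key := remaining_pair_identity hf hJ (Φ.phiV S x) (Φ.FV S κ l x) (Φ.sumA S κ x)
    (Φ.sumA S l x) (pdV κ (Φ.phiV S) x) (pdV l (Φ.phiV S) x)
  rw [AAc_antisymm (fun a b c => (hf a b c).1) κ l, hΦ.AAc_add_AA κ l, hΦ.pdV_sumA_swap κ l, hd,
    FUp_eq, FUp_eq, FV_antisymm _ _ κ l,
    anti (pdV κ (Φ.phiV S) x) (pdV l (Φ.phiV S) x)]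
  simp only [← brHom_apply, ← ipHom_apply] at key ⊢
  simp only [map_add, map_sub, map_neg, map_smul, LinearMap.sub_apply,
    LinearMap.neg_apply, LinearMap.smul_apply, smul_eq_mul, Complex.ofReal_mul] at key ⊢
  linear_combination ((g κ : ℂ) * (g l : ℂ)) * key

end Config

/-- The linear free fields, sorted by type. -/
def fldEquiv (N n : ℕ) : Fld N n ≃ (Fin N × Fin 4 × Fin 4) ⊕ (Fin N × Fin 4) ⊕ (Fin N × Fin 4) ⊕
    Fin N ⊕ (Fin n × Fin 4) ⊕ (Fin n × Fin 4) where
  toFun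
    | .F a μ ν => .inl (a, μ, ν)
    | .Ac a μ => .inr (.inl (a, μ))
    | .A a μ => .inr (.inr (.inl (a, μ)))
    | .phi a => .inr (.inr (.inr (.inl a)))
    | .psi m α => .inr (.inr (.inr (.inr (.inl (m, α)))))
    | .psib m α => .inr (.inr (.inr (.inr (.inr (m, α)))))
  invFun
    | .inl (a, μ, ν) => .F a μ ν
    | .inr (.inl (a, μ)) => .Ac a μ
    | .inr (.inr (.inl (a, μ))) => .A a μ
    | .inr (.inr (.inr (.inl a))) => .phi a
    | .inr (.inr (.inr (.inr (.inl (m, α))))) => .psi m α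
    | .inr (.inr (.inr (.inr (.inr (m, α))))) => .psib m α
  left_inv i := by cases i <;> rfl
  right_inv i := by rcases i with _ | _ | _ | _ | _ | _ <;> rfl

theorem sum_fld {N n : ℕ} {M : Type*} [AddCommMonoid M] (h : Fld N n → M) :
    ∑ i, h i = ∑ a, ∑ μ, ∑ ν, h (.F a μ ν) + (∑ a, ∑ μ, h (.Ac a μ) + (∑ a, ∑ μ, h (.A a μ) +
      (∑ a, h (.phi a) + (∑ m, ∑ α, h (.psi m α) + ∑ m, ∑ α, h (.psib m α))))) := by
  rw [← (fldEquiv N n).symm.sum_comp]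
  simp only [Fintype.sum_sum_type, Fintype.sum_prod_type]
  rfl

/-! ### Evaluating derivatives of Wick polynomials -/

section Algebra

variable {N : ℕ}

theorem ip_single_left (a : Fin N) (Y : Fin N → ℂ) : ip (Pi.single a 1) Y = Y a := by
  simp [ip, Pi.single_apply]

theorem ip_single_right (a : Fin N) (Y : Fin N → ℂ) : ip Y (Pi.single a 1) = Y a := by
  simp [ip, Pi.single_apply]

variable (f : Fin N → Fin N → Fin N → ℝ) {R : Type*} [CommRing R] [Algebra ℂ R]

/-- One Leibniz formula for an arbitrary derivation, specialized later to the derivative with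
respect to each type of field. -/
theorem map_derivation_cubic (E : R →ₐ[ℂ] ℂ) (D : Derivation ℂ R R)
    (F : Fin 4 → Fin 4 → Fin N → R) (B j : Fin 4 → Fin N → R) :
    E (D (cubic f F B j)) =
      (1 / 2 : ℂ) * (∑ μ, ∑ ν, ((g μ * g ν : ℝ) : ℂ) *
        (ip (fun a => E (D (F μ ν a))) (br f (fun a => E (B μ a)) (fun a => E (B ν a))) +
          ip (fun a => E (F μ ν a)) (br f (fun a => E (D (B μ a))) (fun a => E (B ν a)) +
            br f (fun a => E (B μ a)) (fun a => E (D (B ν a)))))) +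
      ∑ μ, (g μ : ℂ) * (ip (fun a => E (D (B μ a))) (fun a => E (j μ a)) +
        ip (fun a => E (B μ a)) (fun a => E (D (j μ a)))) := by
  simp only [cubic, map_add, map_sum, Derivation.map_smul, map_smul, derivation_ip, map_ip,
    derivation_br, map_br, smul_eq_mul]
  rfl

end Algebra

namespace Config

variable {N n : ℕ} {C : Consts N n} {S : Strings} {Φ : Config N n}

/-- Evaluation of Wick polynomials as an algebra homomorphism. -/
noncomputable def evalHom (S : Strings) (Φ : Config N n) (x : Mink) : Wick N n →ₐ[ℂ] ℂ :=
  MvPolynomial.aeval (Φ.val S x)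

theorem eval_eq (W : Wick N n) (x : Mink) : Φ.eval S W x = Φ.evalHom S x W := rfl

theorem evalHom_X (i : Fld N n) (x : Mink) : Φ.evalHom S x (MvPolynomial.X i) = Φ.val S x i :=
  MvPolynomial.aeval_X _ _

theorem evalHom_F (μ ν : Fin 4) (x : Mink) :
    (fun a => Φ.evalHom S x (MvPolynomial.X (.F a μ ν))) = Φ.FUp S μ ν x := by
  simp only [evalHom_X]; rfl

theorem evalHom_Ac (μ : Fin 4) (x : Mink) :
    (fun a => Φ.evalHom S x (MvPolynomial.X (.Ac a μ))) = (g μ : ℂ) • Φ.AcV S μ x := by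
  simp only [evalHom_X]; rfl

theorem evalHom_A (μ : Fin 4) (x : Mink) :
    (fun a => Φ.evalHom S x (MvPolynomial.X (.A a μ))) = (g μ : ℂ) • Φ.AV S μ x := by
  simp only [evalHom_X]; rfl

theorem evalHom_phi (x : Mink) :
    (fun a => Φ.evalHom S x (MvPolynomial.X (.phi a))) = Φ.phiV S x := by
  simp only [evalHom_X]; rfl

theorem evalHom_j (μ : Fin 4) (x : Mink) :
    (fun a => Φ.evalHom S x (jWick C μ a)) = Φ.jUp C S μ x := rfl

theorem evalHom_pderiv_X (i j : Fld N n) (x : Mink) :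
    Φ.evalHom S x (MvPolynomial.pderiv i (MvPolynomial.X j)) = if j = i then 1 else 0 := by
  rw [MvPolynomial.pderiv_X, Pi.single_apply]
  split_ifs <;> simp

/-- `∂j^μ_a / ∂ψ`. -/
theorem evalHom_pderiv_psi_j (k : Fin n) (δ μ : Fin 4) (a : Fin N) (x : Mink) :
    Φ.evalHom S x (MvPolynomial.pderiv (.psi k δ) (jWick C μ a)) =
      ∑ α, C.γ μ α δ * ∑ m, C.τ a m k * Φ.psib m α x := by
  simp only [jWick, map_sum, Derivation.map_smul, Derivation.leibniz, map_smul, map_add, smul_eq_mul,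
    map_mul, evalHom_pderiv_X, evalHom_X, reduceCtorEq, if_false, mul_zero, add_zero,
    Fld.psi.injEq, mul_ite, mul_one, ite_and, Finset.sum_ite_eq', Finset.sum_ite_irrel,
    Finset.sum_const_zero, Finset.mem_univ, if_true, val]
  rw [Finset.sum_comm]
  simp only [Finset.mul_sum, mul_assoc]

/-- `∂j^μ_a / ∂ψ̄`. -/
theorem evalHom_pderiv_psib_j (k : Fin n) (δ μ : Fin 4) (a : Fin N) (x : Mink) :
    Φ.evalHom S x (MvPolynomial.pderiv (.psib k δ) (jWick C μ a)) =
      ∑ β, C.γ μ δ β * ∑ m, C.τ a k m * Φ.psi m β x := by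
  simp only [jWick, map_sum, Derivation.map_smul, Derivation.leibniz, map_smul, map_add, smul_eq_mul,
    map_mul, evalHom_pderiv_X, evalHom_X, reduceCtorEq, if_false, mul_zero, zero_add,
    Fld.psib.injEq, mul_ite, mul_one, ite_and, Finset.sum_ite_eq', Finset.sum_ite_irrel,
    Finset.sum_const_zero, Finset.mem_univ, if_true, val]
  rw [Finset.sum_comm]
  simp only [Finset.mul_sum, mul_assoc]

theorem evalHom_pderiv_j_eq_zero {i : Fld N n} (h1 : ∀ m α, i ≠ .psi m α)
    (h2 : ∀ m α, i ≠ .psib m α) (μ : Fin 4) (a : Fin N) (x : Mink) :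
    Φ.evalHom S x (MvPolynomial.pderiv i (jWick C μ a)) = 0 := by
  simp only [jWick, map_sum, Derivation.map_smul, Derivation.leibniz, map_smul, map_add, smul_eq_mul,
    map_mul, evalHom_pderiv_X, (h1 _ _).symm, (h2 _ _).symm, if_false, mul_zero, add_zero,
    Finset.sum_const_zero]

end Config

/-! ### Partial derivatives of the interactions `L1 + K1` and `U1` -/

namespace Config

variable {N n : ℕ} {C : Consts N n} {S : Strings} {Φ : Config N n}

theorem ite_fld_F (a : Fin N) (κ l μ ν : Fin 4) :
    (fun b => if (Fld.F b μ ν : Fld N n) = .F a κ l then (1 : ℂ) else 0) =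
      (if μ = κ then if ν = l then 1 else 0 else 0 : ℂ) • Pi.single a 1 := by
  funext b
  by_cases h1 : b = a <;> by_cases h2 : μ = κ <;> by_cases h3 : ν = l <;>
    simp [h1, h2, h3]

theorem ite_fld_Ac (a : Fin N) (κ μ : Fin 4) :
    (fun b => if (Fld.Ac b μ : Fld N n) = .Ac a κ then (1 : ℂ) else 0) =
      (if μ = κ then 1 else 0 : ℂ) • Pi.single a 1 := by
  funext b
  by_cases h1 : b = a <;> by_cases h2 : μ = κ <;> simp [h1, h2]

theorem ite_fld_A (a : Fin N) (κ μ : Fin 4) :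
    (fun b => if (Fld.A b μ : Fld N n) = .A a κ then (1 : ℂ) else 0) =
      (if μ = κ then 1 else 0 : ℂ) • Pi.single a 1 := by
  funext b
  by_cases h1 : b = a <;> by_cases h2 : μ = κ <;> simp [h1, h2]

theorem fun_zero_eq : (fun _ : Fin N => (0 : ℂ)) = 0 := rfl

/-- Derivative of the cubic expression with respect to the potential. -/
theorem cubic_deriv_potential (hf : ∀ a b c, C.f a b c = -C.f b a c ∧ C.f a b c = -C.f a c b)
    (B : Fin 4 → Fin N → ℂ) (j : Fin 4 → Fin N → ℂ) (κ : Fin 4) (a : Fin N) (x : Mink) :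
    (1 / 2 : ℂ) * (∑ μ, ∑ ν, ((g μ * g ν : ℝ) : ℂ) *
        (ip (Φ.FUp S μ ν x)
          (br C.f ((if μ = κ then 1 else 0 : ℂ) • Pi.single a 1) ((g ν : ℂ) • B ν) +
            br C.f ((g μ : ℂ) • B μ) ((if ν = κ then 1 else 0 : ℂ) • Pi.single a 1)))) +
      ∑ μ, (g μ : ℂ) * ip ((if μ = κ then 1 else 0 : ℂ) • Pi.single a 1) (j μ) =
    (g κ : ℂ) * (j κ - ∑ ν, br C.f (Φ.FUp S κ ν x) (B ν)) a := by
  have h1 : ∀ ν, ip (Φ.FUp S κ ν x) (br C.f (Pi.single a 1) (B ν)) =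
      -(br C.f (Φ.FUp S κ ν x) (B ν)) a := by
    intro ν
    rw [br_antisymm (fun a b c => (hf a b c).1) (B ν), ← ipHom_apply, map_neg, ipHom_apply,
      ip_br hf, ip_single_right]
  -- Both slots of the bracket give the same contribution, by antisymmetry of the evaluated `F`;
  -- this cancels the prefactor `1/2`.
  have h2 : ∀ ν, ip (Φ.FUp S ν κ x) (br C.f (B ν) (Pi.single a 1)) =
      -(br C.f (Φ.FUp S κ ν x) (B ν)) a := by
    intro ν
    rw [ip_br hf, ip_single_right, FUp_eq, FUp_eq, FV_antisymm _ _ κ ν, ← brHom_apply,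
      ← brHom_apply]
    simp only [map_smul, map_neg, LinearMap.smul_apply, LinearMap.neg_apply, Pi.smul_apply,
      Pi.neg_apply, smul_eq_mul]
    ring
  have e1 : ∀ μ ν, ((g μ * g ν : ℝ) : ℂ) *
        (ip (Φ.FUp S μ ν x)
          (br C.f ((if μ = κ then 1 else 0 : ℂ) • Pi.single a 1) ((g ν : ℂ) • B ν) +
            br C.f ((g μ : ℂ) • B μ) ((if ν = κ then 1 else 0 : ℂ) • Pi.single a 1))) =
      (if μ = κ then (g κ : ℂ) * ip (Φ.FUp S κ ν x) (br C.f (Pi.single a 1) (B ν)) else 0) +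
      (if ν = κ then (g κ : ℂ) * ip (Φ.FUp S μ κ x) (br C.f (B μ) (Pi.single a 1)) else 0) := by
    intro μ ν
    simp only [← brHom_apply, ← ipHom_apply, map_smul, LinearMap.smul_apply, map_add,
      smul_eq_mul]
    push_cast
    have hμ := g_mul_self μ
    have hν := g_mul_self ν
    by_cases hm : μ = κ <;> by_cases hn : ν = κ <;> simp only [hm, hn, if_true, if_false] at hμ hν ⊢
    · linear_combination ((g κ : ℂ) * ipHom (Φ.FUp S κ κ x) (brHom C.f (Pi.single a 1) (B κ)) +
        (g κ : ℂ) * ipHom (Φ.FUp S κ κ x) (brHom C.f (B κ) (Pi.single a 1))) * hμ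
    · linear_combination (g κ : ℂ) * ipHom (Φ.FUp S κ ν x) (brHom C.f (Pi.single a 1) (B ν)) * hν
    · linear_combination (g κ : ℂ) * ipHom (Φ.FUp S μ κ x) (brHom C.f (B μ) (Pi.single a 1)) * hμ
    · ring
  simp only [e1, Finset.sum_add_distrib, Finset.sum_ite_eq', Finset.mem_univ, if_true,
    Finset.sum_ite_irrel, Finset.sum_const_zero, h1, h2]
  simp only [Finset.sum_ite_eq', Finset.mem_univ, if_true, ← ipHom_apply, map_smul,
    LinearMap.smul_apply, smul_eq_mul, ite_mul, one_mul, zero_mul, mul_ite, mul_zero]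
  simp only [ipHom_apply, ip_single_left, Pi.sub_apply, Finset.sum_apply, mul_neg,
    Finset.sum_neg_distrib, ← Finset.mul_sum]
  ring

/-- As polynomial variables `F a κ l` and `F a l κ` are independent, so the prefactor `1/2`
survives. -/
theorem eval_pderiv_F_L1_K1 (κ l : Fin 4) (a : Fin N) (x : Mink) :
    Φ.eval S (MvPolynomial.pderiv (.F a κ l) (L1 C + K1 C)) x =
      (1 / 2) * (Φ.AAc C S κ l x + Φ.AA C S κ l x) a := by
  have hj := evalHom_pderiv_j_eq_zero (C := C) (Φ := Φ) (S := S) (i := .F a κ l) (by simp) (by simp)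
  simp only [eval_eq, L1, K1, map_add, map_derivation_cubic, evalHom_pderiv_X, reduceCtorEq,
    if_false, hj, ite_fld_F, evalHom_Ac, evalHom_A, evalHom_j, evalHom_F, fun_zero_eq]
  simp only [← ipHom_apply, ← brHom_apply, map_zero, LinearMap.zero_apply, map_smul, add_zero,
    mul_zero, Finset.sum_const_zero, LinearMap.smul_apply, smul_eq_mul, ite_mul, one_mul, zero_mul,
    mul_ite, Finset.sum_ite_irrel, Finset.sum_ite_eq', Finset.mem_univ, if_true]
  simp only [ipHom_apply, ip_single_left, Pi.add_apply]
  change _ = 1 / 2 * (brHom C.f (Φ.AcV S κ x) (Φ.AcV S l x) a +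
    brHom C.f (Φ.AV S κ x) (Φ.AV S l x) a)
  push_cast
  linear_combination (1 / 2 * (brHom C.f (Φ.AcV S κ x) (Φ.AcV S l x) a +
    brHom C.f (Φ.AV S κ x) (Φ.AV S l x) a)) * (g κ * g κ * g_mul_self l + g_mul_self κ)

/-- The currents of the second order arise here. The variables are contravariant components, so the
derivative has a lower index, which accounts for the factor `g κ`. -/
theorem eval_pderiv_Ac_L1_K1 (hf : ∀ a b c, C.f a b c = -C.f b a c ∧ C.f a b c = -C.f a c b)
    (κ : Fin 4) (a : Fin N) (x : Mink) :
    Φ.eval S (MvPolynomial.pderiv (.Ac a κ) (L1 C + K1 C)) x = (g κ : ℂ) * Φ.JcUp C S κ x a := by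
  have hj := evalHom_pderiv_j_eq_zero (C := C) (Φ := Φ) (S := S) (i := .Ac a κ) (by simp) (by simp)
  have key := cubic_deriv_potential (S := S) (Φ := Φ) hf (fun ν => Φ.AcV S ν x)
    (fun ν => Φ.jUp C S ν x) κ a x
  refine Eq.trans ?_ key
  simp only [eval_eq, L1, K1, map_add, map_derivation_cubic, evalHom_pderiv_X, reduceCtorEq,
    if_false, hj, ite_fld_Ac, evalHom_Ac, evalHom_A, evalHom_j, evalHom_F, fun_zero_eq]
  simp only [← ipHom_apply, ← brHom_apply, map_zero, LinearMap.zero_apply, add_zero, zero_add,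
    mul_zero, Finset.sum_const_zero]

theorem eval_pderiv_A_L1_K1 (hf : ∀ a b c, C.f a b c = -C.f b a c ∧ C.f a b c = -C.f a c b)
    (κ : Fin 4) (a : Fin N) (x : Mink) :
    Φ.eval S (MvPolynomial.pderiv (.A a κ) (L1 C + K1 C)) x = (g κ : ℂ) * Φ.JUp C S κ x a := by
  have hj := evalHom_pderiv_j_eq_zero (C := C) (Φ := Φ) (S := S) (i := .A a κ) (by simp) (by simp)
  have key := cubic_deriv_potential (S := S) (Φ := Φ) hf (fun ν => Φ.AV S ν x)
    (fun ν => Φ.jUp C S ν x) κ a x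
  refine Eq.trans ?_ key
  simp only [eval_eq, L1, K1, map_add, map_derivation_cubic, evalHom_pderiv_X, reduceCtorEq,
    if_false, hj, ite_fld_A, evalHom_Ac, evalHom_A, evalHom_j, evalHom_F, fun_zero_eq]
  simp only [← ipHom_apply, ← brHom_apply, map_zero, LinearMap.zero_apply, add_zero, zero_add,
    mul_zero, Finset.sum_const_zero]

theorem eval_pderiv_phi_L1_K1 (a : Fin N) (x : Mink) :
    Φ.eval S (MvPolynomial.pderiv (.phi a) (L1 C + K1 C)) x = 0 := by
  have hj := evalHom_pderiv_j_eq_zero (C := C) (Φ := Φ) (S := S) (i := .phi a) (by simp) (by simp)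
  simp only [eval_eq, L1, K1, map_add, map_derivation_cubic, evalHom_pderiv_X, reduceCtorEq,
    if_false, hj, fun_zero_eq]
  simp only [← ipHom_apply, ← brHom_apply, map_zero, LinearMap.zero_apply, add_zero,
    mul_zero, Finset.sum_const_zero]

theorem eval_pderiv_quark_L1_K1 {i : Fld N n} (h1 : ∀ a μ ν, i ≠ .F a μ ν) (h2 : ∀ a μ, i ≠ .Ac a μ)
    (h3 : ∀ a μ, i ≠ .A a μ) (x : Mink) :
    Φ.eval S (MvPolynomial.pderiv i (L1 C + K1 C)) x =
      ∑ μ, ip (Φ.sumA S μ x)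
        (fun a => Φ.evalHom S x (MvPolynomial.pderiv i (jWick C μ a))) := by
  simp only [eval_eq, L1, K1, map_add, map_derivation_cubic, evalHom_pderiv_X, (h1 _ _ _).symm,
    (h2 _ _).symm, (h3 _ _).symm, if_false, fun_zero_eq, evalHom_Ac, evalHom_A]
  simp only [← ipHom_apply, ← brHom_apply, map_zero, LinearMap.zero_apply, add_zero, zero_add,
    mul_zero, Finset.sum_const_zero, map_smul, LinearMap.smul_apply, smul_eq_mul, ← mul_assoc,
    g_mul_self, one_mul, ← Finset.sum_add_distrib, sumA_eq, map_add, LinearMap.add_apply]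

theorem map_derivation_U1 (D : Derivation ℂ (Wick N n) (Wick N n)) (μ : Fin 4) (x : Mink) :
    Φ.evalHom S x (D (U1 C μ)) =
      (1 / 2 : ℂ) * (∑ ν, (g ν : ℂ) *
        (ip (fun a => Φ.evalHom S x (D (MvPolynomial.X (.F a μ ν))))
            (br C.f (Φ.phiV S x) ((g ν : ℂ) • Φ.sumA S ν x)) +
          ip (Φ.FUp S μ ν x)
            (br C.f (fun a => Φ.evalHom S x (D (MvPolynomial.X (.phi a))))
                ((g ν : ℂ) • Φ.sumA S ν x) +
              br C.f (Φ.phiV S x) ((fun a => Φ.evalHom S x (D (MvPolynomial.X (.Ac a ν)))) +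
                fun a => Φ.evalHom S x (D (MvPolynomial.X (.A a ν))))))) +
      (ip (fun a => Φ.evalHom S x (D (MvPolynomial.X (.phi a)))) (Φ.jUp C S μ x) +
        ip (Φ.phiV S x) (fun a => Φ.evalHom S x (D (jWick C μ a)))) := by
  simp only [U1, map_add, map_sum, Derivation.map_smul, map_smul, derivation_ip, map_ip,
    derivation_br, map_br, smul_eq_mul, evalHom_phi, evalHom_F, evalHom_j]
  have e : ∀ ν, (fun a => Φ.evalHom S x (MvPolynomial.X (.Ac a ν)) +
      Φ.evalHom S x (MvPolynomial.X (.A a ν))) = (g ν : ℂ) • Φ.sumA S ν x := by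
    intro ν
    rw [sumA_eq, smul_add, ← evalHom_Ac, ← evalHom_A]
    rfl
  simp only [e]
  rfl

theorem eval_pderiv_F_U1 (μ κ ν : Fin 4) (a : Fin N) (x : Mink) :
    Φ.eval S (MvPolynomial.pderiv (.F a κ ν) (U1 C μ)) x =
      if μ = κ then (1 / 2) * Φ.sig C S ν x a else 0 := by
  have hj := evalHom_pderiv_j_eq_zero (C := C) (Φ := Φ) (S := S) (i := .F a κ ν) (by simp) (by simp)
  simp only [eval_eq, map_derivation_U1, evalHom_pderiv_X, reduceCtorEq, if_false, hj, ite_fld_F,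
    fun_zero_eq]
  simp only [← ipHom_apply, ← brHom_apply, map_zero, LinearMap.zero_apply, map_smul, add_zero,
    LinearMap.smul_apply, smul_eq_mul, ite_mul, one_mul, zero_mul,
    mul_ite, mul_zero, Finset.sum_ite_irrel, Finset.sum_ite_eq', Finset.mem_univ, if_true,
    Finset.sum_const_zero, ← mul_assoc, g_mul_self]
  simp only [ipHom_apply, ip_single_left]
  rfl

/-- Up to the lowering factor `g ν`, the coefficient is antisymmetric in `μν`, as `sum_curl_eq_zero`
requires. -/
theorem eval_pderiv_Ac_U1 (hf : ∀ a b c, C.f a b c = -C.f b a c ∧ C.f a b c = -C.f a c b)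
    (μ ν : Fin 4) (a : Fin N) (x : Mink) :
    Φ.eval S (MvPolynomial.pderiv (.Ac a ν) (U1 C μ)) x =
      (1 / 2) * (g ν : ℂ) * br C.f (Φ.FUp S μ ν x) (Φ.phiV S x) a := by
  have hj := evalHom_pderiv_j_eq_zero (C := C) (Φ := Φ) (S := S) (i := .Ac a ν) (by simp) (by simp)
  simp only [eval_eq, map_derivation_U1, evalHom_pderiv_X, reduceCtorEq, if_false, hj, ite_fld_Ac,
    fun_zero_eq]
  simp only [← ipHom_apply, ← brHom_apply, map_zero, LinearMap.zero_apply, map_smul, add_zero,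
    zero_add, smul_zero, smul_eq_mul, ite_mul, one_mul, zero_mul,
    mul_ite, mul_zero, Finset.sum_ite_eq', Finset.mem_univ, if_true]
  simp only [ipHom_apply, brHom_apply, ip_br hf, ip_single_right]
  ring

theorem eval_pderiv_A_U1 (hf : ∀ a b c, C.f a b c = -C.f b a c ∧ C.f a b c = -C.f a c b)
    (μ ν : Fin 4) (a : Fin N) (x : Mink) :
    Φ.eval S (MvPolynomial.pderiv (.A a ν) (U1 C μ)) x =
      (1 / 2) * (g ν : ℂ) * br C.f (Φ.FUp S μ ν x) (Φ.phiV S x) a := by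
  have hj := evalHom_pderiv_j_eq_zero (C := C) (Φ := Φ) (S := S) (i := .A a ν) (by simp) (by simp)
  simp only [eval_eq, map_derivation_U1, evalHom_pderiv_X, reduceCtorEq, if_false, hj, ite_fld_A,
    fun_zero_eq]
  simp only [← ipHom_apply, ← brHom_apply, map_zero, LinearMap.zero_apply, map_smul, add_zero,
    zero_add, smul_zero, smul_eq_mul, ite_mul, one_mul, zero_mul,
    mul_ite, mul_zero, Finset.sum_ite_eq', Finset.mem_univ, if_true]
  simp only [ipHom_apply, brHom_apply, ip_br hf, ip_single_right]
  ring

theorem eval_pderiv_quark_U1 {i : Fld N n} (h1 : ∀ a μ ν, i ≠ .F a μ ν) (h2 : ∀ a μ, i ≠ .Ac a μ)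
    (h3 : ∀ a μ, i ≠ .A a μ) (h4 : ∀ a, i ≠ .phi a) (μ : Fin 4) (x : Mink) :
    Φ.eval S (MvPolynomial.pderiv i (U1 C μ)) x =
      ip (Φ.phiV S x) (fun a => Φ.evalHom S x (MvPolynomial.pderiv i (jWick C μ a))) := by
  simp only [eval_eq, map_derivation_U1, evalHom_pderiv_X, (h1 _ _ _).symm,
    (h2 _ _).symm, (h3 _ _).symm, (h4 _).symm, if_false, fun_zero_eq]
  simp only [← ipHom_apply, ← brHom_apply, map_zero, LinearMap.zero_apply, add_zero, zero_add,
    mul_zero, Finset.sum_const_zero]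

end Config

namespace Bilocal

theorem IsLinear.dx {D : Bilocal} (hD : D.IsLinear) (κ : Fin 4) : (D.dx κ).IsLinear := by
  intro f f' hf hf' z
  have e : ∀ p, fderiv ℝ (fun p => f p + z * f' p) p (Pi.single κ 1, 0) =
      fderiv ℝ f p (Pi.single κ 1, 0) + z * fderiv ℝ f' p (Pi.single κ 1, 0) := by
    intro p
    rw [fderiv_fun_add (hf.differentiableAt p) ((hf'.const_mul z).differentiableAt p),
      fderiv_const_mul (hf'.differentiableAt p)]
    rfl
  simp only [Bilocal.dx, e]
  rw [hD _ _ (hf.fderiv_apply _) (hf'.fderiv_apply _) z]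
  ring

end Bilocal

open Bilocal

/-! ### Contraction with the two-point obstructions -/

namespace Config

variable {N n : ℕ} {C : Consts N n} {S : Strings} {Φ : Config N n}

/-- `ψ̄ π(φ)`. -/
noncomputable def phiPsib (C : Consts N n) (S : Strings) (Φ : Config N n) (m : Fin n) (β : Fin 4)
    (x : Mink) : ℂ :=
  ∑ a, Φ.phi S a x * ∑ k, C.τ a k m * Φ.psib k β x

/-- `π(φ) ψ`. -/
noncomputable def phiPsi (C : Consts N n) (S : Strings) (Φ : Config N n) (m : Fin n) (β : Fin 4)
    (x : Mink) : ℂ :=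
  ∑ a, Φ.phi S a x * ∑ k, C.τ a m k * Φ.psi k β x

theorem OnShell.contDiff_phiPsib (hΦ : Φ.OnShell C S) (m : Fin n) (β : Fin 4) :
    ContDiff ℝ ∞ (phiPsib C S Φ m β) :=
  ContDiff.sum fun a _ => (hΦ.contDiff_phi a).mul
    (ContDiff.sum fun k _ => contDiff_const.mul (hΦ.smooth_psib k β))

theorem OnShell.contDiff_phiPsi (hΦ : Φ.OnShell C S) (m : Fin n) (β : Fin 4) :
    ContDiff ℝ ∞ (phiPsi C S Φ m β) :=
  ContDiff.sum fun a _ => (hΦ.contDiff_phi a).mul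
    (ContDiff.sum fun k _ => contDiff_const.mul (hΦ.smooth_psi k β))

theorem eval_pderiv_psi_U1 (μ : Fin 4) (k : Fin n) (δ : Fin 4) (x : Mink) :
    Φ.eval S (MvPolynomial.pderiv (.psi k δ) (U1 C μ)) x =
      ∑ α, C.γ μ α δ * phiPsib C S Φ k α x := by
  rw [eval_pderiv_quark_U1 (by simp) (by simp) (by simp) (by simp)]
  simp only [evalHom_pderiv_psi_j, ip, phiPsib, phiV, Finset.mul_sum]
  rw [Finset.sum_comm]
  refine Finset.sum_congr rfl fun α _ => Finset.sum_congr rfl fun a _ =>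
    Finset.sum_congr rfl fun m _ => ?_
  ring

theorem eval_pderiv_psib_U1 (μ : Fin 4) (k : Fin n) (δ : Fin 4) (x : Mink) :
    Φ.eval S (MvPolynomial.pderiv (.psib k δ) (U1 C μ)) x =
      ∑ β, C.γ μ δ β * phiPsi C S Φ k β x := by
  rw [eval_pderiv_quark_U1 (by simp) (by simp) (by simp) (by simp)]
  simp only [evalHom_pderiv_psib_j, ip, phiPsi, phiV, Finset.mul_sum]
  rw [Finset.sum_comm]
  refine Finset.sum_congr rfl fun α _ => Finset.sum_congr rfl fun a _ =>
    Finset.sum_congr rfl fun m _ => ?_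
  ring

variable {O : Fin 4 → Fld N n → Fld N n → Bilocal}

/-- Contributions of a field `B^ν` with `O_μ(B_ν) = O_ν(B_μ)`, multiplied by an antisymmetric
coefficient. -/
theorem sum_curl_eq_zero {D : Fin 4 → Fin 4 → Bilocal} (hD : ∀ μ ν, (D μ ν).IsLinear)
    (curl : ∀ μ ν, ((g ν : ℂ) • D μ ν - (g μ : ℂ) • D ν μ).Eqv 0)
    {h : Fin 4 → Fin 4 → Mink → ℂ} (ch : ∀ μ ν, ContDiff ℝ ∞ (h μ ν))
    (ha : ∀ μ ν x, h ν μ x = -h μ ν x) {k : Mink × Mink → ℂ} (hk : IsTest k) :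
    ∑ μ, ∑ ν, D μ ν (fun p => (1 / 2) * (g ν : ℂ) * h μ ν p.1 * k p) = 0 := by
  have ht : ∀ μ ν, IsTest fun p => h μ ν p.1 * k p := fun μ ν => hk.fst_mul (ch μ ν)
  refine sum_sum_eq_zero_of_antisymm fun μ ν => ?_
  have e1 : D μ ν (fun p => (1 / 2) * (g ν : ℂ) * h μ ν p.1 * k p) =
      (1 / 2) * (g ν : ℂ) * D μ ν (fun p => h μ ν p.1 * k p) := by
    rw [← (hD μ ν).map_const_mul (ht μ ν)]
    simp only [mul_assoc]
  have e2 : D ν μ (fun p => (1 / 2) * (g μ : ℂ) * h ν μ p.1 * k p) =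
      -((1 / 2) * (g μ : ℂ)) * D ν μ (fun p => h μ ν p.1 * k p) := by
    rw [← (hD ν μ).map_const_mul (ht μ ν)]
    congr 1
    funext p
    rw [ha μ ν]
    ring
  have := curl μ ν _ (ht μ ν)
  simp only [Pi.sub_apply, Pi.smul_apply, smul_eq_mul, Pi.zero_apply] at this
  rw [e1, e2]
  linear_combination (1 / 2 : ℂ) * this

/-- The contraction of `∂U_1^μ/∂φ` with the two-point obstructions. -/
theorem OnShell.sum_obstr_U1 (hΦ : Φ.OnShell C S) (hO : IsTwoPointObstruction C S O)
    (hf : ∀ a b c, C.f a b c = -C.f b a c ∧ C.f a b c = -C.f a c b) (χ : Fld N n)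
    {k : Mink × Mink → ℂ} (hk : IsTest k) :
    ∑ μ, ∑ φ, O μ φ χ (fun p => Φ.eval S (MvPolynomial.pderiv φ (U1 C μ)) p.1 * k p) =
      ∑ a, ∑ ν, rowF S a ν χ (fun p => (1 / 2) * Φ.sig C S ν p.1 a * k p) +
      (∑ m, ∑ β, rowPsi m β χ (fun p => phiPsib C S Φ m β p.1 * k p) +
      ∑ m, ∑ β, rowPsib m β χ (fun p => phiPsi C S Φ m β p.1 * k p)) := by
  have lin := hO.linear
  have hs : ∀ ν a, IsTest fun p => (1 / 2) * Φ.sig C S ν p.1 a * k p := fun ν a => by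
    simpa only [mul_assoc] using (hk.fst_mul (hΦ.smoothV_sig ν a)).const_mul (1 / 2)
  simp only [sum_fld, Finset.sum_add_distrib, eval_pderiv_F_U1, eval_pderiv_Ac_U1 hf,
    eval_pderiv_A_U1 hf, eval_pderiv_psi_U1, eval_pderiv_psib_U1]
  -- The Kronecker delta ties the index of `O_μ` to the first index of `F`, leaving the prescribed
  -- sum over `μ`.
  have hF : ∑ μ, ∑ a, ∑ κ, ∑ ν, O μ (.F a κ ν) χ (fun p =>
      (if μ = κ then (1 / 2) * Φ.sig C S ν p.1 a else 0) * k p) =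
      ∑ a, ∑ ν, rowF S a ν χ (fun p => (1 / 2) * Φ.sig C S ν p.1 a * k p) := by
    rw [Finset.sum_comm]
    refine Finset.sum_congr rfl fun a _ => ?_
    have e : ∀ μ, ∑ κ, ∑ ν, O μ (.F a κ ν) χ (fun p =>
        (if μ = κ then (1 / 2) * Φ.sig C S ν p.1 a else 0) * k p) =
        ∑ ν, O μ (.F a μ ν) χ (fun p => (1 / 2) * Φ.sig C S ν p.1 a * k p) := by
      intro μ
      rw [Finset.sum_eq_single μ]
      · simp only [if_true]
      · intro κ _ hκ
        simp only [if_neg hκ.symm, zero_mul, (lin _ _ _).map_zero, Finset.sum_const_zero]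
      · simp
    simp only [e]
    rw [Finset.sum_comm]
    refine Finset.sum_congr rfl fun ν _ => ?_
    rw [← hO.F a ν χ _ (hs ν a), Finset.sum_apply]
  have cFφ : ∀ a μ ν, ContDiff ℝ ∞ fun x => br C.f (Φ.FUp S μ ν x) (Φ.phiV S x) a := fun a μ ν =>
    (hΦ.smoothV_FUp μ ν).br hΦ.smoothV_phiV a
  have aFφ : ∀ a μ ν x, br C.f (Φ.FUp S ν μ x) (Φ.phiV S x) a =
      -br C.f (Φ.FUp S μ ν x) (Φ.phiV S x) a := by
    intro a μ ν x
    rw [FUp_eq, FUp_eq, FV_antisymm _ _ μ ν, mul_comm (g ν : ℂ), smul_neg, ← brHom_apply,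
      map_neg]
    rfl
  have hAc : ∑ μ, ∑ a, ∑ ν, O μ (.Ac a ν) χ (fun p =>
      (1 / 2) * (g ν : ℂ) * br C.f (Φ.FUp S μ ν p.1) (Φ.phiV S p.1) a * k p) = 0 := by
    rw [Finset.sum_comm]
    exact Finset.sum_eq_zero fun a _ => sum_curl_eq_zero (fun μ ν => lin μ (.Ac a ν) χ)
      (fun μ ν => hO.curl_Ac a μ ν χ) (cFφ a) (aFφ a) hk
  have hA : ∑ μ, ∑ a, ∑ ν, O μ (.A a ν) χ (fun p =>
      (1 / 2) * (g ν : ℂ) * br C.f (Φ.FUp S μ ν p.1) (Φ.phiV S p.1) a * k p) = 0 := by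
    rw [Finset.sum_comm]
    exact Finset.sum_eq_zero fun a _ => sum_curl_eq_zero (fun μ ν => lin μ (.A a ν) χ)
      (fun μ ν => hO.curl_A a μ ν χ) (cFφ a) (aFφ a) hk
  have hphi : ∑ μ, ∑ a, O μ (.phi a) χ (fun p =>
      Φ.eval S (MvPolynomial.pderiv (.phi a) (U1 C μ)) p.1 * k p) = 0 :=
    Finset.sum_eq_zero fun μ _ => Finset.sum_eq_zero fun a _ =>
      hO.phi μ a χ _ (hk.fst_mul (hΦ.contDiff_eval _))
  -- The matrix `γ^μ` of the current combines with `O_μ(ψ, ·)` to the row given by the Dirac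
  -- equation.
  have hpsi : ∑ μ, ∑ m, ∑ δ, O μ (.psi m δ) χ (fun p =>
      (∑ α, C.γ μ α δ * phiPsib C S Φ m α p.1) * k p) =
      ∑ m, ∑ β, rowPsi m β χ (fun p => phiPsib C S Φ m β p.1 * k p) := by
    rw [Finset.sum_comm]
    refine Finset.sum_congr rfl fun m _ => ?_
    have ht : ∀ α, IsTest fun p => phiPsib C S Φ m α p.1 * k p := fun α =>
      hk.fst_mul (hΦ.contDiff_phiPsib m α)
    have e : ∀ μ δ, O μ (.psi m δ) χ (fun p =>
        (∑ α, C.γ μ α δ * phiPsib C S Φ m α p.1) * k p) =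
        ∑ α, C.γ μ α δ * O μ (.psi m δ) χ (fun p => phiPsib C S Φ m α p.1 * k p) := by
      intro μ δ
      simp only [Finset.sum_mul, mul_assoc]
      rw [(lin μ (.psi m δ) χ).map_sum _ fun α => (ht α).const_mul _]
      exact Finset.sum_congr rfl fun α _ => (lin μ (.psi m δ) χ).map_const_mul (ht α) _
    simp only [e]
    calc _ = ∑ μ, ∑ α, ∑ δ, C.γ μ α δ * O μ (.psi m δ) χ (fun p => phiPsib C S Φ m α p.1 * k p) :=
          Finset.sum_congr rfl fun μ _ => Finset.sum_comm
      _ = ∑ α, ∑ μ, ∑ δ, C.γ μ α δ * O μ (.psi m δ) χ (fun p => phiPsib C S Φ m α p.1 * k p) :=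
          Finset.sum_comm
      _ = _ := by
        refine Finset.sum_congr rfl fun α _ => ?_
        rw [← hO.psi m α χ _ (ht α)]
        simp only [Finset.sum_apply, Pi.smul_apply, smul_eq_mul]
  have hpsib : ∑ μ, ∑ m, ∑ δ, O μ (.psib m δ) χ (fun p =>
      (∑ β, C.γ μ δ β * phiPsi C S Φ m β p.1) * k p) =
      ∑ m, ∑ β, rowPsib m β χ (fun p => phiPsi C S Φ m β p.1 * k p) := by
    rw [Finset.sum_comm]
    refine Finset.sum_congr rfl fun m _ => ?_
    have ht : ∀ α, IsTest fun p => phiPsi C S Φ m α p.1 * k p := fun α =>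
      hk.fst_mul (hΦ.contDiff_phiPsi m α)
    have e : ∀ μ δ, O μ (.psib m δ) χ (fun p =>
        (∑ β, C.γ μ δ β * phiPsi C S Φ m β p.1) * k p) =
        ∑ β, C.γ μ δ β * O μ (.psib m δ) χ (fun p => phiPsi C S Φ m β p.1 * k p) := by
      intro μ δ
      simp only [Finset.sum_mul, mul_assoc]
      rw [(lin μ (.psib m δ) χ).map_sum _ fun α => (ht α).const_mul _]
      exact Finset.sum_congr rfl fun α _ => (lin μ (.psib m δ) χ).map_const_mul (ht α) _
    simp only [e]
    calc _ = ∑ μ, ∑ β, ∑ δ, C.γ μ δ β * O μ (.psib m δ) χ (fun p => phiPsi C S Φ m β p.1 * k p) :=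
          Finset.sum_congr rfl fun μ _ => Finset.sum_comm
      _ = ∑ β, ∑ μ, ∑ δ, C.γ μ δ β * O μ (.psib m δ) χ (fun p => phiPsi C S Φ m β p.1 * k p) :=
          Finset.sum_comm
      _ = _ := by
        refine Finset.sum_congr rfl fun β _ => ?_
        rw [← hO.psib m β χ _ (ht β)]
        simp only [Finset.sum_apply, Pi.smul_apply, smul_eq_mul]
  rw [hF, hAc, hA, hphi, hpsi, hpsib]
  ring

/-- The contraction of `O_μ(F^{μν}, ·)` with `∂(L_1 + K_1)/∂χ`. -/
theorem OnShell.sum_rowF (hΦ : Φ.OnShell C S)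
    (hf : ∀ a b c, C.f a b c = -C.f b a c ∧ C.f a b c = -C.f a c b) (a : Fin N) (ν : Fin 4)
    {s : Mink → ℂ} (cs : ContDiff ℝ ∞ s) {f : Mink × Mink → ℂ} (hft : IsTest f) :
    ∑ χ, rowF S a ν χ (fun p => (1 / 2) * s p.1 *
        (Φ.eval S (MvPolynomial.pderiv χ (L1 C + K1 C)) p.2 * f p)) =
      -(1 / 2) * ∑ l, ((g ν : ℂ) * (g l : ℂ)) * dx l iDelta (fun p => s p.1 *
          ((Φ.AAc C S ν l p.2 + Φ.AA C S ν l p.2) a * f p)) -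
      (1 / 2) * iDelta (fun p => s p.1 * (Φ.JcUp C S ν p.2 a * f p)) -
      (1 / 2) * iDelta (fun p => s p.1 * (Φ.JUp C S ν p.2 a * f p)) +
      (1 / 2) * ∑ κ, dx κ (Complex.I • IcDelta' S ν)
        (fun p => s p.1 * (Φ.JcUp C S κ p.2 a * f p)) -
      (1 / 2) * ∑ κ, dx κ (Complex.I • IuDelta S ν)
        (fun p => s p.1 * (Φ.JUp C S κ p.2 a * f p)) := by
  have lc : (Complex.I • IcDelta' S ν).IsLinear := (isLinear_IcDelta S ν).swap.smul _
  have lu : (Complex.I • IuDelta S ν).IsLinear := (isLinear_IuDelta S ν).smul _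
  have ld := isLinear_iDelta
  have tQ : ∀ κ l, IsTest fun p => s p.1 *
      ((Φ.AAc C S κ l p.2 + Φ.AA C S κ l p.2) a * f p) := fun κ l =>
    (hft.snd_mul (((hΦ.smoothV_AAc κ l).add (hΦ.smoothV_AA κ l)) a)).fst_mul cs
  have tJc : ∀ κ, IsTest fun p => s p.1 * (Φ.JcUp C S κ p.2 a * f p) := fun κ =>
    (hft.snd_mul (hΦ.smoothV_JcUp κ a)).fst_mul cs
  have tJ : ∀ κ, IsTest fun p => s p.1 * (Φ.JUp C S κ p.2 a * f p) := fun κ =>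
    (hft.snd_mul (hΦ.smoothV_JUp κ a)).fst_mul cs
  -- The factor `1/4` collects one `1/2` from `U1` and one from `L1 + K1`.
  have eQ : ∀ b κ l, (fun p : Mink × Mink => (1 / 2 : ℂ) * s p.1 *
      ((1 / 2) * (Φ.AAc C S κ l p.2 + Φ.AA C S κ l p.2) b * f p)) =
      fun p => (1 / 4 : ℂ) * (s p.1 * ((Φ.AAc C S κ l p.2 + Φ.AA C S κ l p.2) b * f p)) :=
    fun b κ l => by funext p; ring
  have eJc : ∀ b κ, (fun p : Mink × Mink => (1 / 2 : ℂ) * s p.1 *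
      ((g κ : ℂ) * Φ.JcUp C S κ p.2 b * f p)) =
      fun p => ((1 / 2 : ℂ) * g κ) * (s p.1 * (Φ.JcUp C S κ p.2 b * f p)) :=
    fun b κ => by funext p; ring
  have eJ : ∀ b κ, (fun p : Mink × Mink => (1 / 2 : ℂ) * s p.1 *
      ((g κ : ℂ) * Φ.JUp C S κ p.2 b * f p)) =
      fun p => ((1 / 2 : ℂ) * g κ) * (s p.1 * (Φ.JUp C S κ p.2 b * f p)) :=
    fun b κ => by funext p; ring
  -- Antisymmetry makes the two terms of `η^{ν[κ}∂^{λ]}` contribute equally, which raises `1/4` to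
  -- `1/2`.
  have swapQ : ∀ κ, dx κ iDelta (fun p => s p.1 *
      ((Φ.AAc C S κ ν p.2 + Φ.AA C S κ ν p.2) a * f p)) =
      -dx κ iDelta (fun p => s p.1 * ((Φ.AAc C S ν κ p.2 + Φ.AA C S ν κ p.2) a * f p)) := by
    intro κ
    rw [neg_eq_neg_one_mul, ← (ld.dx κ).map_const_mul (tQ ν κ)]
    congr 1
    funext p
    rw [AAc_antisymm (fun a b c => (hf a b c).1) ν κ]
    simp only [Pi.neg_apply]
    ring
  have z1 : IcDelta' S ν (fun _ => 0) = 0 := (isLinear_IcDelta S ν).swap.map_zero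
  have z2 : IuDelta S ν (fun _ => 0) = 0 := (isLinear_IuDelta S ν).map_zero
  simp only [sum_fld, rowF, eval_pderiv_F_L1_K1, eval_pderiv_Ac_L1_K1 hf, eval_pderiv_A_L1_K1 hf,
    eval_pderiv_phi_L1_K1, eQ, eJc, eJ]
  have hF : ∑ b, ∑ κ, ∑ l, (if a = b then
      -(eta ν κ • dxUp l iDelta - eta ν l • dxUp κ iDelta) else 0 : Bilocal)
      (fun p => (1 / 4 : ℂ) * (s p.1 * ((Φ.AAc C S κ l p.2 + Φ.AA C S κ l p.2) b * f p))) =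
      -(1 / 2) * ∑ l, ((g ν : ℂ) * (g l : ℂ)) * dx l iDelta (fun p => s p.1 *
          ((Φ.AAc C S ν l p.2 + Φ.AA C S ν l p.2) a * f p)) := by
    rw [Finset.sum_eq_single a (fun b _ hb => by simp [if_neg hb.symm]) (by simp)]
    simp only [if_true]
    have e : ∀ κ l, (-(eta ν κ • dxUp l iDelta - eta ν l • dxUp κ iDelta))
                (fun p => (1 / 4 : ℂ) * (s p.1 * ((Φ.AAc C S κ l p.2 + Φ.AA C S κ l p.2) a * f p))) =
        (if ν = κ then -(1 / 4) * (((g ν : ℂ) * (g l : ℂ)) * dx l iDelta (fun p => s p.1 *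
          ((Φ.AAc C S ν l p.2 + Φ.AA C S ν l p.2) a * f p))) else 0) +
        (if ν = l then -(1 / 4) * (((g ν : ℂ) * (g κ : ℂ)) * dx κ iDelta (fun p => s p.1 *
          ((Φ.AAc C S ν κ p.2 + Φ.AA C S ν κ p.2) a * f p))) else 0) := by
      intro κ l
      simp only [eta, Pi.neg_apply, Pi.sub_apply, Pi.smul_apply, smul_eq_mul, dxUp,
        (ld.dx _).map_const_mul (tQ κ l)]
      by_cases h1 : ν = κ <;> by_cases h2 : ν = l
      · subst h1; subst h2
        simp only [if_true]
        linear_combination (1 / 4 : ℂ) * (g ν : ℂ) * (g ν : ℂ) * swapQ ν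
      · subst h1
        simp only [if_true, if_neg h2]
        ring
      · subst h2
        simp only [if_true, if_neg h1]
        linear_combination (1 / 4 : ℂ) * (g ν : ℂ) * (g κ : ℂ) * swapQ κ
      · simp only [if_neg h1, if_neg h2]
        ring
    simp only [e, Finset.sum_add_distrib, Finset.sum_ite_eq, Finset.mem_univ, if_true,
      Finset.sum_ite_irrel, Finset.sum_const_zero, ← Finset.mul_sum]
    ring
  have hAc : ∑ b, ∑ κ, (if a = b then
      -(eta ν κ • iDelta - dxUp κ (Complex.I • IcDelta' S ν)) else 0 : Bilocal)
      (fun p => ((1 / 2 : ℂ) * g κ) * (s p.1 * (Φ.JcUp C S κ p.2 b * f p))) =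
      -((1 / 2) * iDelta (fun p => s p.1 * (Φ.JcUp C S ν p.2 a * f p))) +
      (1 / 2) * ∑ κ, dx κ (Complex.I • IcDelta' S ν)
        (fun p => s p.1 * (Φ.JcUp C S κ p.2 a * f p)) := by
    rw [Finset.sum_eq_single a (fun b _ hb => by simp [if_neg hb.symm]) (by simp)]
    simp only [if_true]
    have e : ∀ κ, (-(eta ν κ • iDelta - dxUp κ (Complex.I • IcDelta' S ν)))
                (fun p => ((1 / 2 : ℂ) * g κ) * (s p.1 * (Φ.JcUp C S κ p.2 a * f p))) =
        (if ν = κ then -((1 / 2) * iDelta (fun p => s p.1 * (Φ.JcUp C S ν p.2 a * f p))) else 0) +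
        (1 / 2) * dx κ (Complex.I • IcDelta' S ν)
          (fun p => s p.1 * (Φ.JcUp C S κ p.2 a * f p)) := by
      intro κ
      simp only [eta, Pi.neg_apply, Pi.sub_apply, Pi.smul_apply, smul_eq_mul, dxUp,
        (lc.dx _).map_const_mul (tJc κ), ld.map_const_mul (tJc κ)]
      have hg := g_mul_self κ
      by_cases h1 : ν = κ
      · subst h1
        simp only [if_true]
        linear_combination (-(1 / 2) * iDelta (fun p => s p.1 * (Φ.JcUp C S ν p.2 a * f p)) +
          (1 / 2) * dx ν (Complex.I • IcDelta' S ν)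
            (fun p => s p.1 * (Φ.JcUp C S ν p.2 a * f p))) * hg
      · simp only [if_neg h1]
        linear_combination ((1 / 2) * dx κ (Complex.I • IcDelta' S ν)
            (fun p => s p.1 * (Φ.JcUp C S κ p.2 a * f p))) * hg
    simp only [e, Finset.sum_add_distrib, Finset.sum_ite_eq, Finset.mem_univ, if_true,
      ← Finset.mul_sum]
  have hA : ∑ b, ∑ κ, (if a = b then
      -(eta ν κ • iDelta + dxUp κ (Complex.I • IuDelta S ν)) else 0 : Bilocal)
      (fun p => ((1 / 2 : ℂ) * g κ) * (s p.1 * (Φ.JUp C S κ p.2 b * f p))) =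
      -((1 / 2) * iDelta (fun p => s p.1 * (Φ.JUp C S ν p.2 a * f p))) +
      -(1 / 2) * ∑ κ, dx κ (Complex.I • IuDelta S ν)
        (fun p => s p.1 * (Φ.JUp C S κ p.2 a * f p)) := by
    rw [Finset.sum_eq_single a (fun b _ hb => by simp [if_neg hb.symm]) (by simp)]
    simp only [if_true]
    have e : ∀ κ, (-(eta ν κ • iDelta + dxUp κ (Complex.I • IuDelta S ν)))
                (fun p => ((1 / 2 : ℂ) * g κ) * (s p.1 * (Φ.JUp C S κ p.2 a * f p))) =
        (if ν = κ then -((1 / 2) * iDelta (fun p => s p.1 * (Φ.JUp C S ν p.2 a * f p))) else 0) +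
        -(1 / 2) * dx κ (Complex.I • IuDelta S ν)
          (fun p => s p.1 * (Φ.JUp C S κ p.2 a * f p)) := by
      intro κ
      simp only [eta, Pi.neg_apply, Pi.add_apply, Pi.smul_apply, smul_eq_mul, dxUp,
        (lu.dx _).map_const_mul (tJ κ), ld.map_const_mul (tJ κ)]
      have hg := g_mul_self κ
      by_cases h1 : ν = κ
      · subst h1
        simp only [if_true]
        linear_combination (-(1 / 2) * iDelta (fun p => s p.1 * (Φ.JUp C S ν p.2 a * f p)) -
          (1 / 2) * dx ν (Complex.I • IuDelta S ν)
            (fun p => s p.1 * (Φ.JUp C S ν p.2 a * f p))) * hg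
      · simp only [if_neg h1]
        linear_combination (-(1 / 2) * dx κ (Complex.I • IuDelta S ν)
            (fun p => s p.1 * (Φ.JUp C S κ p.2 a * f p))) * hg
    simp only [e, Finset.sum_add_distrib, Finset.sum_ite_eq, Finset.mem_univ, if_true,
      ← Finset.mul_sum]
  -- Neither `L1` nor `K1` contains `φ`, so its obstruction with `F` does not enter.
  have hphi : ∑ b, (if a = b then -(Complex.I • (IcDelta' S ν + IuDelta S ν)) else 0 : Bilocal)
      (fun p => (1 / 2 : ℂ) * s p.1 * (0 * f p)) = 0 := by
    refine Finset.sum_eq_zero fun b _ => ?_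
    simp only [zero_mul, mul_zero]
    split_ifs
    · simp [z1, z2]
    · rfl
  rw [hF, hAc, hA, hphi]
  simp only [Pi.zero_apply, Finset.sum_const_zero]
  ring

/-- The contraction of the quark obstructions with `∂(L_1 + K_1)/∂χ`. -/
theorem sum_rowPsi (m : Fin n) (β : Fin 4) (G : Fld N n → Mink × Mink → ℂ) :
    ∑ χ, rowPsi m β χ (G χ) = -delta (G (.psib m β)) := by
  rw [Finset.sum_eq_single (.psib m β)]
  · simp [rowPsi]
  · intro χ _ hχ
    cases χ with
    | psib k δ =>
      have : ¬(m = k ∧ β = δ) := fun h => hχ (by rw [h.1, h.2])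
      simp [rowPsi, if_neg this]
    | _ => rfl
  · simp

theorem sum_rowPsib (m : Fin n) (β : Fin 4) (G : Fld N n → Mink × Mink → ℂ) :
    ∑ χ, rowPsib m β χ (G χ) = delta (G (.psi m β)) := by
  rw [Finset.sum_eq_single (.psi m β)]
  · simp [rowPsib]
  · intro χ _ hχ
    cases χ with
    | psi k δ =>
      have : ¬(m = k ∧ β = δ) := fun h => hχ (by rw [h.1, h.2])
      simp [rowPsib, if_neg this]
    | _ => rfl
  · simp

end Config

namespace Config

variable {N n : ℕ} {C : Consts N n} {S : Strings} {Φ : Config N n}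

/-! ### The quark terms -/

/-- `X_a τ_a`. -/
noncomputable def colourMatrix (C : Consts N n) (X : Fin N → ℂ) : Matrix (Fin n) (Fin n) ℂ :=
  ∑ a, X a • C.τ a

/-- `ψ̄ γ^μ M ψ`. -/
noncomputable def quarkForm (C : Consts N n) (Φ : Config N n) (μ : Fin 4) (x : Mink)
    (M : Matrix (Fin n) (Fin n) ℂ) : ℂ :=
  ∑ α, ∑ β, C.γ μ α β * ∑ k, ∑ l, Φ.psib k α x * (M k l * Φ.psi l β x)

theorem quarkForm_sub (μ : Fin 4) (x : Mink) (M M' : Matrix (Fin n) (Fin n) ℂ) :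
    quarkForm C Φ μ x (M - M') = quarkForm C Φ μ x M - quarkForm C Φ μ x M' := by
  simp only [quarkForm, Matrix.sub_apply, sub_mul, mul_sub, Finset.sum_sub_distrib]

theorem quarkForm_smul (μ : Fin 4) (x : Mink) (z : ℂ) (M : Matrix (Fin n) (Fin n) ℂ) :
    quarkForm C Φ μ x (z • M) = z * quarkForm C Φ μ x M := by
  simp only [quarkForm, Matrix.smul_apply, smul_eq_mul, Finset.mul_sum]
  refine Finset.sum_congr rfl fun _ _ => Finset.sum_congr rfl fun _ _ => Finset.sum_congr rfl
    fun _ _ => Finset.sum_congr rfl fun _ _ => ?_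
  ring

/-- Linearity of `quarkForm` in the colour matrix turns a contraction with the current into a single
matrix in colour space. -/
theorem ip_jUp (μ : Fin 4) (x : Mink) (X : Fin N → ℂ) :
    ip X (Φ.jUp C S μ x) = quarkForm C Φ μ x (colourMatrix C X) := by
  have e : ∀ a, Φ.jUp C S μ x a = quarkForm C Φ μ x (C.τ a) := by
    intro a
    simp only [jUp, Config.eval, jWick, map_sum, map_smul, map_mul, MvPolynomial.aeval_X, val,
      quarkForm, smul_eq_mul, Finset.mul_sum]
    calc _ = ∑ k, ∑ α, ∑ l, ∑ β, C.γ μ α β * C.τ a k l * (Φ.psib k α x * Φ.psi l β x) :=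
          Finset.sum_congr rfl fun k _ => Finset.sum_comm
      _ = ∑ α, ∑ k, ∑ l, ∑ β, C.γ μ α β * C.τ a k l * (Φ.psib k α x * Φ.psi l β x) :=
          Finset.sum_comm
      _ = ∑ α, ∑ k, ∑ β, ∑ l, C.γ μ α β * C.τ a k l * (Φ.psib k α x * Φ.psi l β x) :=
          Finset.sum_congr rfl fun α _ => Finset.sum_congr rfl fun k _ => Finset.sum_comm
      _ = ∑ α, ∑ β, ∑ k, ∑ l, C.γ μ α β * C.τ a k l * (Φ.psib k α x * Φ.psi l β x) :=
          Finset.sum_congr rfl fun α _ => Finset.sum_comm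
      _ = _ := by
        refine Finset.sum_congr rfl fun _ _ => Finset.sum_congr rfl fun _ _ =>
          Finset.sum_congr rfl fun _ _ => Finset.sum_congr rfl fun _ _ => ?_
        ring
  have h0 : quarkForm C Φ μ x 0 = 0 := by simp [quarkForm]
  have hadd : ∀ M M', quarkForm C Φ μ x (M + M') = quarkForm C Φ μ x M + quarkForm C Φ μ x M' := by
    intro M M'
    simp only [quarkForm, Matrix.add_apply, add_mul, mul_add, Finset.sum_add_distrib]
  have hsum : quarkForm C Φ μ x (colourMatrix C X) = ∑ a, quarkForm C Φ μ x (X a • C.τ a) :=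
    map_sum (AddMonoidHom.mk' (quarkForm C Φ μ x) hadd) _ _
  rw [hsum]
  simp only [ip, e, quarkForm_smul]

/-- The representation property of `π`, expressed in components. -/
theorem colourMatrix_br {𝔤 : Type*} [LieRing 𝔤] [LieAlgebra ℂ 𝔤] (ξ : Module.Basis (Fin N) ℂ 𝔤)
    (π : 𝔤 →ₗ[ℂ] Matrix (Fin n) (Fin n) ℂ) (hπ : ∀ X Y, π ⁅X, Y⁆ = π X * π Y - π Y * π X)
    (hξ : ∀ a b, ⁅ξ a, ξ b⁆ = ∑ c, (Complex.I * (C.f a b c : ℂ)) • ξ c)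
    (hτ : ∀ a, C.τ a = π (ξ a)) (X Y : Fin N → ℂ) :
    colourMatrix C (br C.f X Y) = Complex.I •
      (colourMatrix C X * colourMatrix C Y - colourMatrix C Y * colourMatrix C X) := by
  have e : ∀ X : Fin N → ℂ, colourMatrix C X = π (ξ.equivFun.symm X) := by
    intro X
    simp [colourMatrix, hτ, Module.Basis.equivFun_symm_apply]
  rw [e, e, e, equivFun_symm_br ξ hξ, map_smul, hπ]

theorem phiPsib_eq (m : Fin n) (β : Fin 4) (x : Mink) :
    phiPsib C S Φ m β x = ∑ k, Φ.psib k β x * colourMatrix C (Φ.phiV S x) k m := by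
  simp only [phiPsib, colourMatrix, Matrix.sum_apply, Matrix.smul_apply, smul_eq_mul,
    Finset.mul_sum, phiV]
  rw [Finset.sum_comm]
  exact Finset.sum_congr rfl fun k _ => Finset.sum_congr rfl fun a _ => by ring

theorem phiPsi_eq (m : Fin n) (β : Fin 4) (x : Mink) :
    phiPsi C S Φ m β x = ∑ k, colourMatrix C (Φ.phiV S x) m k * Φ.psi k β x := by
  simp only [phiPsi, colourMatrix, Matrix.sum_apply, Matrix.smul_apply, smul_eq_mul,
    Finset.mul_sum, Finset.sum_mul, phiV]
  rw [Finset.sum_comm]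
  exact Finset.sum_congr rfl fun k _ => Finset.sum_congr rfl fun a _ => by ring

theorem eval_pderiv_psi_L1_K1 (m : Fin n) (β : Fin 4) (x : Mink) :
    Φ.eval S (MvPolynomial.pderiv (.psi m β) (L1 C + K1 C)) x =
      ∑ μ, ∑ α, C.γ μ α β * ∑ k, Φ.psib k α x * colourMatrix C (Φ.sumA S μ x) k m := by
  rw [eval_pderiv_quark_L1_K1 (by simp) (by simp) (by simp)]
  refine Finset.sum_congr rfl fun μ _ => ?_
  simp only [evalHom_pderiv_psi_j, ip, colourMatrix, Matrix.sum_apply, Matrix.smul_apply,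
    smul_eq_mul, Finset.mul_sum]
  rw [Finset.sum_comm]
  refine Finset.sum_congr rfl fun α _ => ?_
  rw [Finset.sum_comm]
  exact Finset.sum_congr rfl fun k _ => Finset.sum_congr rfl fun a _ => by ring

theorem eval_pderiv_psib_L1_K1 (m : Fin n) (β : Fin 4) (x : Mink) :
    Φ.eval S (MvPolynomial.pderiv (.psib m β) (L1 C + K1 C)) x =
      ∑ μ, ∑ δ, C.γ μ β δ * ∑ k, colourMatrix C (Φ.sumA S μ x) m k * Φ.psi k δ x := by
  rw [eval_pderiv_quark_L1_K1 (by simp) (by simp) (by simp)]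
  refine Finset.sum_congr rfl fun μ _ => ?_
  simp only [evalHom_pderiv_psib_j, ip, colourMatrix, Matrix.sum_apply, Matrix.smul_apply,
    smul_eq_mul, Finset.mul_sum, Finset.sum_mul]
  rw [Finset.sum_comm]
  refine Finset.sum_congr rfl fun α _ => ?_
  rw [Finset.sum_comm]
  exact Finset.sum_congr rfl fun k _ => Finset.sum_congr rfl fun a _ => by ring

/-- The quark terms add up to `⟨i[φ, B_μ] | j^μ⟩`. -/
theorem quark_terms {𝔤 : Type*} [LieRing 𝔤] [LieAlgebra ℂ 𝔤] (ξ : Module.Basis (Fin N) ℂ 𝔤)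
    (π : 𝔤 →ₗ[ℂ] Matrix (Fin n) (Fin n) ℂ) (hπ : ∀ X Y, π ⁅X, Y⁆ = π X * π Y - π Y * π X)
    (hξ : ∀ a b, ⁅ξ a, ξ b⁆ = ∑ c, (Complex.I * (C.f a b c : ℂ)) • ξ c)
    (hτ : ∀ a, C.τ a = π (ξ a)) (x : Mink) :
    -∑ m, ∑ β, phiPsib C S Φ m β x *
        Φ.eval S (MvPolynomial.pderiv (.psib m β) (L1 C + K1 C)) x +
      ∑ m, ∑ β, phiPsi C S Φ m β x *
        Φ.eval S (MvPolynomial.pderiv (.psi m β) (L1 C + K1 C)) x =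
    Complex.I * ∑ μ, ip (Φ.sig C S μ x) (Φ.jUp C S μ x) := by
  set T := colourMatrix C (Φ.phiV S x)
  have h1 : ∑ m, ∑ β, phiPsib C S Φ m β x *
      Φ.eval S (MvPolynomial.pderiv (.psib m β) (L1 C + K1 C)) x =
      ∑ μ, quarkForm C Φ μ x (T * colourMatrix C (Φ.sumA S μ x)) := by
    simp only [phiPsib_eq, eval_pderiv_psib_L1_K1, Finset.mul_sum, quarkForm, Matrix.mul_apply,
      Finset.sum_mul]
    calc _ = ∑ m, ∑ μ, ∑ β, ∑ δ, ∑ l, ∑ k, Φ.psib k β x * T k m *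
          (C.γ μ β δ * (colourMatrix C (Φ.sumA S μ x) m l * Φ.psi l δ x)) :=
          Finset.sum_congr rfl fun m _ => Finset.sum_comm
      _ = ∑ μ, ∑ m, ∑ β, ∑ δ, ∑ l, ∑ k, Φ.psib k β x * T k m *
          (C.γ μ β δ * (colourMatrix C (Φ.sumA S μ x) m l * Φ.psi l δ x)) := Finset.sum_comm
      _ = _ := by
        refine Finset.sum_congr rfl fun μ _ => ?_
        rw [Finset.sum_comm]
        refine Finset.sum_congr rfl fun β _ => ?_
        rw [Finset.sum_comm]
        refine Finset.sum_congr rfl fun δ _ => ?_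
        rw [Finset.sum_comm]
        conv_rhs => rw [Finset.sum_comm]
        refine Finset.sum_congr rfl fun l _ => ?_
        rw [Finset.sum_comm]
        exact Finset.sum_congr rfl fun k _ => Finset.sum_congr rfl fun m _ => by ring
  have h2 : ∑ m, ∑ β, phiPsi C S Φ m β x *
      Φ.eval S (MvPolynomial.pderiv (.psi m β) (L1 C + K1 C)) x =
      ∑ μ, quarkForm C Φ μ x (colourMatrix C (Φ.sumA S μ x) * T) := by
    simp only [phiPsi_eq, eval_pderiv_psi_L1_K1, Finset.mul_sum, quarkForm, Matrix.mul_apply,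
      Finset.sum_mul]
    calc _ = ∑ m, ∑ μ, ∑ β, ∑ α, ∑ k, ∑ l, T m l * Φ.psi l β x *
          (C.γ μ α β * (Φ.psib k α x * colourMatrix C (Φ.sumA S μ x) k m)) :=
          Finset.sum_congr rfl fun m _ => Finset.sum_comm
      _ = ∑ μ, ∑ m, ∑ β, ∑ α, ∑ k, ∑ l, T m l * Φ.psi l β x *
          (C.γ μ α β * (Φ.psib k α x * colourMatrix C (Φ.sumA S μ x) k m)) := Finset.sum_comm
      _ = _ := by
        refine Finset.sum_congr rfl fun μ _ => ?_
        rw [Finset.sum_comm]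
        conv_rhs => rw [Finset.sum_comm]
        refine Finset.sum_congr rfl fun β _ => ?_
        rw [Finset.sum_comm]
        refine Finset.sum_congr rfl fun α _ => ?_
        rw [Finset.sum_comm]
        refine Finset.sum_congr rfl fun k _ => ?_
        rw [Finset.sum_comm]
        exact Finset.sum_congr rfl fun l _ => Finset.sum_congr rfl fun m _ => by ring
  rw [h1, h2, ← Finset.sum_neg_distrib, ← Finset.sum_add_distrib, Finset.mul_sum]
  refine Finset.sum_congr rfl fun μ _ => ?_
  rw [ip_jUp, sig, colourMatrix_br ξ π hπ hξ hτ, quarkForm_smul, quarkForm_sub]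
  -- The two quark rows have opposite signs and opposite orders of `π(φ)` and `π(B)`; their sum is
  -- minus the commutator, and `-1 = i · i`.
  linear_combination (-quarkForm C Φ μ x (T * colourMatrix C (Φ.sumA S μ x)) +
    quarkForm C Φ μ x (colourMatrix C (Φ.sumA S μ x) * T)) * Complex.I_mul_I

/-! ### The local terms -/

/-- The local terms of the obstruction add up to `L_2 - K_2` and the remaining terms. -/
theorem OnShell.local_terms (hΦ : Φ.OnShell C S)
    (hf : ∀ a b c, C.f a b c = -C.f b a c ∧ C.f a b c = -C.f a c b) (x : Mink) :
    (1 / 2) * ∑ ν, ∑ l, ((g ν : ℂ) * (g l : ℂ)) *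
        ip (pdV l (Φ.sig C S ν) x) (Φ.AAc C S ν l x + Φ.AA C S ν l x) -
      (1 / 2) * ∑ ν, ip (Φ.sig C S ν x) (Φ.JcUp C S ν x + Φ.JUp C S ν x) +
      ∑ ν, ip (Φ.sig C S ν x) (Φ.jUp C S ν x) =
    Φ.L2 C S x - Φ.K2 C S x + Φ.remaining C S x := by
  -- Half of `J(c) + J` contains `j` once, which the quark terms compensate; only the gluonic parts
  -- remain.
  have hJ : ∀ ν, ip (Φ.sig C S ν x) (Φ.jUp C S ν x) -
      (1 / 2) * ip (Φ.sig C S ν x) (Φ.JcUp C S ν x + Φ.JUp C S ν x) =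
      (1 / 2) * ∑ l, ip (Φ.sig C S ν x) (br C.f (Φ.FUp S ν l x) (Φ.sumA S l x)) := by
    intro ν
    have e1 : Φ.JcUp C S ν x = Φ.jUp C S ν x - ∑ l, brHom C.f (Φ.FUp S ν l x) (Φ.AcV S l x) := rfl
    have e2 : Φ.JUp C S ν x = Φ.jUp C S ν x - ∑ l, brHom C.f (Φ.FUp S ν l x) (Φ.AV S l x) := rfl
    rw [e1, e2]
    simp only [← ipHom_apply, ← brHom_apply, sumA_eq, map_add, map_sub, map_sum,
      Finset.sum_add_distrib]
    ring
  have hJ' := Finset.sum_congr (rfl : (Finset.univ : Finset (Fin 4)) = _) fun ν _ => hJ ν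
  rw [Finset.sum_sub_distrib, ← Finset.mul_sum, ← Finset.mul_sum] at hJ'
  have hrest : (1 / 2) * ∑ ν, ∑ l, ((g ν : ℂ) * (g l : ℂ)) *
        ip (pdV l (Φ.sig C S ν) x) (Φ.AAc C S ν l x + Φ.AA C S ν l x) -
      (Φ.L2 C S x - Φ.K2 C S x) +
      (1 / 2) * (∑ κ, ∑ l, ((g κ * g l : ℝ) : ℂ) *
      ip (br C.f (Φ.phiV S x) (pdV κ (Φ.sumA S l) x))
        (Φ.AAc C S κ l x + Φ.AA C S κ l x)) = 0 := by
    simp only [L2, K2, Finset.mul_sum, ← Finset.sum_sub_distrib, ← Finset.sum_add_distrib]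
    refine sum_sum_eq_zero_of_antisymm fun ν l => ?_
    have hs : ∀ ν l, pdV l (Φ.sig C S ν) x = br C.f (pdV l (Φ.phiV S) x) (Φ.sumA S ν x) +
        br C.f (Φ.phiV S x) (pdV l (Φ.sumA S ν) x) := fun ν l =>
      pdV_br hΦ.smoothV_phiV (hΦ.smoothV_sumA ν) l x
    have anti := br_antisymm (R := ℂ) fun a b c => (hf a b c).1
    -- By `∂φ = A(c) - A` and `B = A(c) + A` the mixed brackets cancel here. Pairing the result with
    -- `A_{νl}(c) + A_{νl}` gives the difference of squares in `L_2 - K_2`.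
    have hd : br C.f (pdV l (Φ.phiV S) x) (Φ.sumA S ν x) -
        br C.f (pdV ν (Φ.phiV S) x) (Φ.sumA S l x) =
        (-2 : ℂ) • Φ.AAc C S ν l x + (2 : ℂ) • Φ.AA C S ν l x := by
      have e1 : Φ.AAc C S ν l x = br C.f (Φ.AcV S ν x) (Φ.AcV S l x) := rfl
      have e2 : Φ.AA C S ν l x = br C.f (Φ.AV S ν x) (Φ.AV S l x) := rfl
      have a1 := anti (Φ.AcV S ν x) (Φ.AcV S l x)
      have a2 := anti (Φ.AV S ν x) (Φ.AV S l x)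
      have a3 := anti (Φ.AcV S ν x) (Φ.AV S l x)
      have a4 := anti (Φ.AV S ν x) (Φ.AcV S l x)
      rw [e1, e2, hΦ.pdV_phiV, hΦ.pdV_phiV, sumA_eq, sumA_eq]
      simp only [← brHom_apply] at a1 a2 a3 a4 ⊢
      simp only [map_add, map_sub, LinearMap.sub_apply, a1, a2, a3, a4]
      module
    have hd' := congrArg (fun X => ip X (Φ.AAc C S ν l x + Φ.AA C S ν l x)) hd
    have q1 : Φ.AAc C S l ν x = -Φ.AAc C S ν l x := anti _ _
    have q2 : Φ.AA C S l ν x = -Φ.AA C S ν l x := anti _ _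
    have c1 : ip (Φ.AA C S ν l x) (Φ.AAc C S ν l x) = ip (Φ.AAc C S ν l x) (Φ.AA C S ν l x) :=
      ip_comm _ _
    rw [hs, hs, q1, q2]
    simp only [← brHom_apply, ← ipHom_apply] at hd' c1 ⊢
    simp only [map_add, map_sub, map_neg, map_smul, LinearMap.add_apply, LinearMap.sub_apply,
      LinearMap.neg_apply, LinearMap.smul_apply, smul_eq_mul, Complex.ofReal_mul] at hd' c1 ⊢
    linear_combination ((g ν : ℂ) * (g l : ℂ)) * ((1 / 2 : ℂ) * hd' + c1)
  have hr : Φ.remaining C S x = -(1 / 2) * (∑ κ, ∑ l, ((g κ * g l : ℝ) : ℂ) *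
      ip (br C.f (Φ.phiV S x) (pdV κ (Φ.sumA S l) x))
        (Φ.AAc C S κ l x + Φ.AA C S κ l x)) +
      (1 / 2) * ∑ ν, ∑ l, ip (Φ.sig C S ν x) (br C.f (Φ.FUp S ν l x) (Φ.sumA S l x)) := by
    simp only [hΦ.pdV_sumA]
    rfl
  rw [hr]
  linear_combination hrest + hJ'

end Config

namespace Bilocal

theorem translationInvariant_delta : delta.TranslationInvariant := by
  intro f hf v
  simpa [delta] using integral_diag_fderiv hf 0 v

/-- The delta distribution depends only on the restriction to the diagonal. -/
theorem iDelta_congr {F G : Mink × Mink → ℂ} (h : ∀ x, F (x, x) = G (x, x)) :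
    iDelta F = iDelta G := by
  simp only [iDelta, Pi.smul_apply, delta, h]

theorem iDelta_apply (F : Mink × Mink → ℂ) : iDelta F = Complex.I * delta F := rfl

/-- This is `(∂h) δ = (∂ + ∂')(h δ)`: simultaneous translations leave `δ` invariant, so their
generator acts on `h` alone. -/
theorem delta_fst_mul_pd {h : Mink → ℂ} (ch : ContDiff ℝ ∞ h) {f : Mink × Mink → ℂ}
    (hf : IsTest f) (μ : Fin 4) :
    delta (fun p => pd μ h p.1 * f p) =
      -delta (fun p => h p.1 * fderiv ℝ f p (Pi.single μ 1, 0)) -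
        delta (fun p => h p.1 * fderiv ℝ f p (0, Pi.single μ 1)) := by
  have := translationInvariant_delta _ (hf.fst_mul ch) (Pi.single μ 1)
  simp only [fderiv_fst_mul hf ch, fderiv_fst_mul_snd_dir hf ch] at this
  rw [isLinear_delta.map_add (hf.fst_mul (contDiff_pd ch μ)) ((hf.fderiv_apply _).fst_mul ch)]
    at this
  linear_combination this

/-- The derivative in `x` does not see `q`, which is at `x'`. Only after it is carried out may `q`
be moved to `x` on the diagonal, so no term with a derivative of `q` arises. -/
theorem dx_iDelta_mul_mul {s q : Mink → ℂ} (cs : ContDiff ℝ ∞ s) (cq : ContDiff ℝ ∞ q)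
    {f : Mink × Mink → ℂ} (hf : IsTest f) (l : Fin 4) :
    dx l iDelta (fun p => s p.1 * (q p.2 * f p)) =
      -iDelta (fun p => (pd l s p.1 * q p.1) * f p) -
        iDelta (fun p => (s p.1 * q p.1) * fderiv ℝ f p (Pi.single l 1, 0)) := by
  have t1 : IsTest fun p => q p.2 * f p := hf.snd_mul cq
  have hf' : IsTest fun p => fderiv ℝ f p (Pi.single l 1, 0) := hf.fderiv_apply _
  rw [dx, ← neg_add', neg_inj,
    iDelta_congr (F := fun p => (pd l s p.1 * q p.1) * f p)
      (G := fun p => pd l s p.1 * (q p.2 * f p)) (fun x => by simp only [mul_assoc]),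
    iDelta_congr (F := fun p => (s p.1 * q p.1) * fderiv ℝ f p (Pi.single l 1, 0))
      (G := fun p => s p.1 * (q p.2 * fderiv ℝ f p (Pi.single l 1, 0)))
      (fun x => by simp only [mul_assoc]),
    ← isLinear_iDelta.map_add (t1.fst_mul (contDiff_pd cs l)) ((hf'.snd_mul cq).fst_mul cs)]
  congr 1
  funext p
  rw [fderiv_fst_mul t1 cs, fderiv_snd_mul_fst_dir hf cq]

end Bilocal

/-! ### Assembling the obstruction -/

namespace Config

variable {N n : ℕ} {C : Consts N n} {S : Strings} {Φ : Config N n}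
  {O : Fin 4 → Fld N n → Fld N n → Bilocal}

/-- For each fixed `χ` the factor at `x'` is absorbed into the test function, so that the sum over
the fields at `x` can be carried out with the prescribed rows before the sum over `χ`. -/
theorem OnShell.obstr_apply (hΦ : Φ.OnShell C S) (hO : IsTwoPointObstruction C S O)
    (hf : ∀ a b c, C.f a b c = -C.f b a c ∧ C.f a b c = -C.f a c b)
    {f : Mink × Mink → ℂ} (hft : IsTest f) :
    Φ.obstr S O (U1 C) (L1 C + K1 C) f =
      ∑ a, ∑ ν, (-(1 / 2) * ∑ l, ((g ν : ℂ) * (g l : ℂ)) * dx l iDelta (fun p =>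
          Φ.sig C S ν p.1 a * ((Φ.AAc C S ν l p.2 + Φ.AA C S ν l p.2) a * f p)) -
        (1 / 2) * iDelta (fun p => Φ.sig C S ν p.1 a * (Φ.JcUp C S ν p.2 a * f p)) -
        (1 / 2) * iDelta (fun p => Φ.sig C S ν p.1 a * (Φ.JUp C S ν p.2 a * f p)) +
        (1 / 2) * ∑ κ, dx κ (Complex.I • IcDelta' S ν)
          (fun p => Φ.sig C S ν p.1 a * (Φ.JcUp C S κ p.2 a * f p)) -
        (1 / 2) * ∑ κ, dx κ (Complex.I • IuDelta S ν)
          (fun p => Φ.sig C S ν p.1 a * (Φ.JUp C S κ p.2 a * f p))) +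
      (∑ m, ∑ β, -delta (fun p => phiPsib C S Φ m β p.1 *
          (Φ.eval S (MvPolynomial.pderiv (.psib m β) (L1 C + K1 C)) p.2 * f p)) +
        ∑ m, ∑ β, delta (fun p => phiPsi C S Φ m β p.1 *
          (Φ.eval S (MvPolynomial.pderiv (.psi m β) (L1 C + K1 C)) p.2 * f p))) := by
  have tv : ∀ χ : Fld N n, IsTest fun p =>
      Φ.eval S (MvPolynomial.pderiv χ (L1 C + K1 C)) p.2 * f p := fun χ =>
    hft.snd_mul (hΦ.contDiff_eval _)
  have e1 : Φ.obstr S O (U1 C) (L1 C + K1 C) f = ∑ χ, ∑ μ, ∑ φ, O μ φ χ (fun p =>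
      Φ.eval S (MvPolynomial.pderiv φ (U1 C μ)) p.1 *
        (Φ.eval S (MvPolynomial.pderiv χ (L1 C + K1 C)) p.2 * f p)) := by
    simp only [obstr, Finset.sum_apply, mul, mul_assoc]
    calc _ = ∑ μ, ∑ χ, ∑ φ, O μ φ χ (fun p => Φ.eval S (MvPolynomial.pderiv φ (U1 C μ)) p.1 *
          (Φ.eval S (MvPolynomial.pderiv χ (L1 C + K1 C)) p.2 * f p)) :=
          Finset.sum_congr rfl fun μ _ => Finset.sum_comm
      _ = _ := Finset.sum_comm
  rw [e1, Finset.sum_congr rfl fun χ _ => hΦ.sum_obstr_U1 hO hf χ (tv χ)]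
  rw [Finset.sum_add_distrib, Finset.sum_add_distrib]
  congr 1
  · rw [Finset.sum_comm]
    refine Finset.sum_congr rfl fun a _ => ?_
    rw [Finset.sum_comm]
    exact Finset.sum_congr rfl fun ν _ => hΦ.sum_rowF hf a ν (hΦ.smoothV_sig ν a) hft
  · congr 1
    · rw [Finset.sum_comm]
      refine Finset.sum_congr rfl fun m _ => ?_
      rw [Finset.sum_comm]
      exact Finset.sum_congr rfl fun β _ => sum_rowPsi m β _
    · rw [Finset.sum_comm]
      refine Finset.sum_congr rfl fun m _ => ?_
      rw [Finset.sum_comm]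
      exact Finset.sum_congr rfl fun β _ => sum_rowPsib m β _

/-- The contributions of `⟨T F F'⟩`. -/
theorem OnShell.sum_FF (hΦ : Φ.OnShell C S) {f : Mink × Mink → ℂ} (hft : IsTest f) :
    ∑ a, ∑ ν, -(1 / 2) * ∑ l, ((g ν : ℂ) * (g l : ℂ)) * dx l iDelta (fun p =>
          Φ.sig C S ν p.1 a * ((Φ.AAc C S ν l p.2 + Φ.AA C S ν l p.2) a * f p)) =
      -((1 / 2 : ℂ) • ∑ l, dxUp l (mul (fun x _ => ∑ κ, (g κ : ℂ) *
        ip (Φ.sig C S κ x) (Φ.AAc C S κ l x + Φ.AA C S κ l x)) iDelta)) f +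
      iDelta (fun p => (1 / 2) * (∑ ν, ∑ l, ((g ν : ℂ) * (g l : ℂ)) *
        ip (pdV l (Φ.sig C S ν) p.1) (Φ.AAc C S ν l p.1 + Φ.AA C S ν l p.1)) * f p) := by
  have ld := isLinear_iDelta
  have cs := fun ν a => hΦ.smoothV_sig ν a
  have cq : ∀ ν l a, ContDiff ℝ ∞ fun x => (Φ.AAc C S ν l x + Φ.AA C S ν l x) a := fun ν l a =>
    ((hΦ.smoothV_AAc ν l).add (hΦ.smoothV_AA ν l)) a
  have hf' : ∀ l, IsTest fun p => fderiv ℝ f p (Pi.single l 1, 0) := fun l => hft.fderiv_apply _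
  have t1 : ∀ ν l a, IsTest fun p => (pd l (fun y => Φ.sig C S ν y a) p.1 *
      (Φ.AAc C S ν l p.1 + Φ.AA C S ν l p.1) a) * f p := fun ν l a =>
    hft.fst_mul ((contDiff_pd (cs ν a) l).mul (cq ν l a))
  have t2 : ∀ ν l a, IsTest fun p => (Φ.sig C S ν p.1 a *
      (Φ.AAc C S ν l p.1 + Φ.AA C S ν l p.1) a) * fderiv ℝ f p (Pi.single l 1, 0) := fun ν l a =>
    (hf' l).fst_mul ((cs ν a).mul (cq ν l a))
  have e1 : iDelta (fun p => (1 / 2) * (∑ ν, ∑ l, ((g ν : ℂ) * (g l : ℂ)) *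
        ip (pdV l (Φ.sig C S ν) p.1) (Φ.AAc C S ν l p.1 + Φ.AA C S ν l p.1)) * f p) =
      ∑ a, ∑ ν, ∑ l, ((1 / 2) * ((g ν : ℂ) * (g l : ℂ))) *
        iDelta (fun p => (pd l (fun y => Φ.sig C S ν y a) p.1 *
          (Φ.AAc C S ν l p.1 + Φ.AA C S ν l p.1) a) * f p) := by
    simp only [← ld.map_const_mul (t1 _ _ _)]
    rw [Finset.sum_comm]
    simp only [Finset.sum_comm (s := (Finset.univ : Finset (Fin N)))]
    have t3 : ∀ ν l a, IsTest fun p => ((1 / 2) * ((g ν : ℂ) * (g l : ℂ))) *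
        ((pd l (fun y => Φ.sig C S ν y a) p.1 *
          (Φ.AAc C S ν l p.1 + Φ.AA C S ν l p.1) a) * f p) := fun ν l a => (t1 ν l a).const_mul _
    simp only [← ld.map_sum _ (t3 _ _)]
    simp only [← ld.map_sum _ fun l => IsTest.sum Finset.univ fun a _ => t3 _ l a]
    rw [← ld.map_sum _ fun ν => IsTest.sum Finset.univ fun l _ =>
      IsTest.sum Finset.univ fun a _ => t3 ν l a]
    congr 1
    funext p
    simp only [ip, pdV, Finset.mul_sum, Finset.sum_mul]
    refine Finset.sum_congr rfl fun ν _ => Finset.sum_congr rfl fun l _ =>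
      Finset.sum_congr rfl fun a _ => ?_
    ring
  have e2 : ∀ l, iDelta (fun p => (∑ κ, (g κ : ℂ) *
        ip (Φ.sig C S κ p.1) (Φ.AAc C S κ l p.1 + Φ.AA C S κ l p.1)) *
          fderiv ℝ f p (Pi.single l 1, 0)) =
      ∑ ν, ∑ a, (g ν : ℂ) * iDelta (fun p => (Φ.sig C S ν p.1 a *
        (Φ.AAc C S ν l p.1 + Φ.AA C S ν l p.1) a) * fderiv ℝ f p (Pi.single l 1, 0)) := by
    intro l
    simp only [← ld.map_const_mul (t2 _ _ _)]
    have t3 : ∀ ν a, IsTest fun p => (g ν : ℂ) * ((Φ.sig C S ν p.1 a *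
        (Φ.AAc C S ν l p.1 + Φ.AA C S ν l p.1) a) * fderiv ℝ f p (Pi.single l 1, 0)) := fun ν a =>
      (t2 ν l a).const_mul _
    simp only [← ld.map_sum _ (t3 _)]
    rw [← ld.map_sum _ fun ν => IsTest.sum Finset.univ fun a _ => t3 ν a]
    congr 1
    funext p
    simp only [ip, Finset.mul_sum, Finset.sum_mul]
    refine Finset.sum_congr rfl fun ν _ => Finset.sum_congr rfl fun a _ => ?_
    ring
  have e3 : (-((1 / 2 : ℂ) • ∑ l, dxUp l (mul (fun x _ => ∑ κ, (g κ : ℂ) *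
        ip (Φ.sig C S κ x) (Φ.AAc C S κ l x + Φ.AA C S κ l x)) iDelta)) : Bilocal) f =
      ∑ a, ∑ ν, ∑ l, ((1 / 2) * ((g ν : ℂ) * (g l : ℂ))) * iDelta (fun p => (Φ.sig C S ν p.1 a *
        (Φ.AAc C S ν l p.1 + Φ.AA C S ν l p.1) a) * fderiv ℝ f p (Pi.single l 1, 0)) := by
    simp only [Pi.neg_apply, Pi.smul_apply, Finset.sum_apply, dxUp, dx, mul, smul_eq_mul, e2]
    simp only [mul_neg, Finset.sum_neg_distrib, neg_neg, Finset.mul_sum]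
    calc _ = ∑ l, ∑ a, ∑ ν, 1 / 2 * ((g l : ℂ) * ((g ν : ℂ) * iDelta (fun p => (Φ.sig C S ν p.1 a *
        (Φ.AAc C S ν l p.1 + Φ.AA C S ν l p.1) a) * fderiv ℝ f p (Pi.single l 1, 0)))) :=
          Finset.sum_congr rfl fun l _ => Finset.sum_comm
      _ = ∑ a, ∑ l, ∑ ν, 1 / 2 * ((g l : ℂ) * ((g ν : ℂ) * iDelta (fun p => (Φ.sig C S ν p.1 a *
        (Φ.AAc C S ν l p.1 + Φ.AA C S ν l p.1) a) * fderiv ℝ f p (Pi.single l 1, 0)))) :=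
          Finset.sum_comm
      _ = _ := by
        refine Finset.sum_congr rfl fun a _ => ?_
        rw [Finset.sum_comm]
        refine Finset.sum_congr rfl fun ν _ => Finset.sum_congr rfl fun l _ => ?_
        ring
  rw [Pi.neg_apply] at e3
  rw [e1, e3]
  simp only [← Finset.sum_add_distrib, Finset.mul_sum]
  refine Finset.sum_congr rfl fun a _ => Finset.sum_congr rfl fun ν _ =>
    Finset.sum_congr rfl fun l _ => ?_
  rw [dx_iDelta_mul_mul (cs ν a) (cq ν l a) hft]
  ring

theorem OnShell.sum_sig_J (hΦ : Φ.OnShell C S) {J : Fin 4 → Mink → Fin N → ℂ}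
    (cJ : ∀ ν, SmoothV (J ν)) {f : Mink × Mink → ℂ} (hft : IsTest f) :
    ∑ a, ∑ ν, iDelta (fun p => Φ.sig C S ν p.1 a * (J ν p.2 a * f p)) =
      iDelta (fun p => (∑ ν, ip (Φ.sig C S ν p.1) (J ν p.1)) * f p) := by
  have ld := isLinear_iDelta
  have t : ∀ a ν, IsTest fun p => Φ.sig C S ν p.1 a * (J ν p.2 a * f p) := fun a ν =>
    (hft.snd_mul (cJ ν a)).fst_mul (hΦ.smoothV_sig ν a)
  simp only [← ld.map_sum _ (t _)]
  rw [← ld.map_sum _ fun a => IsTest.sum Finset.univ fun ν _ => t a ν]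
  refine iDelta_congr fun x => ?_
  simp only [ip, Finset.sum_mul]
  rw [Finset.sum_comm]
  exact Finset.sum_congr rfl fun ν _ => Finset.sum_congr rfl fun a _ => by ring

/-- Used twice: for `I'_c δ` with the current `J(c)` and for `I_u δ` with `J`. -/
theorem OnShell.sum_sig_dx (hΦ : Φ.OnShell C S) {J : Fin 4 → Mink → Fin N → ℂ}
    (cJ : ∀ ν, SmoothV (J ν)) (dJ : ∀ a x, ∑ κ, pd κ (fun y => J κ y a) x = 0)
    {D : Fin 4 → Bilocal} (lD : ∀ ν, (D ν).IsLinear) (tD : ∀ ν, (D ν).TranslationInvariant)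
    {f : Mink × Mink → ℂ} (hft : IsTest f) :
    ∑ a, ∑ ν, ∑ κ, dx κ (D ν) (fun p => Φ.sig C S ν p.1 a * (J κ p.2 a * f p)) =
      -(∑ κ, dx' κ (∑ ν, mul (fun x x' => ip (Φ.sig C S ν x) (J κ x')) (D ν))) f := by
  rw [Finset.sum_comm, Finset.sum_congr rfl fun ν _ => sum_dx_eq_neg_sum_dx'_mul (lD ν) (tD ν)
    (hΦ.smoothV_sig ν) cJ dJ hft]
  simp only [Finset.sum_neg_distrib, Finset.sum_apply, dx']
  rw [Finset.sum_comm]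

/-- The obstruction of the first-order interactions. -/
theorem OnShell.obstr_eqv (hΦ : Φ.OnShell C S) (hO : IsTwoPointObstruction C S O)
    {𝔤 : Type*} [LieRing 𝔤] [LieAlgebra ℂ 𝔤] (ξ : Module.Basis (Fin N) ℂ 𝔤)
    (π : 𝔤 →ₗ[ℂ] Matrix (Fin n) (Fin n) ℂ) (hπ : ∀ X Y, π ⁅X, Y⁆ = π X * π Y - π Y * π X)
    (hξ : ∀ a b, ⁅ξ a, ξ b⁆ = ∑ c, (Complex.I * (C.f a b c : ℂ)) • ξ c)
    (hf : ∀ a b c, C.f a b c = -C.f b a c ∧ C.f a b c = -C.f a c b)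
    (hτ : ∀ a, C.τ a = π (ξ a)) :
    (Φ.obstr S O (U1 C) (L1 C + K1 C)).Eqv
      (Φ.manifestTerms C S + mul (fun x _ => Φ.L2 C S x - Φ.K2 C S x) iDelta
        + mul (fun x _ => Φ.remaining C S x) iDelta) := by
  intro f hft
  have hf1 : ∀ a b c, C.f a b c = -C.f b a c := fun a b c => (hf a b c).1
  have ld := isLinear_iDelta
  have hquark : ∑ m, ∑ β, -delta (fun p => phiPsib C S Φ m β p.1 *
          (Φ.eval S (MvPolynomial.pderiv (.psib m β) (L1 C + K1 C)) p.2 * f p)) +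
        ∑ m, ∑ β, delta (fun p => phiPsi C S Φ m β p.1 *
          (Φ.eval S (MvPolynomial.pderiv (.psi m β) (L1 C + K1 C)) p.2 * f p)) =
      iDelta (fun p => (∑ ν, ip (Φ.sig C S ν p.1) (Φ.jUp C S ν p.1)) * f p) := by
    have l := isLinear_delta
    have t1 : ∀ m β, IsTest fun p => phiPsib C S Φ m β p.1 *
        (Φ.eval S (MvPolynomial.pderiv (.psib m β) (L1 C + K1 C)) p.2 * f p) := fun m β =>
      (hft.snd_mul (hΦ.contDiff_eval _)).fst_mul (hΦ.contDiff_phiPsib m β)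
    have t2 : ∀ m β, IsTest fun p => phiPsi C S Φ m β p.1 *
        (Φ.eval S (MvPolynomial.pderiv (.psi m β) (L1 C + K1 C)) p.2 * f p) := fun m β =>
      (hft.snd_mul (hΦ.contDiff_eval _)).fst_mul (hΦ.contDiff_phiPsi m β)
    have t1' := IsTest.sum Finset.univ fun m _ => IsTest.sum Finset.univ fun β _ => t1 m β
    have t2' := IsTest.sum Finset.univ fun m _ => IsTest.sum Finset.univ fun β _ => t2 m β
    have tj : IsTest fun p => (∑ ν, ip (Φ.sig C S ν p.1) (Φ.jUp C S ν p.1)) * f p :=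
      hft.fst_mul (ContDiff.sum fun ν _ => (hΦ.smoothV_sig ν).ip (hΦ.smoothV_jUp ν))
    simp only [Finset.sum_neg_distrib]
    simp only [← l.map_sum _ (t1 _), ← l.map_sum _ (t2 _)]
    rw [← l.map_sum _ fun m => IsTest.sum Finset.univ fun β _ => t1 m β,
      ← l.map_sum _ fun m => IsTest.sum Finset.univ fun β _ => t2 m β, iDelta_apply,
      neg_eq_neg_one_mul, ← l.map_const_mul t1', ← l.map_const_mul tj,
      ← l.map_add (t1'.const_mul _) t2']
    unfold delta
    congr 1
    funext x
    have := quark_terms (S := S) (Φ := Φ) ξ π hπ hξ hτ x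
    simp only [← mul_assoc, ← Finset.sum_mul]
    rw [← this]
    ring
  rw [hΦ.obstr_apply hO hf hft, hquark]
  simp only [Finset.sum_add_distrib, Finset.sum_sub_distrib]
  rw [hΦ.sum_FF hft]
  simp only [← Finset.mul_sum]
  rw [hΦ.sum_sig_J hΦ.smoothV_JcUp hft, hΦ.sum_sig_J hΦ.smoothV_JUp hft,
    hΦ.sum_sig_dx (D := fun ν => Complex.I • IcDelta' S ν) hΦ.smoothV_JcUp (hΦ.div_JcUp hf1)
      (fun ν => (isLinear_IcDelta S ν).swap.smul Complex.I)
      (fun ν => (translationInvariant_IcDelta S ν).swap.smul Complex.I) hft,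
    hΦ.sum_sig_dx (D := fun ν => Complex.I • IuDelta S ν) hΦ.smoothV_JUp (hΦ.div_JUp hf1)
      (fun ν => (isLinear_IuDelta S ν).smul Complex.I)
      (fun ν => (translationInvariant_IuDelta S ν).smul Complex.I) hft]
  have cloc : ContDiff ℝ ∞ fun x => (1 / 2 : ℂ) * ∑ ν, ∑ l, ((g ν : ℂ) * (g l : ℂ)) *
        ip (pdV l (Φ.sig C S ν) x) (Φ.AAc C S ν l x + Φ.AA C S ν l x) :=
    contDiff_const.mul (ContDiff.sum fun ν _ => ContDiff.sum fun l _ => contDiff_const.mul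
      (((hΦ.smoothV_sig ν).pdV l).ip ((hΦ.smoothV_AAc ν l).add (hΦ.smoothV_AA ν l))))
  have cJ : ∀ {J : Fin 4 → Mink → Fin N → ℂ}, (∀ ν, SmoothV (J ν)) →
      ContDiff ℝ ∞ fun x => ∑ ν, ip (Φ.sig C S ν x) (J ν x) := fun hJ =>
    ContDiff.sum fun ν _ => (hΦ.smoothV_sig ν).ip (hJ ν)
  have cip : ∀ {X Y : Mink → Fin N → ℂ}, SmoothV X → SmoothV Y → ContDiff ℝ ∞ fun x =>
      ip (X x) (Y x) := fun hX hY => hX.ip hY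
  have cL : ContDiff ℝ ∞ (Φ.L2 C S) := contDiff_const.mul (ContDiff.sum fun μ _ =>
    ContDiff.sum fun ν _ => contDiff_const.mul (cip (hΦ.smoothV_AAc μ ν) (hΦ.smoothV_AAc μ ν)))
  have cK : ContDiff ℝ ∞ (Φ.K2 C S) := contDiff_const.mul (ContDiff.sum fun μ _ =>
    ContDiff.sum fun ν _ => contDiff_const.mul (cip (hΦ.smoothV_AA μ ν) (hΦ.smoothV_AA μ ν)))
  have tloc := hft.fst_mul cloc
  have tJc := hft.fst_mul (cJ hΦ.smoothV_JcUp)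
  have tJ := hft.fst_mul (cJ hΦ.smoothV_JUp)
  have tj := hft.fst_mul (cJ hΦ.smoothV_jUp)
  -- The pointwise identity of the local terms is solved for `R`, and linearity of `iδ` then carries
  -- it over to distributions.
  have hR : (fun p : Mink × Mink => Φ.remaining C S p.1 * f p) = fun p =>
      (((1 / 2) * ∑ ν, ∑ l, ((g ν : ℂ) * (g l : ℂ)) *
        ip (pdV l (Φ.sig C S ν) p.1) (Φ.AAc C S ν l p.1 + Φ.AA C S ν l p.1)) * f p +
      ((-(1 / 2)) * ((∑ ν, ip (Φ.sig C S ν p.1) (Φ.JcUp C S ν p.1)) * f p) +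
      ((-(1 / 2)) * ((∑ ν, ip (Φ.sig C S ν p.1) (Φ.JUp C S ν p.1)) * f p) +
      ((∑ ν, ip (Φ.sig C S ν p.1) (Φ.jUp C S ν p.1)) * f p +
        (-1) * ((Φ.L2 C S p.1 - Φ.K2 C S p.1) * f p))))) := by
    funext p
    have h := hΦ.local_terms hf p.1
    simp only [← ipHom_apply, map_add, Finset.sum_add_distrib] at h ⊢
    linear_combination (-f p) * h
  have tLK : IsTest fun p => (Φ.L2 C S p.1 - Φ.K2 C S p.1) * f p := hft.fst_mul (cL.sub cK)
  have hRem : iDelta (fun p => Φ.remaining C S p.1 * f p) =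
      iDelta (fun p => ((1 / 2) * ∑ ν, ∑ l, ((g ν : ℂ) * (g l : ℂ)) *
        ip (pdV l (Φ.sig C S ν) p.1) (Φ.AAc C S ν l p.1 + Φ.AA C S ν l p.1)) * f p) +
      ((-(1 / 2)) * iDelta (fun p => (∑ ν, ip (Φ.sig C S ν p.1) (Φ.JcUp C S ν p.1)) * f p) +
      ((-(1 / 2)) * iDelta (fun p => (∑ ν, ip (Φ.sig C S ν p.1) (Φ.JUp C S ν p.1)) * f p) +
      (iDelta (fun p => (∑ ν, ip (Φ.sig C S ν p.1) (Φ.jUp C S ν p.1)) * f p) +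
        (-1) * iDelta (fun p => (Φ.L2 C S p.1 - Φ.K2 C S p.1) * f p)))) := by
    rw [hR, ld.map_add tloc ((tJc.const_mul _).add ((tJ.const_mul _).add (tj.add
        (tLK.const_mul _)))), ld.map_add (tJc.const_mul _) ((tJ.const_mul _).add (tj.add
        (tLK.const_mul _))), ld.map_add (tJ.const_mul _) (tj.add (tLK.const_mul _)),
      ld.map_add tj (tLK.const_mul _), ld.map_const_mul tJc, ld.map_const_mul tJ,
      ld.map_const_mul tLK]
  simp only [Pi.add_apply, manifestTerms, Pi.sub_apply, Pi.neg_apply, mul, Pi.smul_apply,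
    smul_eq_mul] at hRem ⊢
  rw [hRem]
  ring

end Config

/-! ### Symmetrization in `x` and `x'` -/

namespace Config

variable {N n : ℕ} {C : Consts N n} {S : Strings} {Φ : Config N n}

/-- The remaining terms as a symmetrized derivative. -/
theorem OnShell.remaining_eqv (hΦ : Φ.OnShell C S)
    (hR : ∀ x, Φ.remaining C S x = ∑ μ, pd μ (fun y => (1 / 6) * Φ.cubicPhi C S μ y) x) :
    (mul (fun x _ => Φ.remaining C S x) iDelta).Eqv
      (-(Complex.I • sym (∑ μ, dx μ
        (-((1 / 3 : ℂ) • mul (fun x _ => Φ.cubicPhi C S μ x) delta))))) := by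
  intro f hft
  have l := isLinear_delta
  have cc : ∀ μ, ContDiff ℝ ∞ fun y => (1 / 6) * Φ.cubicPhi C S μ y := fun μ =>
    contDiff_const.mul (hΦ.contDiff_cubicPhi μ)
  have t : ∀ μ, IsTest fun p => Φ.cubicPhi C S μ p.1 * fderiv ℝ f p (Pi.single μ 1, 0) := fun μ =>
    (hft.fderiv_apply _).fst_mul (hΦ.contDiff_cubicPhi μ)
  have t' : ∀ μ, IsTest fun p => Φ.cubicPhi C S μ p.1 * fderiv ℝ f p (0, Pi.single μ 1) := fun μ =>
    (hft.fderiv_apply _).fst_mul (hΦ.contDiff_cubicPhi μ)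
  have e1 : ∀ μ, delta (fun p => pd μ (fun y => (1 / 6) * Φ.cubicPhi C S μ y) p.1 * f p) =
      -(1 / 6) * delta (fun p => Φ.cubicPhi C S μ p.1 * fderiv ℝ f p (Pi.single μ 1, 0)) -
        (1 / 6) * delta (fun p => Φ.cubicPhi C S μ p.1 * fderiv ℝ f p (0, Pi.single μ 1)) := by
    intro μ
    rw [delta_fst_mul_pd (cc μ) hft]
    simp only [mul_assoc (1 / 6 : ℂ)]
    rw [l.map_const_mul (t μ), l.map_const_mul (t' μ)]
    ring
  -- Exchange of the arguments turns `∂` into `∂'` on the diagonal, so the symmetrized derivative is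
  -- half of `∂ + ∂'`, and `1/2 · 1/3 = 1/6`.
  have e2 : ∀ μ, delta (fun p => Φ.cubicPhi C S μ p.1 *
      fderiv ℝ (fun p => f (p.2, p.1)) p (Pi.single μ 1, 0)) =
      delta (fun p => Φ.cubicPhi C S μ p.1 * fderiv ℝ f p (0, Pi.single μ 1)) := by
    intro μ
    simp only [fderiv_swap hft]
    rfl
  simp only [mul, hR, Finset.sum_mul, iDelta_apply]
  rw [l.map_sum _ fun μ => hft.fst_mul (contDiff_pd (cc μ) μ)]
  simp only [e1, sym, swap, Pi.neg_apply, Pi.smul_apply, Pi.add_apply, Finset.sum_apply, dx,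
    smul_eq_mul, mul, e2, Finset.sum_sub_distrib, neg_neg, ← Finset.mul_sum]
  ring

/-- The manifest derivative terms are, up to exchange of `x` and `x'`, those of `U_2`. -/
theorem OnShell.manifestTerms_add_swap (hΦ : Φ.OnShell C S)
    (hf : ∀ a b c, C.f a b c = -C.f b a c) {f : Mink × Mink → ℂ} (hft : IsTest f) :
    Φ.manifestTerms C S f + Φ.manifestTerms C S (fun p => f (p.2, p.1)) =
      -(2 * (Complex.I • sym (∑ μ, dx μ (Φ.U2 C S μ +
        (1 / 3 : ℂ) • mul (fun x _ => Φ.cubicPhi C S μ x) delta))) f) := by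
  -- This term matches `U_2` without exchange; the sign comes from reordering the antisymmetric
  -- indices.
  have local_term : ∀ {k : Mink × Mink → ℂ}, IsTest k → -((1 / 2 : ℂ) • ∑ l, dxUp l (mul (fun x _ =>
      ∑ κ, (g κ : ℂ) * ip (Φ.sig C S κ x) (Φ.AAc C S κ l x + Φ.AA C S κ l x)) iDelta)) k =
      -(Complex.I * ∑ μ, dx μ (-((1 / 2 : ℂ) • mul (fun x _ => ∑ ν, ((g μ * g ν : ℝ) : ℂ) *
        ip (Φ.AAc C S μ ν x + Φ.AA C S μ ν x) (Φ.sig C S ν x)) delta)) k) := by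
    intro k hk
    have e : ∀ l, (fun p => (∑ ν, ((g l * g ν : ℝ) : ℂ) *
        ip (Φ.AAc C S l ν p.1 + Φ.AA C S l ν p.1) (Φ.sig C S ν p.1)) *
          fderiv ℝ k p (Pi.single l 1, 0)) = fun p => -(g l : ℂ) * ((∑ κ, (g κ : ℂ) *
        ip (Φ.sig C S κ p.1) (Φ.AAc C S κ l p.1 + Φ.AA C S κ l p.1)) *
          fderiv ℝ k p (Pi.single l 1, 0)) := by
      intro l
      funext p
      simp only [Finset.mul_sum, Finset.sum_mul]
      refine Finset.sum_congr rfl fun ν _ => ?_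
      rw [AAc_antisymm hf l ν, ← ipHom_apply (Φ.sig C S ν p.1), map_neg, ipHom_apply,
        ip_comm (Φ.sig C S ν p.1)]
      push_cast
      ring
    have ct : ∀ l, IsTest fun p => (∑ κ, (g κ : ℂ) *
        ip (Φ.sig C S κ p.1) (Φ.AAc C S κ l p.1 + Φ.AA C S κ l p.1)) *
          fderiv ℝ k p (Pi.single l 1, 0) := fun l =>
      (hk.fderiv_apply _).fst_mul (ContDiff.sum fun κ _ => contDiff_const.mul
        ((hΦ.smoothV_sig κ).ip ((hΦ.smoothV_AAc κ l).add (hΦ.smoothV_AA κ l))))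
    simp only [Pi.smul_apply, Pi.neg_apply, Finset.sum_apply, dxUp, dx, mul, smul_eq_mul, e,
      isLinear_delta.map_const_mul (ct _), iDelta_apply, Finset.mul_sum, ← Finset.sum_neg_distrib]
    exact Finset.sum_congr rfl fun l _ => by ring
  -- The string terms match only after exchange of `x` and `x'`: `∂'` becomes `∂`, `I'_c δ` becomes
  -- `I_c δ`, and below `I_u δ` becomes `I'_u δ`. Hence the equality with `U_2` holds for
  -- symmetrized distributions.
  have Jc_term : ∀ {k : Mink × Mink → ℂ}, IsTest k →
      -((1 / 2 : ℂ) • (∑ κ, dx' κ (∑ ν, mul (fun x x' => ip (Φ.sig C S ν x) (Φ.JcUp C S κ x'))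
        (Complex.I • IcDelta' S ν)))) k =
      -(Complex.I * ∑ μ, dx μ ((1 / 2 : ℂ) • (∑ κ, mul (fun x x' =>
        ip (Φ.JcUp C S μ x) (Φ.sig C S κ x')) (IcDelta S κ))) (fun p => k (p.2, p.1))) := by
    intro k hk
    simp only [Pi.smul_apply, Finset.sum_apply, dx, dx', mul, smul_eq_mul, IcDelta', swap,
      Finset.mul_sum, ← Finset.sum_neg_distrib, fderiv_swap hk]
    refine Finset.sum_congr rfl fun κ _ => Finset.sum_congr rfl fun ν _ => ?_
    simp only [ip_comm (Φ.JcUp C S κ _)]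
    ring
  have J_term : ∀ {k : Mink × Mink → ℂ}, IsTest k →
      ((1 / 2 : ℂ) • (∑ κ, dx' κ (∑ ν, mul (fun x x' => ip (Φ.sig C S ν x) (Φ.JUp C S κ x'))
        (Complex.I • IuDelta S ν)))) k =
      -(Complex.I * ∑ μ, dx μ (-((1 / 2 : ℂ) • (∑ κ, mul (fun x x' =>
        ip (Φ.JUp C S μ x) (Φ.sig C S κ x')) (IuDelta' S κ)))) (fun p => k (p.2, p.1))) := by
    intro k hk
    simp only [Pi.smul_apply, Pi.neg_apply, Finset.sum_apply, dx, dx', mul, smul_eq_mul, IuDelta',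
      swap, Finset.mul_sum, ← Finset.sum_neg_distrib, fderiv_swap hk]
    refine Finset.sum_congr rfl fun κ _ => Finset.sum_congr rfl fun ν _ => ?_
    simp only [ip_comm (Φ.JUp C S κ _)]
    ring
  have split : ∀ k : Mink × Mink → ℂ, (∑ μ, dx μ (Φ.U2 C S μ +
        (1 / 3 : ℂ) • mul (fun x _ => Φ.cubicPhi C S μ x) delta)) k =
      ∑ μ, dx μ ((1 / 2 : ℂ) • (∑ κ, mul (fun x x' =>
        ip (Φ.JcUp C S μ x) (Φ.sig C S κ x')) (IcDelta S κ))) k +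
      ∑ μ, dx μ (-((1 / 2 : ℂ) • (∑ κ, mul (fun x x' =>
        ip (Φ.JUp C S μ x) (Φ.sig C S κ x')) (IuDelta' S κ)))) k +
      ∑ μ, dx μ (-((1 / 2 : ℂ) • mul (fun x _ => ∑ ν, ((g μ * g ν : ℝ) : ℂ) *
        ip (Φ.AAc C S μ ν x + Φ.AA C S μ ν x) (Φ.sig C S ν x)) delta)) k := by
    intro k
    simp only [← Finset.sum_add_distrib, Finset.sum_apply]
    refine Finset.sum_congr rfl fun μ _ => ?_
    simp only [U2, dx, Pi.add_apply, Pi.sub_apply, Pi.neg_apply]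
    ring
  have m : ∀ {k : Mink × Mink → ℂ}, IsTest k → Φ.manifestTerms C S k = _ := fun {k} hk => by
    have h1 := local_term hk
    have h2 := Jc_term hk
    have h3 := J_term hk
    simp only [manifestTerms, Pi.add_apply, Pi.sub_apply, Pi.neg_apply] at h1 h2 h3 ⊢
    rw [sub_eq_add_neg, h1, h2, h3]
  rw [m hft, m hft.swap]
  simp only [Pi.smul_apply, sym, swap, Pi.add_apply, smul_eq_mul]
  rw [split, split]
  simp only [Prod.mk.eta]
  ring

end Config

end StringQCD

theorem propositionp {N n : ℕ} {𝔤 : Type*} [LieRing 𝔤] [LieAlgebra ℂ 𝔤]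
    (C : Consts N n) (S : Strings)
    -- generators, totally antisymmetric structure constants, quark representation
    (ξ : Module.Basis (Fin N) ℂ 𝔤) (π : 𝔤 →ₗ[ℂ] Matrix (Fin n) (Fin n) ℂ)
    (hπ : ∀ X Y, π ⁅X, Y⁆ = π X * π Y - π Y * π X)
    (hξ : ∀ a b, ⁅ξ a, ξ b⁆ = ∑ c, (Complex.I * (C.f a b c : ℂ)) • ξ c)
    (hf : ∀ a b c, C.f a b c = -C.f b a c ∧ C.f a b c = -C.f a c b)
    (hτ : ∀ a, C.τ a = π (ξ a))
    -- Dirac matrices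
    (hγ : ∀ μ ν, C.γ μ * C.γ ν + C.γ ν * C.γ μ = (2 * eta μ ν) • (1 : Matrix (Fin 4) (Fin 4) ℂ))
    -- two-point obstructions
    (O : Fin 4 → Fld N n → Fld N n → Bilocal) (hO : IsTwoPointObstruction C S O)
    -- free fields
    (Φ : Config N n) (hΦ : Φ.OnShell C S) :
    -- the obstruction, and its remaining terms
    (Φ.obstr S O (U1 C) (L1 C + K1 C)).Eqv
      (Φ.manifestTerms C S
        + Bilocal.mul (fun x _ => Φ.L2 C S x - Φ.K2 C S x) Bilocal.iDelta
        + Bilocal.mul (fun x _ => Φ.remaining C S x) Bilocal.iDelta) ∧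
    -- the remaining terms are total derivatives and give the last term of `U_2`
    (∀ x, Φ.remaining C S x = ∑ μ, pd μ (fun y => (1 / 6) * Φ.cubicPhi C S μ y) x) ∧
    (Bilocal.mul (fun x _ => Φ.remaining C S x) Bilocal.iDelta).Eqv
      (-(Complex.I • Bilocal.sym (∑ μ, Bilocal.dx μ
        (-((1 / 3 : ℂ) • Bilocal.mul (fun x _ => Φ.cubicPhi C S μ x) Bilocal.delta))))) ∧
    -- the second-order obstruction is resolved by `L_2`, `K_2` and `U_2`
    (Bilocal.sym (Φ.obstr S O (U1 C) (L1 C + K1 C))).Eqv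
      (Bilocal.mul (fun x _ => Φ.L2 C S x - Φ.K2 C S x) Bilocal.iDelta
        - Complex.I • Bilocal.sym (∑ μ, Bilocal.dx μ (Φ.U2 C S μ))) := by
  have hR := hΦ.remaining_eq hf (br_jacobi ξ hξ)
  have h1 := hΦ.obstr_eqv hO ξ π hπ hξ hf hτ
  have h3 := hΦ.remaining_eqv hR
  refine ⟨h1, hR, h3, fun f hft => ?_⟩
  have hM := hΦ.manifestTerms_add_swap (fun a b c => (hf a b c).1) hft
  have o1 := h1 f hft
  have o2 := h1 _ hft.swap
  have r1 := h3 f hft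
  -- Local terms `k iδ` are already symmetric, so symmetrization leaves `L_2 - K_2` and `R`
  -- unchanged.
  have diag : ∀ k : Mink → ℂ, Bilocal.mul (fun x _ => k x) Bilocal.iDelta (fun p => f (p.2, p.1)) =
      Bilocal.mul (fun x _ => k x) Bilocal.iDelta f := fun k =>
    Bilocal.iDelta_congr fun x => rfl
  simp only [Bilocal.sym, Bilocal.swap, Pi.add_apply, Pi.sub_apply, Pi.neg_apply, Pi.smul_apply,
    Finset.sum_apply, Bilocal.dx, smul_eq_mul, diag, Finset.sum_add_distrib, neg_add, neg_neg,
    Finset.sum_neg_distrib] at hM o1 o2 r1 ⊢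
  rw [o1, o2]
  linear_combination (1 / 2 : ℂ) * hM + r1
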